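/- Consider the one-dimensional abcd Boussinesq system, normalized to $b=d=1$, $$(1-\partial_x^2)\partial_t\eta+\partial_x\bigl(a\,\partial_x^2u+u+u\eta\bigr)=0,\qquad (1-\partial_x^2)\partial_tu+\partial_x\bigl(c\,\partial_x^2\eta+\eta+\tfrac12u^2\bigr)=0,\qquad (t,x)\in\mathbb R\times\mathbb R,$$ for real-valued $u,\eta$. Let $(a,b,c)$ be dispersion-like parameters, that is, $a,c<0$, $b>0$, there is $\theta\in[0,1]$ with $a+1=\frac1{2b}(\theta^2-\frac13)$ and $c+1=\frac1{2b}(1-\theta^2)$, and $3(a+c)+2<8ac$. A global $H^1\times H^1$ solution is a pair $(u,\eta)\in C(\mathbb R,H^1(\mathbb R)\times H^1(\mathbb R))$ that satisfies the system in the sense of distributions. There is $\varepsilon_0>0$, depending only on $(a,b,c)$, such that the following holds. (1) There are $\lambda_0>0$ and $C>0$, depending only on $(a,b,c)$, such that for every $\lambda\ge\lambda_0$, every $0<\varepsilon\le\varepsilon_0$ and every global $H^1\times H^1$ solution with $\|(u,\eta)(t=0)\|_{H^1\times H^1}<\varepsilon$, $$\int_2^\infty\!\!\int_{\mathbb R}\operatorname{sech}^2\Bigl(\frac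 x\lambda\Bigr)\bigl(u^2+(\partial_xu)^2+\eta^2+(\partial_x\eta)^2\bigr)(t,x)\,dx\,dt\le C\lambda\varepsilon^2,$$ and there is an increasing sequence of times $t_n\ge2$, $t_n\to\infty$, with $$\int_{\mathbb R}\operatorname{sech}^2\Bigl(\frac x\lambda\Bigr)\bigl(u^2+(\partial_xu)^2+\eta^2+(\partial_x\eta)^2\bigr)(t_n,x)\,dx\to0.$$ (2) For every $C_0>0$ there is $C>0$, depending only on $(a,b,c)$ and $C_0$, such that, with $\lambda(t)=C_0t/\log^2t$ for $t\ge 2$, for every $0<\varepsilon\le\varepsilon_0$ and every global $H^1\times H^1$ solution with $\|(u,\eta)(t=0)\|_{H^1\times H^1}<\varepsilon$, $$\int_2^\infty\frac1{\lambda(t)}\int_{\mathbb R}\operatorname{sech}^2\Bigl(\frac x{\lambda(t)}\Bigr)\bigl(u^2+(\partial_xu)^2+\eta^2+(\partial_x\eta)^2\bigr)(t,x)\,dx\,dt\le C\varepsilon^2,$$ and there is an increasing sequence of times $t_n\ge2$, $t_n\to\infty$, with $$\int_{\mathbb R}\operatorname{sech}^2\Bigl(\frac x{\lambda(t_n)}\Bigr)\bigl(u^2+(\partial_xu)^2+\eta^2+(\partial_x\eta)^2\bigr)(t_n,x)\,dx\to0.$$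 -/

import Mathlib

open MeasureTheory Filter Topology Set
open scoped ContDiff

noncomputable section

namespace ABCDBoussinesq

/-- The real Lebesgue space `L²(ℝ)`. -/
abbrev L2 : Type := Lp ℝ 2 (volume : Measure ℝ)

/-- The Hilbert space `L²(ℝ) × L²(ℝ)`, with `‖(f, g)‖² = ‖f‖² + ‖g‖²`. -/
abbrev L2Pair : Type := WithLp 2 (L2 × L2)

/-- `g` is the distributional derivative of `f` on `ℝ`. -/
def IsWeakDeriv (f g : ℝ → ℝ) : Prop :=
  ∀ ψ : ℝ → ℝ, ContDiff ℝ ∞ ψ → HasCompactSupport ψ →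
    ∫ x, f x * deriv ψ x = - ∫ x, g x * ψ x

/-- An `L²` function times a continuous compactly supported function is integrable. -/
theorem integrable_mul_test (f : L2) {ψ : ℝ → ℝ} (hψ : Continuous ψ)
    (hc : HasCompactSupport ψ) : Integrable (fun x => f x * ψ x) :=
  (Lp.memLp f).integrable_mul (hψ.memLp_of_hasCompactSupport (p := 2) hc)

/-- The Sobolev space `H¹(ℝ)` of real-valued functions: the pairs `(f, f')` with `f ∈ L²` whose
distributional derivative `f'` is in `L²`, so that `‖f‖²_{H¹} = ‖f‖²_{L²} + ‖f'‖²_{L²}`. -/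
def H1 : Submodule ℝ L2Pair where
  carrier := {p | IsWeakDeriv p.fst p.snd}
  zero_mem' := by
    intro ψ _ _
    have h0 : ((0 : L2) : ℝ → ℝ) =ᵐ[volume] 0 := Lp.coeFn_zero ℝ 2 volume
    have h1 : ∀ φ : ℝ → ℝ, ∫ x, ((0 : L2) : ℝ → ℝ) x * φ x = 0 := fun φ => by
      rw [integral_congr_ae (g := fun _ => (0 : ℝ)) (by
        filter_upwards [h0] with x hx
        rw [hx, Pi.zero_apply, zero_mul])]
      simp
    simp only [WithLp.zero_fst, WithLp.zero_snd, h1, neg_zero]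
  add_mem' := by
    intro p q hp hq ψ hψ hc
    have hd : Continuous (deriv ψ) := hψ.continuous_deriv (by simp)
    have key : ∀ (f g : L2) (φ : ℝ → ℝ), Continuous φ → HasCompactSupport φ →
        ∫ x, ((f + g : L2) : ℝ → ℝ) x * φ x = (∫ x, f x * φ x) + ∫ x, g x * φ x := by
      intro f g φ h h'
      rw [← integral_add (integrable_mul_test f h h') (integrable_mul_test g h h')]
      refine integral_congr_ae ?_
      filter_upwards [Lp.coeFn_add f g] with x hx
      rw [hx, Pi.add_apply, add_mul]
    rw [WithLp.add_fst, WithLp.add_snd, key _ _ _ hd hc.deriv, key _ _ _ hψ.continuous hc,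
      hp ψ hψ hc, hq ψ hψ hc]
    ring
  smul_mem' := by
    intro r p hp ψ hψ hc
    have key : ∀ (f : L2) (φ : ℝ → ℝ),
        ∫ x, ((r • f : L2) : ℝ → ℝ) x * φ x = r * ∫ x, f x * φ x := by
      intro f φ
      rw [← integral_const_mul]
      refine integral_congr_ae ?_
      filter_upwards [Lp.coeFn_smul r f] with x hx
      rw [hx, Pi.smul_apply, smul_eq_mul, mul_assoc]
    rw [WithLp.smul_fst, WithLp.smul_snd, key, key, hp ψ hψ hc]
    ring

/-- The function underlying an element of `H¹`. -/
def val (p : H1) : ℝ → ℝ := (p : L2Pair).fst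

/-- The weak derivative `∂ₓ` of an element of `H¹`. -/
def dx (p : H1) : ℝ → ℝ := (p : L2Pair).snd

/-- `(u, η) ∈ C(ℝ, H¹ × H¹)` solves, in the sense of distributions,
`(1 - ∂ₓ²) ∂ₜ η + ∂ₓ (a ∂ₓ² u + u + u η) = 0` and
`(1 - ∂ₓ²) ∂ₜ u + ∂ₓ (c ∂ₓ² η + η + u² / 2) = 0` on `ℝ × ℝ`:
for each test function `ψ` in the space variable, the pairing of `(1 - ∂ₓ²) η(t)` with `ψ` is
differentiable in time and its derivative is the pairing of `-∂ₓ (a ∂ₓ² u + u + u η)(t)` with `ψ`,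
and likewise for the other equation. -/
structure IsGlobalSolution (a c : ℝ) (u η : ℝ → H1) : Prop where
  continuous_u : Continuous u
  continuous_eta : Continuous η
  eq_eta : ∀ ψ : ℝ → ℝ, ContDiff ℝ ∞ ψ → HasCompactSupport ψ → ∀ t : ℝ,
    HasDerivAt (fun s => ∫ x, val (η s) x * (ψ x - deriv (deriv ψ) x))
      (∫ x, ((val (u t) x + val (u t) x * val (η t) x) * deriv ψ x
        - a * dx (u t) x * deriv (deriv ψ) x)) t
  eq_u : ∀ ψ : ℝ → ℝ, ContDiff ℝ ∞ ψ → HasCompactSupport ψ → ∀ t : ℝ,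
    HasDerivAt (fun s => ∫ x, val (u s) x * (ψ x - deriv (deriv ψ) x))
      (∫ x, ((val (η t) x + (1 / 2) * val (u t) x ^ 2) * deriv ψ x
        - c * dx (η t) x * deriv (deriv ψ) x)) t

/-- The norm of `(u, η)` in `H¹ × H¹`. -/
def pairNorm (u η : H1) : ℝ := Real.sqrt (‖u‖ ^ 2 + ‖η‖ ^ 2)

/-- Dispersion-like parameters of the system normalized to `b = d = 1`. Here `b > 0` is the
original coefficient, and `a`, `c` are the original ones divided by `b`. -/
structure DispersionLike (a b c : ℝ) : Prop where
  a_neg : a < 0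
  c_neg : c < 0
  b_pos : 0 < b
  exists_theta : ∃ θ ∈ Icc (0 : ℝ) 1,
    a + 1 = 1 / (2 * b) * (θ ^ 2 - 1 / 3) ∧ c + 1 = 1 / (2 * b) * (1 - θ ^ 2)
  dispersion : 3 * (a + c) + 2 < 8 * a * c

/-- `∫ sech²(x / ℓ) (u² + (∂ₓ u)² + η² + (∂ₓ η)²) dx`. -/
def localEnergy (ℓ : ℝ) (u η : H1) : ℝ :=
  ∫ x, (1 / Real.cosh (x / ℓ)) ^ 2 *
    (val u x ^ 2 + dx u x ^ 2 + val η x ^ 2 + dx η x ^ 2)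

/-- The time-dependent scale `C₀ t / log² t`. -/
def growingScale (C₀ t : ℝ) : ℝ := C₀ * t / Real.log t ^ 2

end ABCDBoussinesq

end

noncomputable section

namespace ABCDBoussinesq

open scoped BoundedContinuousFunction InnerProductSpace

/-! Write G = (1 - ∂ₓ²)⁻¹. Splitting ∂ₓ² = 1 - (1 - ∂ₓ²) turns the system into uₜ = c ηₓ - (1+c)
∂ₓGη - ∂ₓG(u²/2), ηₜ = a uₓ - (1+a) ∂ₓGu - ∂ₓG(uη). It is Hamiltonian with skew operator -∂ₓG. As a,
c < 0, the conserved energy is comparable to the squared H¹ norm near zero, so small solutions stay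
of size O(ε) for all times (`exists_uniform_bound`).

Decay comes from the virial functional I = ∫ φ (uη + uₓηₓ) + k ∫ φ' η uₓ with φ = tanh(x/λ), which
is O(ε²). The second term moves coercivity between uₓ² and ηₓ². The quadratic part of I' splits into
a form in u and a form in η. Put z = Gu, α = -a, m = 2k, y = ξ²; with the weight frozen, twice the
form in u has symbol (1+y)(1 + (3α-1-m) y + α(1-m) y²), and the form in η has the same symbol with γ
= -c and -m in place of α and m. The dispersion condition provides an m for which both are positive
on y ≥ 0 (`exists_multiplier`). A sum of squares carries this to physical space
(`virial_form_coercive`). Variation of the weight costs O(1/λ), and the cubic terms cost O(‖u‖_∞) by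
a weighted elliptic estimate (`wn_gre_le`). Hence I' dominates the local energy
(`exists_virialRate_ge`), and integration in time gives the fixed-scale bound.

When λ = λ(t), the motion of the weights adds a term of size 1/t. By Young's inequality, part of it
is absorbed and the rest is O(ε²/(t log² t)); its integrability is the reason for the scale t/log² t
(`exists_growing_bound`). The sequences of times exist because 1/t is not integrable at infinity.

At H¹ regularity, uₓ and ηₓ need not be differentiable in time in L². The identities above are
therefore obtained from difference quotients and from a product rule using two topologies
(`hasDerivAt_inner_dL_dL`, `hasDerivAt_mixed`). -/

/-! ### Multiplication, translation and testing in L². -/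

theorem inner_eq_integral (f g : L2) : ⟪f, g⟫_ℝ = ∫ x, f x * g x := by
  rw [L2.inner_def]
  exact integral_congr_ae (Eventually.of_forall fun x => by simp [mul_comm])

theorem memLp_weight (w : ℝ →ᵇ ℝ) (f : L2) : MemLp (fun x => w x * f x) 2 volume :=
  (Lp.memLp f).of_le_mul (c := ‖w‖)
    (w.continuous.aestronglyMeasurable.mul (Lp.memLp f).1)
    (Eventually.of_forall fun x => by
      rw [norm_mul]; exact mul_le_mul_of_nonneg_right (w.norm_coe_le_norm x) (norm_nonneg _))

/-- Pointwise multiplication of an `L²` function by a bounded continuous function. -/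
def mulL : (ℝ →ᵇ ℝ) →L[ℝ] L2 →L[ℝ] L2 :=
  have hm := memLp_weight
  LinearMap.mkContinuous₂
    (LinearMap.mk₂ ℝ (fun w f => (hm w f).toLp _)
      (fun w w' f => by
        apply Lp.ext
        filter_upwards [(hm (w + w') f).coeFn_toLp, (hm w f).coeFn_toLp, (hm w' f).coeFn_toLp,
          Lp.coeFn_add ((hm w f).toLp _) ((hm w' f).toLp _)] with x h1 h2 h3 h4
        rw [h1, h4, Pi.add_apply, h2, h3, BoundedContinuousFunction.add_apply, add_mul])
      (fun r w f => by
        apply Lp.ext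
        filter_upwards [(hm (r • w) f).coeFn_toLp, (hm w f).coeFn_toLp,
          Lp.coeFn_smul r ((hm w f).toLp _)] with x h1 h2 h4
        rw [h1, h4, Pi.smul_apply, h2, BoundedContinuousFunction.smul_apply, smul_eq_mul,
          smul_eq_mul, mul_assoc])
      (fun w f g => by
        apply Lp.ext
        filter_upwards [(hm w (f + g)).coeFn_toLp, (hm w f).coeFn_toLp, (hm w g).coeFn_toLp,
          Lp.coeFn_add ((hm w f).toLp _) ((hm w g).toLp _), Lp.coeFn_add f g] with x h1 h2 h3 h4 h5
        rw [h1, h4, Pi.add_apply, h2, h3, h5, Pi.add_apply, mul_add])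
      (fun r w f => by
        apply Lp.ext
        filter_upwards [(hm w (r • f)).coeFn_toLp, (hm w f).coeFn_toLp,
          Lp.coeFn_smul r ((hm w f).toLp (fun x => w x * f x)),
          Lp.coeFn_smul r f] with x h1 h2 h4 h5
        rw [h1, h4, Pi.smul_apply, h2, h5, Pi.smul_apply, smul_eq_mul, smul_eq_mul]
        ring))
    1 (fun w f => by
      rw [one_mul, LinearMap.mk₂_apply]
      apply Lp.norm_le_mul_norm_of_ae_le_mul
      filter_upwards [(hm w f).coeFn_toLp] with x h1
      rw [h1, norm_mul]
      exact mul_le_mul_of_nonneg_right (w.norm_coe_le_norm x) (norm_nonneg _))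

theorem coeFn_mulL (w : ℝ →ᵇ ℝ) (f : L2) : mulL w f =ᵐ[volume] fun x => w x * f x :=
  MemLp.coeFn_toLp (memLp_weight w f)

theorem norm_mulL_le (w : ℝ →ᵇ ℝ) (f : L2) : ‖mulL w f‖ ≤ ‖w‖ * ‖f‖ := by
  apply Lp.norm_le_mul_norm_of_ae_le_mul
  filter_upwards [coeFn_mulL w f] with x h1
  rw [h1, norm_mul]
  exact mul_le_mul_of_nonneg_right (w.norm_coe_le_norm x) (norm_nonneg _)

theorem integrable_mul (f g : L2) : Integrable (fun x => f x * g x) :=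
  (Lp.memLp f).integrable_mul (Lp.memLp g)

theorem integrable_weight (w : ℝ →ᵇ ℝ) (f g : L2) : Integrable (fun x => w x * (f x * g x)) :=
  (integrable_mul f g).bdd_mul w.continuous.aestronglyMeasurable
    (Eventually.of_forall fun x => w.norm_coe_le_norm x)

theorem inner_mulL (w : ℝ →ᵇ ℝ) (f g : L2) : ⟪mulL w f, g⟫_ℝ = ∫ x, w x * (f x * g x) := by
  rw [inner_eq_integral]
  refine integral_congr_ae ?_
  filter_upwards [coeFn_mulL w f] with x h
  rw [h]; ring

theorem inner_mulL_right (w : ℝ →ᵇ ℝ) (f g : L2) : ⟪f, mulL w g⟫_ℝ = ⟪mulL w f, g⟫_ℝ := by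
  rw [real_inner_comm, inner_mulL, inner_mulL]
  congr 1; ext x; ring

theorem mulL_mul (v w : ℝ →ᵇ ℝ) (f : L2) : mulL (v * w) f = mulL v (mulL w f) := by
  apply Lp.ext
  filter_upwards [coeFn_mulL (v * w) f, coeFn_mulL v (mulL w f), coeFn_mulL w f] with x h1 h2 h3
  rw [h1, h2, h3, BoundedContinuousFunction.mul_apply]; ring

theorem measurePreserving_add (h : ℝ) : MeasurePreserving (fun x : ℝ => x + h) volume volume :=
  measurePreserving_add_right volume h

/-- Translation `f ↦ f (· + h)` on `L²`. -/
def trans (h : ℝ) : L2 →L[ℝ] L2 :=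
  (Lp.compMeasurePreservingₗᵢ ℝ (fun x : ℝ => x + h)
    (measurePreserving_add h)).toContinuousLinearMap

theorem coeFn_trans (h : ℝ) (f : L2) : trans h f =ᵐ[volume] fun x => f (x + h) :=
  Lp.coeFn_compMeasurePreserving f (measurePreserving_add h)

theorem norm_trans (h : ℝ) (f : L2) : ‖trans h f‖ = ‖f‖ :=
  Lp.norm_compMeasurePreserving f (measurePreserving_add h)

theorem trans_add (h k : ℝ) (f : L2) : trans (h + k) f = trans h (trans k f) := by
  apply Lp.ext
  have := (measurePreserving_add h).quasiMeasurePreserving.ae_eq (coeFn_trans k f)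
  filter_upwards [coeFn_trans (h + k) f, coeFn_trans h (trans k f), this] with x h1 h2 h3
  rw [h1, h2]
  simp only [Function.comp_apply] at h3
  rw [h3, add_assoc]

theorem trans_zero (f : L2) : trans 0 f = f := by
  apply Lp.ext
  filter_upwards [coeFn_trans 0 f] with x h1
  rw [h1, add_zero]

theorem continuous_trans (f : L2) : Continuous fun h => trans h f := by
  have : Continuous fun h : ℝ => (ContinuousMap.mk (fun x : ℝ => x + h) (by fun_prop)) :=
    ContinuousMap.continuous_of_continuous_uncurry _ (by
      change Continuous fun p : ℝ × ℝ => p.2 + p.1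
      fun_prop)
  exact (continuous_const (y := f)).compMeasurePreservingLp this
    (fun h => measurePreserving_add h) (by norm_num)

theorem inner_trans_trans (h : ℝ) (f g : L2) : ⟪trans h f, trans h g⟫_ℝ = ⟪f, g⟫_ℝ :=
  (Lp.compMeasurePreservingₗᵢ ℝ (fun x : ℝ => x + h) (measurePreserving_add h)).inner_map_map f g

theorem inner_trans_left (h : ℝ) (f g : L2) : ⟪trans h f, g⟫_ℝ = ⟪f, trans (-h) g⟫_ℝ := by
  rw [← inner_trans_trans (-h), ← trans_add, neg_add_cancel, trans_zero]

/-- A compactly supported smooth function as an element of `L²`. -/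
def testL (ψ : ℝ → ℝ) (h : Continuous ψ) (hc : HasCompactSupport ψ) : L2 :=
  (h.memLp_of_hasCompactSupport (p := 2) hc).toLp ψ

theorem coeFn_testL {ψ : ℝ → ℝ} (h : Continuous ψ) (hc : HasCompactSupport ψ) :
    testL ψ h hc =ᵐ[volume] ψ := MemLp.coeFn_toLp _

theorem inner_testL (f : L2) {ψ : ℝ → ℝ} (h : Continuous ψ) (hc : HasCompactSupport ψ) :
    ⟪f, testL ψ h hc⟫_ℝ = ∫ x, f x * ψ x := by
  rw [inner_eq_integral]
  refine integral_congr_ae ?_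
  filter_upwards [coeFn_testL h hc] with x h
  rw [h]

theorem eq_zero_of_test (f : L2)
    (h : ∀ ψ : ℝ → ℝ, ContDiff ℝ ∞ ψ → HasCompactSupport ψ → ∫ x, f x * ψ x = 0) : f = 0 := by
  rw [Lp.eq_zero_iff_ae_eq_zero]
  refine ae_eq_zero_of_integral_contDiff_smul_eq_zero
    ((Lp.memLp f).locallyIntegrable (by norm_num)) fun g hg hc => ?_
  rw [← h g hg hc]
  congr 1; ext x; rw [smul_eq_mul, mul_comm]

theorem eq_of_test (f g : L2) (h : ∀ ψ : ℝ → ℝ, ContDiff ℝ ∞ ψ → HasCompactSupport ψ →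
    ∫ x, f x * ψ x = ∫ x, g x * ψ x) : f = g := by
  rw [← sub_eq_zero]
  refine eq_zero_of_test _ fun ψ hψ hc => ?_
  rw [← inner_testL _ hψ.continuous hc, inner_sub_left, inner_testL, inner_testL, h ψ hψ hc,
    sub_self]

/-! ### Weak derivatives through the translation group. -/

section

/-- A continuous curve in a Hilbert space is differentiable as soon as it is so when tested against
a separating set, with a continuous candidate for the derivative. -/
theorem hasDerivAt_of_weak {X : Type*} [NormedAddCommGroup X] [InnerProductSpace ℝ X]
    [CompleteSpace X] {S : Set X} (hS : ∀ x : X, (∀ s ∈ S, ⟪x, s⟫_ℝ = 0) → x = 0) {f g : ℝ → X}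
    (hg : Continuous g) (h : ∀ s ∈ S, ∀ t, HasDerivAt (fun t => ⟪f t, s⟫_ℝ) ⟪g t, s⟫_ℝ t) (t : ℝ) :
    HasDerivAt f (g t) t := by
  have hF : ∀ t, HasDerivAt (fun t => f 0 + ∫ r in (0 : ℝ)..t, g r) (g t) t := fun t =>
    (intervalIntegral.integral_hasDerivAt_right (hg.intervalIntegrable _ _)
      hg.stronglyMeasurable.stronglyMeasurableAtFilter hg.continuousAt).const_add _
  -- The difference of the two sides has zero derivative against every element of `S` and vanishes
  -- at time 0; since `S` separates points, it is zero.
  have : f = fun t => f 0 + ∫ r in (0 : ℝ)..t, g r := by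
    ext t
    rw [← sub_eq_zero]
    refine hS _ fun s hs => ?_
    have hd : ∀ t, HasDerivAt (fun t => ⟪f t - (f 0 + ∫ r in (0 : ℝ)..t, g r), s⟫_ℝ) 0 t := by
      intro t
      have h1 := (h s hs t).sub ((hF t).inner ℝ (hasDerivAt_const t s))
      simp only [inner_zero_right, zero_add, sub_self] at h1
      refine h1.congr_of_eventuallyEq (Eventually.of_forall fun r => ?_)
      simp [inner_sub_left]
    have := is_const_of_deriv_eq_zero (fun t => (hd t).differentiableAt) (fun t => (hd t).deriv) t 0
    rw [this]; simp
  rw [this]; exact hF t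

/-- The pairing is the convolution of `f` with the reflection of `ψ`, so the derivative may fall on
`ψ`. -/
theorem hasDerivAt_inner_trans_test (f : L2) {ψ : ℝ → ℝ} (hψ : ContDiff ℝ ∞ ψ)
    (hc : HasCompactSupport ψ) (s : ℝ) :
    HasDerivAt (fun s => ⟪trans s f, testL ψ hψ.continuous hc⟫_ℝ)
      (-∫ x, f x * deriv ψ (x - s)) s := by
  have hneg : HasCompactSupport fun y => ψ (-y) :=
    hc.comp_homeomorph (Homeomorph.neg ℝ)
  have h1 := hneg.hasDerivAt_convolution_right (ContinuousLinearMap.mul ℝ ℝ) (μ := volume)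
    (f₀ := (f : ℝ → ℝ)) ((Lp.memLp f).locallyIntegrable (by norm_num))
    ((hψ.of_le (by simp)).comp contDiff_neg) s
  have h2 : ∀ s, ⟪trans s f, testL ψ hψ.continuous hc⟫_ℝ
      = convolution f (fun y => ψ (-y)) (ContinuousLinearMap.mul ℝ ℝ) volume s := by
    intro s
    rw [inner_testL, convolution_def, ← integral_add_right_eq_self
      (fun t => (ContinuousLinearMap.mul ℝ ℝ) (f t) (ψ (-(s - t)))) s]
    refine integral_congr_ae ?_
    filter_upwards [coeFn_trans s f] with x hx
    rw [hx, ContinuousLinearMap.mul_apply']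
    congr 2; ring
  simp only [h2]
  have h3 : -∫ x, f x * deriv ψ (x - s)
      = convolution f (deriv fun y => ψ (-y)) (ContinuousLinearMap.mul ℝ ℝ) volume s := by
    rw [convolution_def, ← integral_neg]
    congr 1; ext x
    rw [ContinuousLinearMap.mul_apply', deriv_comp_neg]
    simp
  rw [h3]; exact h1

theorem hasCompactSupport_translate {ψ : ℝ → ℝ} (hc : HasCompactSupport ψ) (s : ℝ) :
    HasCompactSupport fun x => ψ (x - s) :=
  hc.comp_homeomorph (Homeomorph.subRight s)

/-- Tested against smooth functions this is the definition of the weak derivative; strong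
differentiability follows because s ↦ `trans s g` is continuous in L². It lets weak derivatives be
handled by calculus on orbits. -/
theorem IsWeakDeriv.hasDerivAt_trans {f g : L2} (h : IsWeakDeriv f g) (s : ℝ) :
    HasDerivAt (fun s => trans s f) (trans s g) s := by
  refine hasDerivAt_of_weak
    (S := {p | ∃ (ψ : ℝ → ℝ) (hψ : ContDiff ℝ ∞ ψ) (hc : HasCompactSupport ψ),
      p = testL ψ hψ.continuous hc}) ?_ (continuous_trans g) ?_ s
  · intro p hp
    refine eq_zero_of_test p fun ψ hψ hc => ?_
    rw [← inner_testL _ hψ.continuous hc]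
    exact hp _ ⟨ψ, hψ, hc, rfl⟩
  · rintro _ ⟨ψ, hψ, hc, rfl⟩ s
    have h1 := hasDerivAt_inner_trans_test f hψ hc s
    have h2 := h (fun x => ψ (x - s)) (hψ.comp (contDiff_id.sub contDiff_const))
      (hasCompactSupport_translate hc s)
    simp only [deriv_comp_sub_const] at h2
    rw [h2, neg_neg] at h1
    refine h1.congr_deriv (Eq.symm ?_)
    rw [inner_testL, ← integral_sub_right_eq_self _ s]
    refine integral_congr_ae ?_
    have := (measurePreserving_add (-s)).quasiMeasurePreserving.ae_eq (coeFn_trans s g)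
    filter_upwards [this] with x hx
    simp only [Function.comp_apply] at hx
    rw [sub_eq_add_neg, hx]; simp

theorem isWeakDeriv_of_hasDerivAt_trans {f g : L2}
    (h : HasDerivAt (fun s => trans s f) g 0) : IsWeakDeriv f g := by
  intro ψ hψ hc
  have h1 := hasDerivAt_inner_trans_test f hψ hc 0
  have h2 := h.inner ℝ (hasDerivAt_const 0 (testL ψ hψ.continuous hc))
  have h3 := h1.unique h2
  simp only [sub_zero, inner_zero_right, zero_add, inner_testL] at h3
  rw [← h3, neg_neg]

/-- Translations preserve the inner product, so s ↦ ⟪τₛf, τₛg⟫ is constant; this is its derivative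
at 0. -/
theorem IsWeakDeriv.integral_by_parts {f f' g g' : L2} (hf : IsWeakDeriv f f')
    (hg : IsWeakDeriv g g') : ⟪f', g⟫_ℝ + ⟪f, g'⟫_ℝ = 0 := by
  have h1 := (hf.hasDerivAt_trans 0).inner ℝ (hg.hasDerivAt_trans 0)
  simp only [inner_trans_trans] at h1
  have := h1.unique (hasDerivAt_const 0 ⟪f, g⟫_ℝ)
  linarith

theorem IsWeakDeriv.trans {f g : L2} (h : IsWeakDeriv f g) (s : ℝ) :
    IsWeakDeriv (trans s f) (ABCDBoussinesq.trans s g) := by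
  apply isWeakDeriv_of_hasDerivAt_trans
  have := (ABCDBoussinesq.trans s).hasFDerivAt.comp_hasDerivAt 0 (h.hasDerivAt_trans 0)
  rw [trans_zero] at this
  refine this.congr_of_eventuallyEq (Eventually.of_forall fun r => ?_)
  change ABCDBoussinesq.trans r _ = ABCDBoussinesq.trans s (ABCDBoussinesq.trans r f)
  rw [← trans_add, ← trans_add, add_comm]

/-- `w'` is the derivative of the smooth bounded function `w`. -/
structure IsWeight (w w' : ℝ →ᵇ ℝ) : Prop where
  smooth : ContDiff ℝ ∞ w
  deriv_eq : ∀ x, HasDerivAt w (w' x) x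

theorem IsWeakDeriv.mulL {f g : L2} (h : IsWeakDeriv f g) {w w' : ℝ →ᵇ ℝ} (hw : IsWeight w w') :
    IsWeakDeriv (mulL w f) (ABCDBoussinesq.mulL w' f + ABCDBoussinesq.mulL w g : L2) := by
  intro ψ hψ hc
  have h1 := h (fun x => w x * ψ x) (hw.smooth.mul hψ) hc.mul_left
  have hd : ∀ x, deriv (fun x => w x * ψ x) x = w' x * ψ x + w x * deriv ψ x := fun x =>
    ((hw.deriv_eq x).mul ((hψ.differentiable (by simp)) x).hasDerivAt).deriv
  simp only [hd] at h1
  have hψ' : Continuous (deriv ψ) := hψ.continuous_deriv (by simp)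
  rw [← inner_testL _ hψ' hc.deriv, ← inner_testL _ hψ.continuous hc, inner_add_left]
  rw [inner_testL, inner_testL, inner_testL]
  have e1 : ∀ (v : ℝ →ᵇ ℝ) (k : L2) (φ : ℝ → ℝ),
      ∫ x, ABCDBoussinesq.mulL v k x * φ x = ∫ x, k x * (v x * φ x) := by
    intro v k φ
    refine integral_congr_ae ?_
    filter_upwards [coeFn_mulL v k] with x hx
    rw [hx]; ring
  rw [e1, e1, e1, neg_add, ← h1, ← sub_eq_iff_eq_add', ← integral_neg, sub_eq_add_neg,
    ← integral_neg, ← integral_add]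
  · congr 1; ext x; ring
  · exact integrable_mul_test f (w.continuous.mul hψ') hc.deriv.mul_left
  · exact (integrable_mul_test f (w'.continuous.mul hψ.continuous) hc.mul_left).neg.neg

theorem IsWeakDeriv.add {f f' g g' : L2} (h : IsWeakDeriv f f') (k : IsWeakDeriv g g') :
    IsWeakDeriv (f + g : L2) (f' + g' : L2) :=
  H1.add_mem (x := WithLp.toLp 2 (f, f')) (y := WithLp.toLp 2 (g, g')) h k

theorem IsWeakDeriv.smul {f f' : L2} (r : ℝ) (h : IsWeakDeriv f f') :
    IsWeakDeriv (r • f : L2) (r • f' : L2) :=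
  H1.smul_mem (x := WithLp.toLp 2 (f, f')) r h

/-- The element of `L²` underlying an element of `H¹`. -/
def vL : H1 →L[ℝ] L2 := (WithLp.fstL 2 ℝ L2 L2).comp H1.subtypeL

/-- The weak derivative of an element of `H¹`. -/
def dL : H1 →L[ℝ] L2 := (WithLp.sndL 2 ℝ L2 L2).comp H1.subtypeL

theorem H1.isWeakDeriv (p : H1) : IsWeakDeriv (vL p) (dL p) := p.2

theorem H1.inner_eq (p q : H1) : ⟪p, q⟫_ℝ = ⟪vL p, vL q⟫_ℝ + ⟪dL p, dL q⟫_ℝ :=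
  WithLp.prod_inner_apply _ _

theorem H1.norm_sq (p : H1) : ‖p‖ ^ 2 = ‖vL p‖ ^ 2 + ‖dL p‖ ^ 2 := by
  rw [← real_inner_self_eq_norm_sq, H1.inner_eq, real_inner_self_eq_norm_sq,
    real_inner_self_eq_norm_sq]

/-- The defining conditions are equalities between continuous functionals, one for each test
function. Closedness gives completeness, hence adjoints, and allows arguments by density. -/
theorem isClosed_H1 : IsClosed (H1 : Set L2Pair) := by
  have : (H1 : Set L2Pair) = ⋂ (ψ : ℝ → ℝ) (hψ : ContDiff ℝ ∞ ψ) (hc : HasCompactSupport ψ),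
      {p | ⟪p.fst, testL (deriv ψ) (hψ.continuous_deriv (by simp)) hc.deriv⟫_ℝ
        = -⟪p.snd, testL ψ hψ.continuous hc⟫_ℝ} := by
    ext p
    simp only [mem_iInter, mem_ofPred_eq, inner_testL]
    rfl
  rw [this]
  refine isClosed_iInter fun ψ => isClosed_iInter fun hψ => isClosed_iInter fun hc =>
    isClosed_eq ?_ ?_
  · exact ((WithLp.fstL 2 ℝ L2 L2).continuous.inner continuous_const)
  · exact ((WithLp.sndL 2 ℝ L2 L2).continuous.inner continuous_const).neg

instance : CompleteSpace H1 := isClosed_H1.completeSpace_coe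

/-- A pair of bounded operators into `L²`, the second giving the weak derivative of the first, as
a bounded operator into `H¹`. -/
def liftH1 {E : Type*} [NormedAddCommGroup E] [NormedSpace ℝ E] (A B : E →L[ℝ] L2)
    (h : ∀ x, IsWeakDeriv (A x) (B x)) : E →L[ℝ] H1 :=
  ((WithLp.prodContinuousLinearEquiv 2 ℝ L2 L2).symm.toContinuousLinearMap.comp
    (A.prod B)).codRestrict H1 h

/-- An element of `H¹` from a function and its weak derivative. -/
def mkH1 (f g : L2) (h : IsWeakDeriv f g) : H1 := ⟨WithLp.toLp 2 (f, g), h⟩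

theorem vL_mkH1 {f g : L2} (h : IsWeakDeriv f g) : vL (mkH1 f g h) = f := rfl
theorem dL_mkH1 {f g : L2} (h : IsWeakDeriv f g) : dL (mkH1 f g h) = g := rfl

theorem IsWeakDeriv.unique {f g g' : L2} (h : IsWeakDeriv f g) (h' : IsWeakDeriv f g') :
    g = g' := by
  refine eq_of_test _ _ fun ψ hψ hc => ?_
  have h1 := h ψ hψ hc
  rw [h' ψ hψ hc] at h1
  linarith

theorem H1.ext {p q : H1} (h : vL p = vL q) : p = q := by
  have h2 : dL p = dL q := by
    have := H1.isWeakDeriv p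
    rw [h] at this
    exact this.unique (H1.isWeakDeriv q)
  exact Subtype.ext (WithLp.ofLp_injective 2 (Prod.ext h h2))

end

/-! ### Density of test functions, Sobolev embedding and the product rule. -/

theorem isWeakDeriv_testL {ψ : ℝ → ℝ} (hψ : ContDiff ℝ ∞ ψ) (hc : HasCompactSupport ψ) :
    IsWeakDeriv (testL ψ hψ.continuous hc)
      (testL (deriv ψ) (hψ.continuous_deriv (by simp)) hc.deriv) := by
  intro φ hφ hφc
  have hψ' : Continuous (deriv ψ) := hψ.continuous_deriv (by simp)
  have hφ' : Continuous (deriv φ) := hφ.continuous_deriv (by simp)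
  have e : ∀ (v : ℝ → ℝ) (h : Continuous v) (hc : HasCompactSupport v) (k : ℝ → ℝ),
      ∫ x, testL v h hc x * k x = ∫ x, v x * k x := fun v h hc k =>
    integral_congr_ae (by filter_upwards [coeFn_testL h hc] with x hx; rw [hx])
  rw [e, e]
  exact integral_mul_deriv_eq_deriv_mul_of_integrable
    (fun x _ => ((hψ.differentiable (by simp)) x).hasDerivAt)
    (fun x _ => ((hφ.differentiable (by simp)) x).hasDerivAt)
    ((hψ.continuous.mul hφ').integrable_of_hasCompactSupport hc.mul_right)
    ((hψ'.mul hφ.continuous).integrable_of_hasCompactSupport hc.deriv.mul_right)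
    ((hψ.continuous.mul hφ.continuous).integrable_of_hasCompactSupport hc.mul_right)

/-- A test function as an element of `H¹`. -/
def testH (ψ : ℝ → ℝ) (hψ : ContDiff ℝ ∞ ψ) (hc : HasCompactSupport ψ) : H1 :=
  mkH1 _ _ (isWeakDeriv_testL hψ hc)

/-- The elements of `H¹` represented by test functions. -/
def testSub : Submodule ℝ H1 where
  carrier := {p | ∃ ψ : ℝ → ℝ, ContDiff ℝ ∞ ψ ∧ HasCompactSupport ψ ∧ vL p =ᵐ[volume] ψ}
  zero_mem' := ⟨0, contDiff_const, HasCompactSupport.zero, by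
    rw [map_zero]; exact Lp.coeFn_zero ℝ 2 volume⟩
  add_mem' := by
    rintro p q ⟨ψ, h1, h2, h3⟩ ⟨φ, k1, k2, k3⟩
    refine ⟨ψ + φ, h1.add k1, h2.add k2, ?_⟩
    rw [map_add]
    exact (Lp.coeFn_add _ _).trans (h3.add k3)
  smul_mem' := by
    rintro r p ⟨ψ, h1, h2, h3⟩
    refine ⟨r • ψ, contDiff_const.smul h1, h2.smul_left, ?_⟩
    rw [map_smul]
    exact (Lp.coeFn_smul _ _).trans (h3.const_smul r)

theorem testH_mem {ψ : ℝ → ℝ} (hψ : ContDiff ℝ ∞ ψ) (hc : HasCompactSupport ψ) :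
    testH ψ hψ hc ∈ testSub := ⟨ψ, hψ, hc, coeFn_testL hψ.continuous hc⟩

theorem eq_testH_of_ae {p : H1} {ψ : ℝ → ℝ} (hψ : ContDiff ℝ ∞ ψ) (hc : HasCompactSupport ψ)
    (h : vL p =ᵐ[volume] ψ) : p = testH ψ hψ hc :=
  H1.ext (Lp.ext (h.trans (coeFn_testL hψ.continuous hc).symm))

/-- An element p orthogonal to all test functions satisfies p'' = p weakly; pairing with p and
integrating by parts gives ‖p‖ = 0. -/
theorem dense_testSub : Dense (testSub : Set H1) := by
  rw [Submodule.dense_iff_topologicalClosure_eq_top, Submodule.topologicalClosure_eq_top_iff,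
    Submodule.eq_bot_iff]
  intro p hp
  rw [Submodule.mem_orthogonal'] at hp
  have h2 : IsWeakDeriv (dL p) (vL p) := by
    intro ψ hψ hc
    have := hp _ (testH_mem hψ hc)
    rw [H1.inner_eq, testH, vL_mkH1, dL_mkH1, inner_testL, inner_testL] at this
    linarith
  have h3 := h2.integral_by_parts (H1.isWeakDeriv p)
  rw [real_inner_self_eq_norm_sq, real_inner_self_eq_norm_sq, ← H1.norm_sq] at h3
  simpa using h3

/-- ψ(x)² is the integral of 2ψψ' over (-∞, x], and 2ψψ' ≤ ψ² + ψ'². -/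
theorem sq_le_norm_sq_testH {ψ : ℝ → ℝ} (hψ : ContDiff ℝ ∞ ψ) (hc : HasCompactSupport ψ) (x : ℝ) :
    ψ x ^ 2 ≤ ‖testH ψ hψ hc‖ ^ 2 := by
  have hψ' : Continuous (deriv ψ) := hψ.continuous_deriv (by simp)
  have hs : HasCompactSupport (fun y => ψ y ^ 2) := by
    simp only [sq]; exact hc.mul_right (f' := ψ)
  have h1 := HasCompactSupport.integral_Iic_deriv_eq
    ((hψ.pow 2).of_le (by simp)) hs x
  have hd : ∀ y, deriv (fun y => ψ y ^ 2) y = 2 * ψ y * deriv ψ y := fun y => by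
    have := (((hψ.differentiable (by simp)) y).hasDerivAt.pow 2).deriv
    have e : (fun y => ψ y ^ 2) = ψ ^ 2 := rfl
    rw [e, this]; simp
  simp only [hd] at h1
  have i1 : Integrable fun y => ψ y * ψ y :=
    (hψ.continuous.mul hψ.continuous).integrable_of_hasCompactSupport hc.mul_right
  have i2 : Integrable fun y => deriv ψ y * deriv ψ y :=
    (hψ'.mul hψ').integrable_of_hasCompactSupport hc.deriv.mul_right
  have i3 : Integrable fun y => 2 * ψ y * deriv ψ y :=
    ((continuous_const.mul hψ.continuous).mul hψ').integrable_of_hasCompactSupport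
      hc.deriv.mul_left
  have e : ∀ (v : ℝ → ℝ) (h : Continuous v) (hc : HasCompactSupport v),
      ‖testL v h hc‖ ^ 2 = ∫ x, v x * v x := fun v h hc => by
    rw [← real_inner_self_eq_norm_sq, inner_testL]
    exact integral_congr_ae (by filter_upwards [coeFn_testL h hc] with x hx; rw [hx])
  rw [H1.norm_sq, testH, vL_mkH1, dL_mkH1, e, e, ← integral_add i1 i2, ← h1]
  refine (integral_mono i3.integrableOn (i1.add i2).integrableOn fun y => ?_).trans
    (setIntegral_le_integral (i1.add i2) (Eventually.of_forall fun y => ?_))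
  · simp only [Pi.add_apply]; nlinarith [sq_nonneg (ψ y - deriv ψ y)]
  · simp only [Pi.add_apply, Pi.zero_apply]; nlinarith [mul_self_nonneg (ψ y), mul_self_nonneg (deriv ψ y)]

theorem exists_rep_of_mem_testSub {p : H1} (hp : p ∈ testSub) :
    ∃ F : ℝ →ᵇ ℝ, F =ᵐ[volume] vL p ∧ ‖F‖ ≤ ‖p‖ := by
  obtain ⟨ψ, hψ, hc, h⟩ := hp
  obtain rfl := eq_testH_of_ae hψ hc h
  have hb : ∀ x, ‖ψ x‖ ≤ ‖testH ψ hψ hc‖ := fun x =>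
    abs_le_of_sq_le_sq (sq_le_norm_sq_testH hψ hc x) (norm_nonneg _)
  refine ⟨BoundedContinuousFunction.ofNormedAddCommGroup ψ hψ.continuous _ hb, h.symm, ?_⟩
  exact BoundedContinuousFunction.norm_ofNormedAddCommGroup_le hψ.continuous (norm_nonneg _) hb

theorem bcf_eq_of_ae {F F' : ℝ →ᵇ ℝ} (h : F =ᵐ[volume] F') : F = F' :=
  DFunLike.coe_injective
    (Continuous.ae_eq_iff_eq volume F.continuous F'.continuous |>.1 h)

/-- Sobolev embedding: an element of `H¹` has a bounded continuous representative. -/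
theorem exists_rep (p : H1) : ∃ F : ℝ →ᵇ ℝ, F =ᵐ[volume] vL p ∧ ‖F‖ ≤ ‖p‖ := by
  obtain ⟨q, hq, hlim⟩ := mem_closure_iff_seq_limit.1 (dense_testSub p)
  choose F hF hFn using fun n => exists_rep_of_mem_testSub (hq n)
  have hdist : ∀ m n, ‖F m - F n‖ ≤ ‖q m - q n‖ := by
    intro m n
    obtain ⟨E, hE, hEn⟩ := exists_rep_of_mem_testSub (testSub.sub_mem (hq m) (hq n))
    have : E = F m - F n := by
      apply bcf_eq_of_ae
      rw [map_sub] at hE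
      filter_upwards [hE, hF m, hF n, Lp.coeFn_sub (vL (q m)) (vL (q n))] with x h1 h2 h3 h4
      rw [h1, h4, BoundedContinuousFunction.coe_sub, Pi.sub_apply, Pi.sub_apply, h2, h3]
    rwa [← this]
  have hC : CauchySeq F := by
    have := hlim.cauchySeq
    rw [Metric.cauchySeq_iff] at this ⊢
    intro ε hε
    obtain ⟨N, hN⟩ := this ε hε
    exact ⟨N, fun m hm n hn => by
      rw [dist_eq_norm]
      exact (hdist m n).trans_lt (by rw [← dist_eq_norm]; exact hN m hm n hn)⟩
  obtain ⟨E, hE⟩ := cauchySeq_tendsto_of_complete hC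
  refine ⟨E, ?_, ?_⟩
  · have h1 : Tendsto (fun n => vL (q n)) atTop (𝓝 (vL p)) := (vL.continuous.tendsto p).comp hlim
    -- The uniform limit `E` and the L² limit `vL p` agree almost everywhere, because a subsequence
    -- of the L²-convergent sequence converges almost everywhere.
    obtain ⟨ns, hns, hae⟩ := (tendstoInMeasure_of_tendsto_Lp h1).exists_seq_tendsto_ae
    have hall : ∀ᵐ x, ∀ n, F n x = vL (q n) x := ae_all_iff.2 hF
    filter_upwards [hae, hall] with x h1 h2
    have h3 : Tendsto (fun n => F (ns n) x) atTop (𝓝 (E x)) :=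
      ((BoundedContinuousFunction.evalCLM ℝ x).continuous.tendsto E |>.comp hE).comp
        hns.tendsto_atTop
    simp only [h2] at h3
    exact tendsto_nhds_unique h3 h1
  · exact le_of_tendsto_of_tendsto hE.norm hlim.norm (Eventually.of_forall hFn)

/-- The Sobolev embedding of `H¹` into bounded continuous functions. -/
def toB : H1 →L[ℝ] (ℝ →ᵇ ℝ) :=
  LinearMap.mkContinuous
    { toFun := fun p => (exists_rep p).choose
      map_add' := fun p q => by
        apply bcf_eq_of_ae
        filter_upwards [(exists_rep (p + q)).choose_spec.1, (exists_rep p).choose_spec.1, (exists_rep q).choose_spec.1,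
          Lp.coeFn_add (vL p) (vL q)] with x h1 h2 h3 h4
        rw [h1, map_add, h4, BoundedContinuousFunction.coe_add, Pi.add_apply, Pi.add_apply, h2, h3]
      map_smul' := fun r p => by
        apply bcf_eq_of_ae
        filter_upwards [(exists_rep (r • p)).choose_spec.1, (exists_rep p).choose_spec.1, Lp.coeFn_smul r (vL p)] with x h1 h2 h4
        rw [h1, map_smul, h4, Pi.smul_apply, ← h2]; rfl }
    1 fun p => by rw [one_mul]; exact (exists_rep p).choose_spec.2

theorem toB_ae (p : H1) : toB p =ᵐ[volume] vL p := (exists_rep p).choose_spec.1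

theorem norm_toB_le (p : H1) : ‖toB p‖ ≤ ‖p‖ := (exists_rep p).choose_spec.2

theorem mulL_toB_comm (p q : H1) : mulL (toB p) (vL q) = mulL (toB q) (vL p) := by
  apply Lp.ext
  filter_upwards [coeFn_mulL (toB p) (vL q), coeFn_mulL (toB q) (vL p), toB_ae p, toB_ae q]
    with x h1 h2 h3 h4
  rw [h1, h2, h3, h4, mul_comm]

/-- For a test function `p` this is the product rule with a smooth weight. Both entries depend
continuously on `p`, test functions are dense and `H1` is closed. -/
theorem isWeakDeriv_mul (p q : H1) : IsWeakDeriv (mulL (toB p) (vL q))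
    (mulL (toB q) (dL p) + mulL (toB p) (dL q) : L2) := by
  let A : H1 →L[ℝ] L2Pair := (WithLp.prodContinuousLinearEquiv 2 ℝ L2 L2).symm.toContinuousLinearMap.comp
    (((mulL.flip (vL q)).comp toB).prod ((mulL (toB q)).comp dL + (mulL.flip (dL q)).comp toB))
  have hcl : IsClosed (A ⁻¹' (H1 : Set L2Pair)) := isClosed_H1.preimage A.continuous
  have : (testSub : Set H1) ⊆ A ⁻¹' (H1 : Set L2Pair) := by
    rintro r ⟨ψ, hψ, hc, h⟩
    obtain rfl := eq_testH_of_ae hψ hc h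
    have hψ' : ContDiff ℝ ∞ (deriv ψ) := by
      simpa using ((contDiff_infty_iff_deriv (𝕜 := ℝ)).1 hψ).2
    have h1 : (toB (testH ψ hψ hc) : ℝ → ℝ) = ψ :=
      (Continuous.ae_eq_iff_eq volume (toB _).continuous hψ.continuous).1
        ((toB_ae _).trans (coeFn_testL hψ.continuous hc))
    have h2 : (toB (testH (deriv ψ) hψ' hc.deriv) : ℝ → ℝ) = deriv ψ :=
      (Continuous.ae_eq_iff_eq volume (toB _).continuous hψ'.continuous).1
        ((toB_ae _).trans (coeFn_testL hψ'.continuous hc.deriv))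
    have hw : IsWeight (toB (testH ψ hψ hc)) (toB (testH (deriv ψ) hψ' hc.deriv)) :=
      ⟨by rw [h1]; exact hψ, fun x => by
        rw [h1, h2]; exact ((hψ.differentiable (by simp)) x).hasDerivAt⟩
    have h3 := (H1.isWeakDeriv q).mulL hw
    rw [mulL_toB_comm (testH (deriv ψ) hψ' hc.deriv) q] at h3
    exact h3
  exact (hcl.closure_subset_iff.2 this) (dense_testSub p)

/-! ### The resolvent of the Laplacian. -/

/-- `(1 - ∂ₓ²)⁻¹`. -/
def gre : L2 →L[ℝ] H1 := ContinuousLinearMap.adjoint vL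

theorem inner_gre (f : L2) (p : H1) : ⟪gre f, p⟫_ℝ = ⟪f, vL p⟫_ℝ :=
  ContinuousLinearMap.adjoint_inner_left _ _ _

theorem norm_vL_le (p : H1) : ‖vL p‖ ≤ ‖p‖ := by
  refine abs_le_of_sq_le_sq' ?_ (norm_nonneg _) |>.2
  rw [H1.norm_sq]; nlinarith [sq_nonneg ‖dL p‖]

theorem norm_dL_le (p : H1) : ‖dL p‖ ≤ ‖p‖ := by
  refine abs_le_of_sq_le_sq' ?_ (norm_nonneg _) |>.2
  rw [H1.norm_sq]; nlinarith [sq_nonneg ‖vL p‖]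

/-- The adjoint relation ⟪Gf, ψ⟫ in H¹ = ⟪f, ψ⟫ in L², read on test functions, is the equation z -
z'' = f for z = Gf. It gives the second derivative needed for `dgre`. -/
theorem isWeakDeriv_dL_gre (f : L2) : IsWeakDeriv (dL (gre f)) (vL (gre f) - f : L2) := by
  intro ψ hψ hc
  have h := inner_gre f (testH ψ hψ hc)
  rw [H1.inner_eq, testH, vL_mkH1, dL_mkH1, inner_testL] at h
  rw [← inner_testL _ hψ.continuous hc, inner_sub_left, ← h, inner_testL, inner_testL]
  ring

/-- `∂ₓ (1 - ∂ₓ²)⁻¹`, with values in `H¹`. -/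
def dgre : L2 →L[ℝ] H1 :=
  liftH1 (dL.comp gre) (vL.comp gre - ContinuousLinearMap.id ℝ L2) isWeakDeriv_dL_gre

theorem vL_dgre (f : L2) : vL (dgre f) = dL (gre f) := rfl
theorem dL_dgre (f : L2) : dL (dgre f) = vL (gre f) - f := rfl

/-! ### The system as an evolution equation in L². -/

section

theorem contDiff_deriv {ψ : ℝ → ℝ} (hψ : ContDiff ℝ ∞ ψ) : ContDiff ℝ ∞ (deriv ψ) := by
  simpa using ((contDiff_infty_iff_deriv (𝕜 := ℝ)).1 hψ).2

/-- The image of `ψ` under `1 - ∂ₓ²`, in `L²`. -/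
def helmTest (ψ : ℝ → ℝ) (hψ : ContDiff ℝ ∞ ψ) (hc : HasCompactSupport ψ) : L2 :=
  testL ψ hψ.continuous hc
    - testL (deriv (deriv ψ)) (contDiff_deriv (contDiff_deriv hψ)).continuous hc.deriv.deriv

theorem inner_helmTest (f : L2) {ψ : ℝ → ℝ} (hψ : ContDiff ℝ ∞ ψ) (hc : HasCompactSupport ψ) :
    ⟪f, helmTest ψ hψ hc⟫_ℝ = ∫ x, f x * (ψ x - deriv (deriv ψ) x) := by
  have h2 := (contDiff_deriv (contDiff_deriv hψ)).continuous
  rw [helmTest, inner_sub_right, inner_testL, inner_testL,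
    ← integral_sub (integrable_mul_test f hψ.continuous hc)
      (integrable_mul_test f h2 hc.deriv.deriv)]
  congr 1; ext x; ring

theorem trans_testL {ψ : ℝ → ℝ} (h : Continuous ψ) (hc : HasCompactSupport ψ) (s : ℝ) :
    trans (-s) (testL ψ h hc) = testL (fun x => ψ (x - s)) (h.comp (continuous_id.sub
      continuous_const)) (hasCompactSupport_translate hc s) := by
  apply Lp.ext
  have := (measurePreserving_add (-s)).quasiMeasurePreserving.ae_eq (coeFn_testL h hc)
  filter_upwards [coeFn_trans (-s) (testL ψ h hc), this, coeFn_testL (h.comp (continuous_id.sub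
      (continuous_const (y := s)))) (hasCompactSupport_translate hc s)] with x h1 h2 h3
  simp only [Function.comp_apply] at h2
  rw [h1, h2]
  exact h3.symm

/-- `(1 - ∂ₓ²)` maps the test functions onto a subset of `L²` with trivial orthogonal. -/
theorem eq_zero_of_helmTest (g : L2)
    (h : ∀ ψ (hψ : ContDiff ℝ ∞ ψ) (hc : HasCompactSupport ψ), ⟪g, helmTest ψ hψ hc⟫_ℝ = 0) :
    g = 0 := by
  -- Averaging `g` over translates gains one derivative: `A r` has weak derivative τᵣg - g in L²,
  -- although `g` itself need not be differentiable.
  let A : ℝ → L2 := fun r => ∫ s in (0 : ℝ)..r, trans s g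
  have hcont := continuous_trans g
  have hA : ∀ r, HasDerivAt A (trans r g) r := fun r =>
    intervalIntegral.integral_hasDerivAt_right (hcont.intervalIntegrable _ _)
      hcont.stronglyMeasurable.stronglyMeasurableAtFilter hcont.continuousAt
  have hz : ∀ r, A r = 0 := by
    intro r
    have e : ∀ k, trans k (A r) = A (k + r) - A k := by
      intro k
      have e1 : trans k (A r) = ∫ s in (0 : ℝ)..r, trans (k + s) g := by
        rw [← ContinuousLinearMap.intervalIntegral_comp_comm _ (hcont.intervalIntegrable _ _)]
        simp only [trans_add]
      rw [e1, intervalIntegral.integral_comp_add_left (fun s => trans s g), add_zero]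
      exact (intervalIntegral.integral_interval_sub_left (hcont.intervalIntegrable _ _)
        (hcont.intervalIntegrable _ _)).symm
    have hd : HasDerivAt (fun k => trans k (A r)) (trans r g - g) 0 := by
      simp only [e]
      have h1 : HasDerivAt (fun k => A (k + r)) (trans r g) 0 :=
        HasDerivAt.comp_add_const 0 r (by rw [zero_add]; exact hA r)
      have h2 := hA 0
      rw [trans_zero] at h2
      exact h1.sub h2
    have w1 := isWeakDeriv_of_hasDerivAt_trans hd
    -- The hypothesis is translation invariant, so `A r` is also orthogonal to every ψ - ψ''. Hence
    -- the second weak derivative of `A r` is `A r`.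
    have w2 : IsWeakDeriv (trans r g - g : L2) (A r) := by
      intro ψ hψ hc
      have h1 := w1 (deriv ψ) (contDiff_deriv hψ) hc.deriv
      have h2 : ⟪A r, helmTest ψ hψ hc⟫_ℝ = 0 := by
        rw [real_inner_comm]
        have : ⟪helmTest ψ hψ hc, A r⟫_ℝ = ∫ s in (0 : ℝ)..r, ⟪helmTest ψ hψ hc, trans s g⟫_ℝ :=
          ((innerSL ℝ (helmTest ψ hψ hc)).intervalIntegral_comp_comm
            (hcont.intervalIntegrable _ _)).symm
        rw [this]
        have h0 : ∀ s, ⟪helmTest ψ hψ hc, trans s g⟫_ℝ = 0 := by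
          intro s
          rw [real_inner_comm, inner_trans_left, helmTest, map_sub, trans_testL, trans_testL]
          have := h (fun x => ψ (x - s)) (hψ.comp (contDiff_id.sub contDiff_const))
            (hasCompactSupport_translate hc s)
          rw [helmTest] at this
          have e1 : ∀ φ : ℝ → ℝ, deriv (fun x => φ (x - s)) = fun x => deriv φ (x - s) :=
            fun φ => funext fun x => deriv_comp_sub_const φ s x
          simp only [e1] at this
          exact this
        simp [h0]
      rw [helmTest, inner_sub_right, inner_testL, inner_testL] at h2
      linarith
    -- This is ‖(A r)'‖² + ‖A r‖² = 0. So `A` vanishes identically, and its derivative at 0, which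
    -- is `g`, is zero.
    have h3 := w1.integral_by_parts w2
    have : ⟪A r, A r⟫_ℝ = 0 := by
      have a1 := real_inner_self_nonneg (x := A r)
      have a2 := real_inner_self_nonneg (x := (trans r g - g : L2))
      linarith
    exact inner_self_eq_zero.1 this
  have hA0 := hA 0
  rw [trans_zero] at hA0
  have : A = fun _ => 0 := funext hz
  rw [this] at hA0
  exact (hA0.unique (hasDerivAt_const 0 0))

/-- The regular part `-(1 + k) ∂ₓ (1 - ∂ₓ²)⁻¹ f - ∂ₓ (1 - ∂ₓ²)⁻¹ n` of the evolution. -/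
def src (k : ℝ) (f n : L2) : H1 := -((1 + k) • dgre f) - dgre n

theorem vL_src (k : ℝ) (f n : L2) :
    vL (src k f n) = -((1 + k) • dL (gre f)) - dL (gre n) := by
  simp only [src, map_sub, map_neg, map_smul, vL_dgre]

theorem dL_src (k : ℝ) (f n : L2) :
    dL (src k f n) = -((1 + k) • (vL (gre f) - f)) - (vL (gre n) - n) := by
  simp only [src, map_sub, map_neg, map_smul, dL_dgre]

theorem inner_dgre_helmTest (f : L2) {ψ : ℝ → ℝ} (hψ : ContDiff ℝ ∞ ψ)
    (hc : HasCompactSupport ψ) :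
    ⟪dL (gre f), helmTest ψ hψ hc⟫_ℝ = -∫ x, f x * deriv ψ x := by
  have h1 := H1.isWeakDeriv (gre f) ψ hψ hc
  have h2 := isWeakDeriv_dL_gre f (deriv ψ) (contDiff_deriv hψ) hc.deriv
  have hψ' := contDiff_deriv hψ
  rw [← inner_testL (vL (gre f) - f : L2) hψ'.continuous hc.deriv, inner_sub_left,
    inner_testL, inner_testL] at h2
  rw [helmTest, inner_sub_right, inner_testL, inner_testL]
  linarith

/-- This inverts 1 - ∂ₓ²: -∂ₓG(k vₓₓ + v + n) = k vₓ - (1+k) ∂ₓGv - ∂ₓGn. The right side is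
continuous in L², and the functions ψ - ψ'' separate L², so the distributional equation holds
strongly in L². -/
theorem hasDerivAt_vL_of_weak {k : ℝ} {f v : ℝ → H1} {n : ℝ → L2} (hv : Continuous v)
    (hn : Continuous n)
    (h : ∀ ψ : ℝ → ℝ, ContDiff ℝ ∞ ψ → HasCompactSupport ψ → ∀ t : ℝ,
      HasDerivAt (fun s => ∫ x, val (f s) x * (ψ x - deriv (deriv ψ) x))
        (∫ x, ((val (v t) x + n t x) * deriv ψ x - k * dx (v t) x * deriv (deriv ψ) x)) t)
    (t : ℝ) : HasDerivAt (fun t => vL (f t)) (k • dL (v t) + vL (src k (vL (v t)) (n t))) t := by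
  refine hasDerivAt_of_weak (f := fun t => vL (f t))
    (g := fun t => k • dL (v t) + vL (src k (vL (v t)) (n t)))
    (S := {p | ∃ (ψ : ℝ → ℝ) (hψ : ContDiff ℝ ∞ ψ) (hc : HasCompactSupport ψ),
      p = helmTest ψ hψ hc}) ?_ ?_ ?_ t
  · exact fun x hx => eq_zero_of_helmTest x fun ψ hψ hc => hx _ ⟨ψ, hψ, hc, rfl⟩
  · simp only [vL_src]
    have h1 : Continuous fun t => dL (gre (vL (v t))) := by fun_prop
    have h2 : Continuous fun t => dL (gre (n t)) := by fun_prop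
    have h3 : Continuous fun t => dL (v t) := by fun_prop
    exact (h3.const_smul k).add ((h1.const_smul (1 + k)).neg.sub h2)
  · rintro _ ⟨ψ, hψ, hc, rfl⟩ s
    have h1 := h ψ hψ hc s
    simp only [inner_helmTest]
    refine h1.congr_deriv ?_
    have hψ' := contDiff_deriv hψ
    have hψ'' := contDiff_deriv hψ'
    have e1 : ∫ x, ((val (v s) x + n s x) * deriv ψ x - k * dx (v s) x * deriv (deriv ψ) x)
        = (∫ x, vL (v s) x * deriv ψ x) + (∫ x, n s x * deriv ψ x)
          - k * ∫ x, dL (v s) x * deriv (deriv ψ) x := by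
      rw [← integral_const_mul, ← integral_add (integrable_mul_test _ hψ'.continuous hc.deriv)
        (integrable_mul_test _ hψ'.continuous hc.deriv), ← integral_sub]
      · congr 1; ext x; change (vL (v s) x + n s x) * _ - k * dL (v s) x * _ = _; ring
      · exact (integrable_mul_test _ hψ'.continuous hc.deriv).add
          (integrable_mul_test _ hψ'.continuous hc.deriv)
      · exact (integrable_mul_test _ hψ''.continuous hc.deriv.deriv).const_mul k
    rw [e1, ← inner_helmTest _ hψ hc, vL_src, inner_add_left, inner_sub_left, inner_neg_left,
      inner_smul_left, inner_smul_left, inner_dgre_helmTest, inner_dgre_helmTest, helmTest,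
      inner_sub_right, inner_testL, inner_testL]
    have := H1.isWeakDeriv (v s) ψ hψ hc
    rw [this]
    simp only [conj_trivial]
    ring

variable {a c : ℝ} {u η : ℝ → H1}

theorem IsGlobalSolution.hasDerivAt_eta (h : IsGlobalSolution a c u η) (t : ℝ) :
    HasDerivAt (fun t => vL (η t))
      (a • dL (u t) + vL (src a (vL (u t)) (mulL (toB (u t)) (vL (η t))))) t := by
  have hu := h.continuous_u
  have hη := h.continuous_eta
  refine hasDerivAt_vL_of_weak (n := fun t => mulL (toB (u t)) (vL (η t))) hu (by fun_prop)
    (fun ψ hψ hc t => ?_) t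
  refine (h.eq_eta ψ hψ hc t).congr_deriv (integral_congr_ae ?_)
  filter_upwards [coeFn_mulL (toB (u t)) (vL (η t)), toB_ae (u t)] with x h1 h2
  rw [h1, h2]; rfl

theorem IsGlobalSolution.hasDerivAt_u (h : IsGlobalSolution a c u η) (t : ℝ) :
    HasDerivAt (fun t => vL (u t))
      (c • dL (η t) + vL (src c (vL (η t)) ((1 / 2 : ℝ) • mulL (toB (u t)) (vL (u t))))) t := by
  have hu := h.continuous_u
  have hη := h.continuous_eta
  refine hasDerivAt_vL_of_weak (n := fun t => (1 / 2 : ℝ) • mulL (toB (u t)) (vL (u t))) hη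
    (by fun_prop) (fun ψ hψ hc t => ?_) t
  refine (h.eq_u ψ hψ hc t).congr_deriv (integral_congr_ae ?_)
  filter_upwards [coeFn_mulL (toB (u t)) (vL (u t)), toB_ae (u t),
    Lp.coeFn_smul (1 / 2 : ℝ) (mulL (toB (u t)) (vL (u t)))] with x h1 h2 h3
  rw [h3, Pi.smul_apply, h1, h2, smul_eq_mul]
  change (vL (η t) x + 1 / 2 * vL (u t) x ^ 2) * _ - _ = _
  change _ = (vL (η t) x + _) * _ - _
  rw [sq]

end

/-! ### Quadratic quantities in derivatives: difference quotients and limits. -/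

section

/-- The difference quotient `(f(· + h) - f) / h`. -/
def dq (h : ℝ) : L2 →L[ℝ] L2 := h⁻¹ • (trans h - ContinuousLinearMap.id ℝ L2)

theorem dq_apply (h : ℝ) (f : L2) : dq h f = h⁻¹ • (trans h f - f) := rfl

theorem IsWeakDeriv.dq {f g : L2} (hf : IsWeakDeriv f g) (h : ℝ) :
    IsWeakDeriv (dq h f) (ABCDBoussinesq.dq h g) := by
  rw [dq_apply, dq_apply, sub_eq_add_neg, sub_eq_add_neg, ← neg_one_smul ℝ f, ← neg_one_smul ℝ g]
  exact ((hf.trans h).add (hf.smul (-1))).smul h⁻¹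

/-- Mean value inequality along the orbit s ↦ τₛf, whose velocity has constant norm ‖g‖. Uniformity
in `h` supplies the domination in later limits. -/
theorem IsWeakDeriv.norm_dq_le {f g : L2} (hf : IsWeakDeriv f g) (h : ℝ) :
    ‖ABCDBoussinesq.dq h f‖ ≤ ‖g‖ := by
  rcases eq_or_ne h 0 with rfl | hh
  · simp [dq_apply]
  have h1 := Convex.norm_image_sub_le_of_norm_hasDerivWithin_le (s := univ) (x := (0 : ℝ)) (y := h)
    (fun s _ => (hf.hasDerivAt_trans s).hasDerivWithinAt)
    (fun s _ => (norm_trans s g).le) convex_univ (mem_univ _) (mem_univ _)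
  rw [trans_zero, sub_zero] at h1
  rw [dq_apply, norm_smul, norm_inv]
  rw [inv_mul_le_iff₀ (norm_pos_iff.2 hh), mul_comm]
  exact h1

theorem IsWeakDeriv.tendsto_dq {f g : L2} (hf : IsWeakDeriv f g) :
    Tendsto (fun h => ABCDBoussinesq.dq h f) (𝓝[≠] 0) (𝓝 g) := by
  have h1 := hf.hasDerivAt_trans 0
  rw [trans_zero, hasDerivAt_iff_tendsto_slope_zero] at h1
  refine h1.congr fun h => ?_
  rw [zero_add, trans_zero, dq_apply]

theorem IsWeight.integral_by_parts {w w' : ℝ →ᵇ ℝ} (hw : IsWeight w w') {f f' g g' : L2}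
    (hf : IsWeakDeriv f f') (hg : IsWeakDeriv g g') :
    ⟪mulL w f', g⟫_ℝ + ⟪mulL w f, g'⟫_ℝ = -⟪mulL w' f, g⟫_ℝ := by
  have h1 := (hf.mulL hw).integral_by_parts hg
  rw [inner_add_left] at h1
  linarith

theorem inner_mulL_comm (w : ℝ →ᵇ ℝ) (f g : L2) : ⟪mulL w f, g⟫_ℝ = ⟪mulL w g, f⟫_ℝ := by
  rw [← inner_mulL_right, real_inner_comm]

theorem IsWeight.inner_deriv_self {w w' : ℝ →ᵇ ℝ} (hw : IsWeight w w') {f f' : L2}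
    (hf : IsWeakDeriv f f') : ⟪mulL w f', f⟫_ℝ = -(1 / 2) * ⟪mulL w' f, f⟫_ℝ := by
  have h1 := hw.integral_by_parts hf hf
  rw [inner_mulL_comm w f f'] at h1
  linarith

/-- The identities are passed to the limit in integrated form by dominated convergence; continuity
of `G'` then makes the limiting primitive differentiable. -/
theorem hasDerivAt_of_tendsto {ι : Type*} {l : Filter ι} [l.NeBot] [l.IsCountablyGenerated]
    {F F' : ι → ℝ → ℝ} {G G' B : ℝ → ℝ} (hd : ∀ n t, HasDerivAt (F n) (F' n t) t)
    (hc : ∀ n, Continuous (F' n)) (h1 : ∀ t, Tendsto (fun n => F n t) l (𝓝 (G t)))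
    (h2 : ∀ t, Tendsto (fun n => F' n t) l (𝓝 (G' t))) (hB : Continuous B)
    (hb : ∀ n t, |F' n t| ≤ B t) (hG : Continuous G') (t : ℝ) : HasDerivAt G (G' t) t := by
  have key : G = fun t => G 0 + ∫ s in (0 : ℝ)..t, G' s := by
    ext t
    have e1 : ∀ n, ∫ s in (0 : ℝ)..t, F' n s = F n t - F n 0 := fun n =>
      intervalIntegral.integral_eq_sub_of_hasDerivAt (fun s _ => hd n s)
        ((hc n).intervalIntegrable _ _)
    have e2 : Tendsto (fun n => ∫ s in (0 : ℝ)..t, F' n s) l (𝓝 (∫ s in (0 : ℝ)..t, G' s)) :=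
      intervalIntegral.tendsto_integral_filter_of_dominated_convergence B
        (Eventually.of_forall fun n => (hc n).aestronglyMeasurable)
        (Eventually.of_forall fun n => Eventually.of_forall fun s _ => hb n s)
        (hB.intervalIntegrable _ _) (Eventually.of_forall fun s _ => h2 s)
    simp only [e1] at e2
    have := tendsto_nhds_unique e2 ((h1 t).sub (h1 0))
    linarith
  rw [key]
  exact (intervalIntegral.integral_hasDerivAt_right (hG.intervalIntegrable _ _)
    hG.stronglyMeasurable.stronglyMeasurableAtFilter hG.continuousAt).const_add _

theorem abs_inner_mulL_le (w : ℝ →ᵇ ℝ) (f g : L2) : |⟪mulL w f, g⟫_ℝ| ≤ ‖w‖ * (‖f‖ * ‖g‖) := by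
  rw [← mul_assoc]
  exact (abs_real_inner_le_norm _ _).trans
    (mul_le_mul_of_nonneg_right (norm_mulL_le w f) (norm_nonneg _))

section transport
variable {P Q p q : ℝ → H1} {k l : ℝ}

theorem abs_inner_mulL_dq_le (w : ℝ →ᵇ ℝ) (P Q : H1) (h : ℝ) :
    |⟪mulL w (dq h (vL P)), dq h (vL Q)⟫_ℝ| ≤ ‖w‖ * (‖P‖ * ‖Q‖) :=
  (abs_inner_mulL_le _ _ _).trans (mul_le_mul_of_nonneg_left (mul_le_mul
    (((H1.isWeakDeriv P).norm_dq_le h).trans (norm_dL_le P))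
    (((H1.isWeakDeriv Q).norm_dq_le h).trans (norm_dL_le Q)) (norm_nonneg _) (norm_nonneg _))
    (norm_nonneg _))

theorem tendsto_inner_mulL_dq (w : ℝ →ᵇ ℝ) (P Q : H1) :
    Tendsto (fun h => ⟪mulL w (dq h (vL P)), dq h (vL Q)⟫_ℝ) (𝓝[≠] 0)
      (𝓝 ⟪mulL w (dL P), dL Q⟫_ℝ) :=
  (((mulL w).continuous.tendsto _).comp (H1.isWeakDeriv P).tendsto_dq).inner
    (H1.isWeakDeriv Q).tendsto_dq

/-- Evolution of a localized quadratic quantity in the derivatives along a symmetric hyperbolic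
system with source terms in `H¹`. -/
theorem hasDerivAt_inner_dL_dL (hP : Continuous P) (hQ : Continuous Q) (hp : Continuous p)
    (hq : Continuous q) (hP' : ∀ t, HasDerivAt (fun t => vL (P t)) (k • dL (Q t) + vL (p t)) t)
    (hQ' : ∀ t, HasDerivAt (fun t => vL (Q t)) (l • dL (P t) + vL (q t)) t)
    {w w' : ℝ →ᵇ ℝ} (hw : IsWeight w w') (t : ℝ) :
    HasDerivAt (fun t => ⟪mulL w (dL (P t)), dL (Q t)⟫_ℝ)
      (-(1 / 2) * (k * ⟪mulL w' (dL (Q t)), dL (Q t)⟫_ℝ + l * ⟪mulL w' (dL (P t)), dL (P t)⟫_ℝ)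
        + ⟪mulL w (dL (p t)), dL (Q t)⟫_ℝ + ⟪mulL w (dL (P t)), dL (q t)⟫_ℝ) t := by
  refine hasDerivAt_of_tendsto (l := 𝓝[≠] (0 : ℝ))
    (F := fun h t => ⟪mulL w (dq h (vL (P t))), dq h (vL (Q t))⟫_ℝ)
    (F' := fun h t => -(1 / 2) * (k * ⟪mulL w' (dq h (vL (Q t))), dq h (vL (Q t))⟫_ℝ
        + l * ⟪mulL w' (dq h (vL (P t))), dq h (vL (P t))⟫_ℝ)
        + ⟪mulL w (dq h (vL (p t))), dq h (vL (Q t))⟫_ℝ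
        + ⟪mulL w (dq h (vL (P t))), dq h (vL (q t))⟫_ℝ)
    (G' := fun t => -(1 / 2) * (k * ⟪mulL w' (dL (Q t)), dL (Q t)⟫_ℝ
        + l * ⟪mulL w' (dL (P t)), dL (P t)⟫_ℝ)
        + ⟪mulL w (dL (p t)), dL (Q t)⟫_ℝ + ⟪mulL w (dL (P t)), dL (q t)⟫_ℝ)
    (B := fun t => (1 / 2) * (|k| * (‖w'‖ * (‖Q t‖ * ‖Q t‖)) + |l| * (‖w'‖ * (‖P t‖ * ‖P t‖)))
      + ‖w‖ * (‖p t‖ * ‖Q t‖) + ‖w‖ * (‖P t‖ * ‖q t‖))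
    ?_ ?_ ?_ ?_ ?_ ?_ ?_ t
  · intro h t
    have d1 := (dq h).hasFDerivAt.comp_hasDerivAt t (hP' t)
    have d2 := (dq h).hasFDerivAt.comp_hasDerivAt t (hQ' t)
    have d3 := ((mulL w).hasFDerivAt.comp_hasDerivAt t d1).inner ℝ d2
    refine d3.congr_deriv ?_
    -- For each fixed `h` the quotients lie in H¹, so the terms with one derivative too many are
    -- halves of exact derivatives and leave only `w'`.
    have i1 := hw.inner_deriv_self ((H1.isWeakDeriv (P t)).dq h)
    have i2 := hw.inner_deriv_self ((H1.isWeakDeriv (Q t)).dq h)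
    simp only [Function.comp_apply, map_add, map_smul, inner_add_left, inner_add_right,
      inner_smul_left, inner_smul_right, conj_trivial]
    rw [i2, inner_mulL_comm w _ (dq h (dL (P t))), i1]
    ring
  · intro h; fun_prop
  · exact fun t => tendsto_inner_mulL_dq w _ _
  · exact fun t => (((((tendsto_inner_mulL_dq w' (Q t) (Q t)).const_mul k).add
      ((tendsto_inner_mulL_dq w' (P t) (P t)).const_mul l)).const_mul _).add
      (tendsto_inner_mulL_dq w (p t) (Q t))).add (tendsto_inner_mulL_dq w (P t) (q t))
  · fun_prop
  · intro h t
    refine (abs_add_le _ _).trans (add_le_add ((abs_add_le _ _).trans (add_le_add ?_ ?_)) ?_)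
    · rw [abs_mul]
      norm_num
      refine (abs_add_le _ _).trans ?_
      rw [abs_mul, abs_mul]
      exact add_le_add (mul_le_mul_of_nonneg_left (abs_inner_mulL_dq_le _ _ _ _) (abs_nonneg _))
        (mul_le_mul_of_nonneg_left (abs_inner_mulL_dq_le _ _ _ _) (abs_nonneg _))
    · exact abs_inner_mulL_dq_le _ _ _ _
    · exact abs_inner_mulL_dq_le _ _ _ _
  · fun_prop

theorem tendsto_inner_dq (P Q : H1) :
    Tendsto (fun h => ⟪dq h (vL P), dq h (vL Q)⟫_ℝ) (𝓝[≠] 0) (𝓝 ⟪dL P, dL Q⟫_ℝ) :=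
  (H1.isWeakDeriv P).tendsto_dq.inner (H1.isWeakDeriv Q).tendsto_dq

theorem abs_inner_dq_le (P Q : H1) (h : ℝ) :
    |⟪dq h (vL P), dq h (vL Q)⟫_ℝ| ≤ ‖P‖ * ‖Q‖ :=
  (abs_real_inner_le_norm _ _).trans (mul_le_mul
    (((H1.isWeakDeriv P).norm_dq_le h).trans (norm_dL_le P))
    (((H1.isWeakDeriv Q).norm_dq_le h).trans (norm_dL_le Q)) (norm_nonneg _) (norm_nonneg _))

/-- The coefficients `l` and `k` are crossed on purpose: the top-order contributions become 2kl(⟪Pₓ,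
Qₓₓ⟫ + ⟪Qₓ, Pₓₓ⟫), which formally vanishes. For the system this is the gradient part of the energy.
-/
theorem hasDerivAt_energy_dL (hP : Continuous P) (hQ : Continuous Q) (hp : Continuous p)
    (hq : Continuous q) (hP' : ∀ t, HasDerivAt (fun t => vL (P t)) (k • dL (Q t) + vL (p t)) t)
    (hQ' : ∀ t, HasDerivAt (fun t => vL (Q t)) (l • dL (P t) + vL (q t)) t) (t : ℝ) :
    HasDerivAt (fun t => l * ⟪dL (P t), dL (P t)⟫_ℝ + k * ⟪dL (Q t), dL (Q t)⟫_ℝ)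
      (2 * l * ⟪dL (P t), dL (p t)⟫_ℝ + 2 * k * ⟪dL (Q t), dL (q t)⟫_ℝ) t := by
  refine hasDerivAt_of_tendsto (l := 𝓝[≠] (0 : ℝ))
    (F := fun h t => l * ⟪dq h (vL (P t)), dq h (vL (P t))⟫_ℝ
      + k * ⟪dq h (vL (Q t)), dq h (vL (Q t))⟫_ℝ)
    (F' := fun h t => 2 * l * ⟪dq h (vL (P t)), dq h (vL (p t))⟫_ℝ
      + 2 * k * ⟪dq h (vL (Q t)), dq h (vL (q t))⟫_ℝ)
    (G' := fun t => 2 * l * ⟪dL (P t), dL (p t)⟫_ℝ + 2 * k * ⟪dL (Q t), dL (q t)⟫_ℝ)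
    (B := fun t => |2 * l| * (‖P t‖ * ‖p t‖) + |2 * k| * (‖Q t‖ * ‖q t‖))
    ?_ ?_ ?_ ?_ ?_ ?_ ?_ t
  · intro h t
    have d1 := (dq h).hasFDerivAt.comp_hasDerivAt t (hP' t)
    have d2 := (dq h).hasFDerivAt.comp_hasDerivAt t (hQ' t)
    have d3 := ((d1.inner ℝ d1).const_mul l).add ((d2.inner ℝ d2).const_mul k)
    refine d3.congr_deriv ?_
    have i1 := ((H1.isWeakDeriv (P t)).dq h).integral_by_parts ((H1.isWeakDeriv (Q t)).dq h)
    simp only [Function.comp_apply, map_add, map_smul, inner_add_left, inner_add_right,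
      inner_smul_left, inner_smul_right, conj_trivial]
    rw [real_inner_comm (dq h (vL (P t))) (dq h (vL (p t))),
      real_inner_comm (dq h (vL (Q t))) (dq h (vL (q t))),
      real_inner_comm (dq h (vL (P t))) (dq h (dL (Q t))),
      real_inner_comm (dq h (dL (P t))) (dq h (vL (Q t)))] at *
    linear_combination 2 * k * l * i1
  · intro h; fun_prop
  · exact fun t => ((tendsto_inner_dq (P t) (P t)).const_mul l).add
      ((tendsto_inner_dq (Q t) (Q t)).const_mul k)
  · exact fun t => ((tendsto_inner_dq (P t) (p t)).const_mul _).add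
      ((tendsto_inner_dq (Q t) (q t)).const_mul _)
  · fun_prop
  · intro h t
    refine (abs_add_le _ _).trans ?_
    rw [abs_mul, abs_mul (2 * k)]
    exact add_le_add (mul_le_mul_of_nonneg_left (abs_inner_dq_le _ _ _) (abs_nonneg _))
      (mul_le_mul_of_nonneg_left (abs_inner_dq_le _ _ _) (abs_nonneg _))
  · fun_prop

end transport

/-- Product rule when each factor is differentiable only in a space weaker than the one in which
it is continuous. -/
theorem hasDerivAt_mixed {X₁ X₂ E₁ E₂ Z : Type*} [NormedAddCommGroup X₁] [NormedSpace ℝ X₁]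
    [NormedAddCommGroup X₂] [NormedSpace ℝ X₂] [NormedAddCommGroup E₁] [NormedSpace ℝ E₁]
    [NormedAddCommGroup E₂] [NormedSpace ℝ E₂] [NormedAddCommGroup Z] [NormedSpace ℝ Z]
    (B₁ : X₁ →L[ℝ] E₂ →L[ℝ] Z) (B₂ : E₁ →L[ℝ] X₂ →L[ℝ] Z) (i₁ : E₁ →L[ℝ] X₁)
    (i₂ : E₂ →L[ℝ] X₂) (hB : ∀ x y, B₁ (i₁ x) y = B₂ x (i₂ y)) {f : ℝ → E₁} {g : ℝ → E₂}
    {f' : X₁} {g' : X₂} {t : ℝ} (hg : ContinuousAt g t)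
    (hf' : HasDerivAt (fun t => i₁ (f t)) f' t) (hg' : HasDerivAt (fun t => i₂ (g t)) g' t) :
    HasDerivAt (fun t => B₁ (i₁ (f t)) (g t)) (B₁ f' (g t) + B₂ (f t) g') t := by
  rw [hasDerivAt_iff_tendsto_slope] at *
  -- The increment is split so that the slope of `f` meets the current `g s`, which needs continuity
  -- of `g` in the strong space, while the slope of `g` meets the frozen `f t`.
  have h1 : Tendsto (fun s => B₁ (slope (fun t => i₁ (f t)) t s) (g s)
      + B₂ (f t) (slope (fun t => i₂ (g t)) t s)) (𝓝[≠] t) (𝓝 (B₁ f' (g t) + B₂ (f t) g')) :=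
    ((B₁.continuous₂.tendsto (f', g t)).comp
      (hf'.prodMk_nhds (hg.tendsto.mono_left nhdsWithin_le_nhds))).add
      (((B₂ (f t)).continuous.tendsto _).comp hg')
  refine h1.congr fun s => ?_
  simp only [slope_def_module, map_smul, map_sub, _root_.smul_apply,
    _root_.sub_apply, hB]
  rw [← smul_add]
  congr 1
  abel

end

/-! ### Conservation of the Hamiltonian and persistence of smallness. -/

section

/-- The operator ∂ₓG is skew-adjoint on L²; this drives energy conservation. -/
theorem inner_dL_gre_antisymm (f g : L2) : ⟪dL (gre f), g⟫_ℝ + ⟪dL (gre g), f⟫_ℝ = 0 := by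
  have h1 := inner_gre g (dgre f)
  rw [H1.inner_eq, vL_dgre, dL_dgre, inner_sub_right] at h1
  have h2 := (H1.isWeakDeriv (gre g)).integral_by_parts (H1.isWeakDeriv (gre f))
  rw [real_inner_comm]
  linarith

theorem inner_dL_gre_vL (P : H1) (g : L2) : ⟪dL (gre (vL P)), g⟫_ℝ = ⟪dL P, vL (gre g)⟫_ℝ := by
  have h1 := inner_dL_gre_antisymm (vL P) g
  have h2 := (H1.isWeakDeriv (gre g)).integral_by_parts (H1.isWeakDeriv P)
  rw [real_inner_comm (vL (gre g))]
  linarith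

/-- Formally uₜ = -∂ₓG(δH/δη) and ηₜ = -∂ₓG(δH/δu), so H' vanishes by skewness of ∂ₓG. The gradient
part is kept in integrated form because second derivatives need not be in L². Here `r` plays uη and
`s` plays u²/2. -/
theorem energy_cancellation (a c : ℝ) (P Q : H1) (r s : L2) :
    ⟪c • dL Q + vL (src c (vL Q) s), vL P + r⟫_ℝ + ⟪a • dL P + vL (src a (vL P) r), vL Q + s⟫_ℝ
      - a * ⟪dL P, dL (src c (vL Q) s)⟫_ℝ - c * ⟪dL Q, dL (src a (vL P) r)⟫_ℝ = 0 := by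
  have h1 := inner_dL_gre_antisymm (vL P) (vL Q)
  have h2 := inner_dL_gre_antisymm (vL P) s
  have h3 := inner_dL_gre_antisymm r (vL Q)
  have h4 := inner_dL_gre_antisymm r s
  have h5 := inner_dL_gre_vL P s
  have h6 := inner_dL_gre_vL Q r
  have h7 := inner_dL_gre_vL P (vL Q)
  have h8 := inner_dL_gre_vL Q (vL P)
  have h9 := (H1.isWeakDeriv P).integral_by_parts (H1.isWeakDeriv Q)
  rw [real_inner_comm (dL Q)] at h9
  simp only [vL_src, dL_src, inner_add_left, inner_add_right, inner_sub_left, inner_sub_right,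
    inner_neg_left, inner_neg_right, inner_smul_left, inner_smul_right, conj_trivial]
  linear_combination (-1 - a - c - a * c) * h1 - h2 - h3 - h4 + a * c * h1 - a * h5 - c * h6
    - a * c * h7 - a * c * h8 - a * c * h9 + a * c * h1 + c * (h1 - h8) + a * (h1 - h7)

variable {a c : ℝ} {u η : ℝ → H1}

/-- As uₜ is only known in L², the chain rule uses u as a bounded function in one factor and as an
L² function in the other. -/
theorem IsGlobalSolution.hasDerivAt_sq (h : IsGlobalSolution a c u η) {x' : L2} {t : ℝ}
    (hx : HasDerivAt (fun t => vL (u t)) x' t) :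
    HasDerivAt (fun t => mulL (toB (u t)) (vL (u t))) ((2 : ℝ) • mulL (toB (u t)) x') t := by
  have h1 := hasDerivAt_mixed (f := u) (g := u) (t := t) (mulL.comp toB).flip (mulL.comp toB) vL vL
    (fun x y => mulL_toB_comm y x) h.continuous_u.continuousAt hx hx
  simp only [ContinuousLinearMap.flip_apply, ContinuousLinearMap.comp_apply] at h1
  rw [two_smul]
  exact h1

/-- The Hamiltonian. -/
def hamiltonian (a c : ℝ) (U E : H1) : ℝ :=
  1 / 2 * (-(a * ⟪dL U, dL U⟫_ℝ + c * ⟪dL E, dL E⟫_ℝ) + ⟪vL U, vL U⟫_ℝ + ⟪vL E, vL E⟫_ℝ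
    + ⟪mulL (toB U) (vL U), vL E⟫_ℝ)

theorem continuous_src {k : ℝ} {f n : ℝ → L2} (hf : Continuous f) (hn : Continuous n) :
    Continuous fun t => src k (f t) (n t) :=
  ((dgre.continuous.comp hf).const_smul (1 + k)).neg.sub (dgre.continuous.comp hn)

theorem IsGlobalSolution.hasDerivAt_hamiltonian (h : IsGlobalSolution a c u η) (t : ℝ) :
    HasDerivAt (fun t => hamiltonian a c (u t) (η t)) 0 t := by
  have hu := h.continuous_u
  have hη := h.continuous_eta
  have d1 := hasDerivAt_energy_dL hu hη
    (continuous_src (by fun_prop) (by fun_prop)) (continuous_src (by fun_prop) (by fun_prop))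
    h.hasDerivAt_u h.hasDerivAt_eta t
  have du := h.hasDerivAt_u t
  have de := h.hasDerivAt_eta t
  have d2 := du.inner ℝ du
  have d3 := de.inner ℝ de
  have d4 := (h.hasDerivAt_sq du).inner ℝ de
  have key := energy_cancellation a c (u t) (η t) (mulL (toB (u t)) (vL (η t)))
    ((1 / 2 : ℝ) • mulL (toB (u t)) (vL (u t)))
  refine ((((d1.neg.add d2).add d3).add d4).const_mul (1 / 2)).congr_deriv ?_
  set X := c • dL (η t) + vL (src c (vL (η t)) ((1 / 2 : ℝ) • mulL (toB (u t)) (vL (u t))))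
  set Y := a • dL (u t) + vL (src a (vL (u t)) (mulL (toB (u t)) (vL (η t))))
  simp only [inner_add_right, inner_smul_left, inner_smul_right, conj_trivial] at key ⊢
  rw [inner_mulL_right] at key
  rw [real_inner_comm X, real_inner_comm Y, real_inner_comm Y (mulL _ _)]
  linear_combination key

theorem IsGlobalSolution.hamiltonian_eq (h : IsGlobalSolution a c u η) (t : ℝ) :
    hamiltonian a c (u t) (η t) = hamiltonian a c (u 0) (η 0) :=
  is_const_of_deriv_eq_zero (fun t => (h.hasDerivAt_hamiltonian t).differentiableAt)
    (fun t => (h.hasDerivAt_hamiltonian t).deriv) t 0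

theorem abs_cubic_le (U E : H1) :
    |⟪mulL (toB U) (vL U), vL E⟫_ℝ| ≤ pairNorm U E * pairNorm U E ^ 2 := by
  have h0 : pairNorm U E ^ 2 = ‖U‖ ^ 2 + ‖E‖ ^ 2 := Real.sq_sqrt (by positivity)
  have hU : ‖U‖ ≤ pairNorm U E := Real.le_sqrt_of_sq_le (by nlinarith [sq_nonneg ‖E‖])
  refine (abs_inner_mulL_le _ _ _).trans ?_
  refine mul_le_mul ((norm_toB_le U).trans hU) ?_ (by positivity) (Real.sqrt_nonneg _)
  rw [h0]
  have h1 := norm_vL_le U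
  have h2 := norm_vL_le E
  have := mul_le_mul h1 h2 (norm_nonneg _) (norm_nonneg _)
  nlinarith [sq_nonneg (‖U‖ - ‖E‖), sq_nonneg ‖U‖, sq_nonneg ‖E‖]

theorem continuous_pairNorm {u η : ℝ → H1} (hu : Continuous u) (hη : Continuous η) :
    Continuous fun t => pairNorm (u t) (η t) := by
  unfold pairNorm; fun_prop

/-- Small solutions remain small in `H¹`. -/
theorem exists_uniform_bound (ha : a < 0) (hc : c < 0) : ∃ ε₁ > 0, ∃ A ≥ 1, ∀ ε, 0 < ε → ε ≤ ε₁ →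
    ∀ u η : ℝ → H1, IsGlobalSolution a c u η → pairNorm (u 0) (η 0) < ε →
      ∀ t, pairNorm (u t) (η t) ≤ A * ε := by
  -- `k` bounds the quadratic part of twice the energy from below; `L` bounds it from above.
  obtain ⟨k, hk0, hka, hkc, hk1⟩ : ∃ k, 0 < k ∧ k ≤ -a ∧ k ≤ -c ∧ k ≤ 1 :=
    ⟨min (min (-a) (-c)) 1, by simp [ha, hc], by simp, by simp, by simp⟩
  set L := 1 + (-a) + (-c) with hL
  have hL1 : 1 < L := by linarith
  set A := 2 * L / k with hA
  have hA2 : 2 ≤ A := by rw [hA, le_div_iff₀ hk0]; nlinarith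
  have lower : ∀ U E : H1, (k - pairNorm U E) * pairNorm U E ^ 2 ≤ 2 * hamiltonian a c U E := by
    intro U E
    have h1 := (abs_le.1 (abs_cubic_le U E)).1
    have h0 : pairNorm U E ^ 2 = ‖U‖ ^ 2 + ‖E‖ ^ 2 := Real.sq_sqrt (by positivity)
    rw [hamiltonian]
    simp only [real_inner_self_eq_norm_sq]
    rw [H1.norm_sq, H1.norm_sq] at h0
    rw [h0] at h1
    rw [sub_mul, h0]
    nlinarith [sq_nonneg ‖vL U‖, sq_nonneg ‖dL U‖, sq_nonneg ‖vL E‖, sq_nonneg ‖dL E‖]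
  have upper : ∀ U E : H1, 2 * hamiltonian a c U E ≤ (L + pairNorm U E) * pairNorm U E ^ 2 := by
    intro U E
    have h1 := (abs_le.1 (abs_cubic_le U E)).2
    have h0 : pairNorm U E ^ 2 = ‖U‖ ^ 2 + ‖E‖ ^ 2 := Real.sq_sqrt (by positivity)
    rw [hamiltonian]
    simp only [real_inner_self_eq_norm_sq]
    rw [H1.norm_sq, H1.norm_sq] at h0
    rw [h0] at h1
    rw [add_mul, h0]
    nlinarith [sq_nonneg ‖vL U‖, sq_nonneg ‖dL U‖, sq_nonneg ‖vL E‖, sq_nonneg ‖dL E‖]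
  have hA0 : 0 < A := by linarith
  refine ⟨k / (4 * A), by positivity, A, by linarith, fun ε hε hε1 u η h h0 t => ?_⟩
  have hεA : A * ε ≤ k / 4 := by
    rw [le_div_iff₀ (by positivity)] at hε1; linarith
  have hε1' : ε ≤ 1 := by nlinarith
  have hn : ∀ s, 0 ≤ pairNorm (u s) (η s) := fun s => Real.sqrt_nonneg _
  have hup : 2 * hamiltonian a c (u 0) (η 0) ≤ 2 * L * ε ^ 2 := by
    refine (upper _ _).trans ?_
    have hsq : pairNorm (u 0) (η 0) ^ 2 ≤ ε ^ 2 := pow_le_pow_left₀ (hn 0) h0.le 2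
    refine mul_le_mul (by linarith) hsq (sq_nonneg _) (by linarith)
  -- Where the norm N is at most k/2, conservation gives (k/2) N² ≤ 2Lε², that is N² ≤ 2Aε² ≤ (Aε)²
  -- since A = 2L/k ≥ 2.
  have step : ∀ s, pairNorm (u s) (η s) ≤ k / 2 → pairNorm (u s) (η s) ≤ A * ε := by
    intro s hs
    have h1 := lower (u s) (η s)
    rw [h.hamiltonian_eq s] at h1
    have h2 : k / 2 * pairNorm (u s) (η s) ^ 2 ≤ 2 * L * ε ^ 2 :=
      (mul_le_mul_of_nonneg_right (by linarith) (sq_nonneg _)).trans (h1.trans hup)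
    have h3 : pairNorm (u s) (η s) ^ 2 ≤ (A * ε) ^ 2 := by
      have : pairNorm (u s) (η s) ^ 2 ≤ 2 * A * ε ^ 2 := by
        rw [hA]
        rw [← mul_le_mul_iff_right₀ (by positivity : 0 < k / 2)]
        refine h2.trans (le_of_eq ?_)
        field_simp
      nlinarith [sq_nonneg ε]
    exact abs_le_of_sq_le_sq' h3 (by positivity) |>.2
  by_contra hcon
  have hbig : k / 2 < pairNorm (u t) (η t) := by
    by_contra hle
    exact hcon (step t (not_lt.1 hle))
  -- Continuity argument: exceeding k/2 would force the value k/2 at some time, where `step` gives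
  -- at most Aε ≤ k/4.
  obtain ⟨s, hs⟩ := mem_range_of_exists_le_of_exists_ge
    (continuous_pairNorm h.continuous_u h.continuous_eta) (c := k / 2)
    ⟨0, by nlinarith⟩ ⟨t, hbig.le⟩
  have := step s hs.le
  have hs' : pairNorm (u s) (η s) = k / 2 := hs
  linarith

end

/-! ### Weighted norms, elliptic estimate and the coercive quadratic form. -/

/-- The weighted square norm `∫ w f²`. -/
def wn (w : ℝ →ᵇ ℝ) (f : L2) : ℝ := ⟪mulL w f, f⟫_ℝ

theorem wn_nonneg {w : ℝ →ᵇ ℝ} (hw : ∀ x, 0 ≤ w x) (f : L2) : 0 ≤ wn w f := by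
  rw [wn, inner_mulL]
  exact integral_nonneg fun x => mul_nonneg (hw x) (mul_self_nonneg _)

theorem abs_inner_mulL_le_wn {v w : ℝ →ᵇ ℝ} {δ : ℝ} (h : ∀ x, |v x| ≤ δ * w x) (f g : L2) :
    |⟪mulL v f, g⟫_ℝ| ≤ δ / 2 * (wn w f + wn w g) := by
  rw [wn, wn, inner_mulL, inner_mulL, inner_mulL,
    ← integral_add (integrable_weight w f f) (integrable_weight w g g), ← integral_const_mul]
  refine (abs_integral_le_integral_abs).trans (integral_mono (integrable_weight v f g).abs
    (((integrable_weight w f f).add (integrable_weight w g g)).const_mul _) fun x => ?_)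
  simp only
  rw [abs_mul, abs_mul]
  have h1 := mul_le_mul_of_nonneg_right (h x) (mul_nonneg (abs_nonneg (f x)) (abs_nonneg (g x)))
  have h2 : 0 ≤ δ * w x := (abs_nonneg _).trans (h x)
  nlinarith [mul_nonneg h2 (sq_nonneg (|f x| - |g x|)), abs_mul_abs_self (f x),
    abs_mul_abs_self (g x)]

theorem wn_mulL_le {w b : ℝ →ᵇ ℝ} (hw : ∀ x, 0 ≤ w x) {M : ℝ} (hb : ‖b‖ ≤ M) (f : L2) :
    wn w (mulL b f) ≤ M ^ 2 * wn w f := by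
  rw [wn, wn, inner_mulL, inner_mulL, ← integral_const_mul]
  refine integral_mono_ae (integrable_weight w _ _) ((integrable_weight w f f).const_mul _) ?_
  filter_upwards [coeFn_mulL b f] with x hx
  rw [hx]
  have h1 : |b x| ≤ M := (b.norm_coe_le_norm x).trans hb
  have h2 : b x ^ 2 ≤ M ^ 2 := sq_le_sq' (abs_le.1 h1).1 (abs_le.1 h1).2
  nlinarith [mul_nonneg (hw x) (sq_nonneg (f x)), mul_le_mul_of_nonneg_right h2
    (mul_nonneg (hw x) (sq_nonneg (f x)))]

theorem wn_smul (w : ℝ →ᵇ ℝ) (r : ℝ) (f : L2) : wn w (r • f) = r ^ 2 * wn w f := by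
  simp only [wn, map_smul, inner_smul_left, inner_smul_right, conj_trivial]; ring

theorem wn_add (w : ℝ →ᵇ ℝ) (f g : L2) :
    wn w (f + g) = wn w f + 2 * ⟪mulL w f, g⟫_ℝ + wn w g := by
  simp only [wn, map_add, inner_add_left, inner_add_right]
  rw [inner_mulL_comm w g f]; ring

theorem wn_sub (w : ℝ →ᵇ ℝ) (f g : L2) :
    wn w (f - g) = wn w f - 2 * ⟪mulL w f, g⟫_ℝ + wn w g := by
  simp only [wn, map_sub, inner_sub_left, inner_sub_right]
  rw [inner_mulL_comm w g f]; ring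

theorem wn_sub_le {w : ℝ →ᵇ ℝ} (hw : ∀ x, 0 ≤ w x) (f g : L2) :
    wn w (f - g) ≤ 2 * (wn w f + wn w g) := by
  have h := wn_nonneg hw (f + g)
  rw [wn_add] at h
  rw [wn_sub]; linarith

/-- Cauchy-Schwarz for an element of small weighted norm. -/
theorem abs_inner_le_of_wn_le {w : ℝ →ᵇ ℝ} (hw : ∀ x, 0 ≤ w x) {M T : ℝ} (hM : 0 < M) {f : L2}
    (hf : wn w f ≤ M ^ 2 * T) (g : L2) : |⟪mulL w f, g⟫_ℝ| ≤ M / 2 * (T + wn w g) := by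
  have h1 := wn_nonneg hw (f + M • g)
  have h2 := wn_nonneg hw (f - M • g)
  rw [wn_add, wn_smul, inner_smul_right] at h1
  rw [wn_sub, wn_smul, inner_smul_right] at h2
  rw [abs_le]
  constructor <;> rw [← mul_le_mul_iff_right₀ hM] <;> nlinarith

/-- Weighted elliptic estimate for `(1 - ∂ₓ²)⁻¹`. -/
theorem wn_gre_le {w w' : ℝ →ᵇ ℝ} (hww : IsWeight w w') (hw : ∀ x, 0 ≤ w x) {δ : ℝ} (hδ : δ ≤ 1)
    (hw' : ∀ x, |w' x| ≤ δ * w x) (f : L2) :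
    wn w (vL (gre f)) + wn w (dL (gre f)) ≤ 4 * wn w f := by
  -- The equation z - z'' = f tested against w z.
  have h1 := hww.integral_by_parts (isWeakDeriv_dL_gre f) (H1.isWeakDeriv (gre f))
  have h2 := (abs_le.1 (abs_inner_mulL_le_wn hw' (dL (gre f)) (vL (gre f)))).1
  have a0 := wn_nonneg hw (vL (gre f))
  have a1 := wn_nonneg hw (dL (gre f))
  -- Young's inequality in the form ⟪wz, f⟫ ≤ (wn z)/4 + wn f. At least a quarter of the left side
  -- survives the `w'` term, hence the constant 4.
  have h3 := wn_nonneg hw (vL (gre f) - (2 : ℝ) • f)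
  rw [map_sub, inner_sub_left, inner_mulL_comm w f] at h1
  rw [wn_sub, wn_smul, inner_smul_right] at h3
  change wn w _ - _ + wn w _ = _ at h1
  have h4 : -(1 / 2 * (wn w (dL (gre f)) + wn w (vL (gre f))))
      ≤ ⟪mulL w' (dL (gre f)), vL (gre f)⟫_ℝ := by
    refine le_trans (neg_le_neg ?_) h2
    exact mul_le_mul_of_nonneg_right (by linarith) (by linarith)
  linarith

/-- Coercivity of the quadratic part of the virial identity. -/
theorem virial_form_coercive {α m s κ : ℝ} (hα : 0 ≤ α) (hs : 0 ≤ s) (hκ : 0 ≤ κ) (hκ1 : κ ≤ 1)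
    (h1 : κ ≤ 3 * α - 1 - m + 2 * s * (1 - κ)) (h2 : κ ≤ α * (1 - m) - (1 - κ) * s ^ 2)
    {w w' : ℝ →ᵇ ℝ} (hww : IsWeight w w') (hw : ∀ x, 0 ≤ w x) {δ : ℝ} (hδ : 0 ≤ δ)
    (hw' : ∀ x, |w' x| ≤ δ * w x) {z₀ z₁ z₂ z₃ : L2} (d₀ : IsWeakDeriv z₀ z₁)
    (d₁ : IsWeakDeriv z₁ z₂) (d₂ : IsWeakDeriv z₂ z₃) :
    (κ - (2 * α + |2 * α * (1 - m) - m * (1 - α)| + 4 * s) * δ)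
        * (wn w z₀ + wn w z₁ + wn w z₂ + wn w z₃)
      ≤ α * (1 - m) * wn w (z₁ - z₃) + (2 * α - 1) * wn w (z₀ - z₂)
        + 2 * (1 - α) * ⟪mulL w z₀, z₀ - z₂⟫_ℝ - m * (1 - α) * ⟪mulL w z₁, z₁ - z₃⟫_ℝ := by
  have e1 := hww.integral_by_parts d₀ d₁
  have e2 := hww.integral_by_parts d₁ d₂
  have b1 := abs_inner_mulL_le_wn hw' z₀ z₁
  have b2 := abs_inner_mulL_le_wn hw' z₁ z₂
  have n0 := wn_nonneg hw z₀
  have n1 := wn_nonneg hw z₁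
  have n2 := wn_nonneg hw z₂
  have n3 := wn_nonneg hw z₃
  -- With frozen weight the form has symbol (1+y)(1 + βy + ρy²), β = 3α-1-m, ρ = α(1-m). These two
  -- squares have total symbol (1+y)(1-sy)². Subtracting 1-κ times them leaves coefficients κ,
  -- β+2s(1-κ) and ρ-(1-κ)s², all at least κ by `h1` and `h2`.
  have s1 := wn_nonneg hw (z₀ + s • z₂)
  have s2 := wn_nonneg hw (z₁ + s • z₃)
  rw [wn_add, wn_smul, inner_smul_right] at s1 s2
  rw [wn_sub, wn_sub, inner_sub_right, inner_sub_right]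
  change wn w z₁ + _ = _ at e1
  change wn w z₂ + _ = _ at e2
  change _ ≤ _ + 2 * (1 - α) * (wn w z₀ - _) - m * (1 - α) * (wn w z₁ - _)
  set A := ⟪mulL w z₀, z₂⟫_ℝ
  set B := ⟪mulL w z₁, z₃⟫_ℝ
  set D₁ := ⟪mulL w' z₀, z₁⟫_ℝ
  set D₂ := ⟪mulL w' z₁, z₂⟫_ℝ
  set N₀ := wn w z₀
  set N₁ := wn w z₁
  set N₂ := wn w z₂
  set N₃ := wn w z₃
  set k := 2 * α * (1 - m) - m * (1 - α) with hk
  -- The cross terms are minus the intermediate norms, up to errors in `w'` of relative size δ.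
  have hA : A = -N₁ - D₁ := by linarith
  have hB : B = -N₂ - D₂ := by linarith
  have f1 : |D₁| ≤ δ / 2 * (N₀ + N₁ + N₂ + N₃) := b1.trans
    (mul_le_mul_of_nonneg_left (by linarith) (by linarith))
  have f2 : |D₂| ≤ δ / 2 * (N₀ + N₁ + N₂ + N₃) := b2.trans
    (mul_le_mul_of_nonneg_left (by linarith) (by linarith))
  have hS : 0 ≤ δ / 2 * (N₀ + N₁ + N₂ + N₃) := (abs_nonneg _).trans f1
  have g1 : |(2 * α + 2 * s * (1 - κ)) * D₁| ≤ (2 * α + 2 * s) * (δ / 2 * (N₀ + N₁ + N₂ + N₃)) := by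
    rw [abs_mul, abs_of_nonneg (by nlinarith)]
    exact mul_le_mul (by nlinarith) f1 (abs_nonneg _) (by linarith)
  have g2 : |(k + 2 * s * (1 - κ)) * D₂| ≤ (|k| + 2 * s) * (δ / 2 * (N₀ + N₁ + N₂ + N₃)) := by
    rw [abs_mul]
    refine mul_le_mul ((abs_add_le _ _).trans (add_le_add le_rfl ?_)) f2 (abs_nonneg _)
      (by positivity)
    rw [abs_of_nonneg (by nlinarith)]; nlinarith
  have g1' := (abs_le.1 g1).1
  have g2' := (abs_le.1 g2).1
  have p1 := mul_nonneg (sub_nonneg.2 hκ1) (add_nonneg s1 s2)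
  have p2 := mul_le_mul_of_nonneg_right h1 (add_nonneg n1 n2)
  have p3 := mul_le_mul_of_nonneg_right h2 (add_nonneg n2 n3)
  have hk0 := abs_nonneg k
  have q1 : 0 ≤ (2 * α + |k| + 4 * s) * (δ / 2 * (N₀ + N₁ + N₂ + N₃)) := by positivity
  have p4 := mul_nonneg hκ (add_nonneg n1 n2)
  rw [hA, hB] at p1
  rw [hA, hB]
  clear_value k A B D₁ D₂ N₀ N₁ N₂ N₃
  generalize |k| = K at *
  subst hk
  linarith [p1, p2, p3, p4, g1', g2', q1]

/-! ### The virial identity and its coercivity. -/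

section

/-- The localized virial functional `∫ φ (u η + ∂ₓu ∂ₓη) + k ∫ w η ∂ₓu`. -/
def virial (k : ℝ) (φ w : ℝ →ᵇ ℝ) (U E : H1) : ℝ :=
  ⟪mulL φ (vL U), vL E⟫_ℝ + ⟪mulL φ (dL U), dL E⟫_ℝ + k * ⟪mulL w (vL E), dL U⟫_ℝ

/-- The time derivative of the virial functional along the flow, for fixed weights with
`φ' = w`. -/
def virialRate (k a c : ℝ) (w w' : ℝ →ᵇ ℝ) (U E : H1) : ℝ :=
  -(1 / 2) * (c * wn w (dL E) + a * wn w (dL U)) - (1 / 2 + c) * wn w (vL E)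
    - (1 / 2 + a) * wn w (vL U) + (1 + c) * ⟪mulL w (vL (gre (vL E))), vL E⟫_ℝ
    + (1 + a) * ⟪mulL w (vL (gre (vL U))), vL U⟫_ℝ
    + ⟪mulL w (vL (gre ((1 / 2 : ℝ) • mulL (toB U) (vL U)))), vL E⟫_ℝ
    + ⟪mulL w (vL (gre (mulL (toB U) (vL E)))), vL U⟫_ℝ
    - 1 / 2 * ⟪mulL w (mulL (toB U) (vL U)), vL E⟫_ℝ
    + k * (a * wn w (dL U) - (1 + a) * ⟪mulL w (dL (gre (vL U))), dL U⟫_ℝ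
      - ⟪mulL w (dL (gre (mulL (toB U) (vL E)))), dL U⟫_ℝ - c * wn w (dL E)
      + (1 + c) * ⟪mulL w (dL (gre (vL E))), dL E⟫_ℝ
      + ⟪mulL w (dL (gre ((1 / 2 : ℝ) • mulL (toB U) (vL U)))), dL E⟫_ℝ
      - c * ⟪mulL w' (vL E), dL E⟫_ℝ + (1 + c) * ⟪mulL w' (vL E), dL (gre (vL E))⟫_ℝ
      + ⟪mulL w' (vL E), dL (gre ((1 / 2 : ℝ) • mulL (toB U) (vL U)))⟫_ℝ)

variable {a c : ℝ} {u η : ℝ → H1}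

/-- The time derivative of uₓ need not be in L², so the x-derivative is moved onto w η before
differentiating u in time. -/
theorem hasDerivAt_inner_vL_dL {w w' : ℝ →ᵇ ℝ} (hw : IsWeight w w') (hu : Continuous u) {x' e' : L2}
    {t : ℝ} (hx : HasDerivAt (fun t => vL (u t)) x' t)
    (he : HasDerivAt (fun t => vL (η t)) e' t) :
    HasDerivAt (fun t => ⟪mulL w (vL (η t)), dL (u t)⟫_ℝ)
      (⟪mulL w e', dL (u t)⟫_ℝ - ⟪mulL w' (vL (η t)) + mulL w (dL (η t)), x'⟫_ℝ) t := by
  have h1 := hasDerivAt_mixed (f := η) (g := u) (t := t)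
    ((innerSL ℝ (E := L2)).bilinearComp (mulL w) dL)
    (-((innerSL ℝ (E := L2)).comp ((mulL w').comp vL + (mulL w).comp dL))) vL vL
    (fun P Q => by
      have := hw.integral_by_parts (H1.isWeakDeriv P) (H1.isWeakDeriv Q)
      change ⟪mulL w (vL P), dL Q⟫_ℝ = -⟪mulL w' (vL P) + mulL w (dL P), vL Q⟫_ℝ
      rw [inner_add_left]
      linarith) hu.continuousAt he hx
  exact h1

/-- The term uₓηₓ completes the terms from uη to exact derivatives: ∂ₓGη·η + Gη·ηₓ = ∂ₓ(Gη·η),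
similarly for u and the sources, and (u²/2)ηₓ + uη uₓ = ½∂ₓ(u²η). Integration by parts leaves w = φ'
everywhere; only the k-term brings in w'. -/
theorem IsGlobalSolution.hasDerivAt_virial (h : IsGlobalSolution a c u η) (k : ℝ)
    {φ w w' : ℝ →ᵇ ℝ} (hφ : IsWeight φ w) (hw : IsWeight w w') (t : ℝ) :
    HasDerivAt (fun t => virial k φ w (u t) (η t)) (virialRate k a c w w' (u t) (η t)) t := by
  have hu := h.continuous_u
  have hη := h.continuous_eta
  have du := h.hasDerivAt_u t
  have de := h.hasDerivAt_eta t
  have d1 := ((mulL φ).hasFDerivAt.comp_hasDerivAt t du).inner ℝ de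
  have d2 := hasDerivAt_inner_dL_dL hu hη
    (continuous_src (by fun_prop) (by fun_prop)) (continuous_src (by fun_prop) (by fun_prop))
    h.hasDerivAt_u h.hasDerivAt_eta hφ t
  have d3 := hasDerivAt_inner_vL_dL hw hu du de
  refine ((d1.add d2).add (d3.const_mul k)).congr_deriv ?_
  set U := u t
  set E := η t
  have i1 := hφ.inner_deriv_self (H1.isWeakDeriv E)
  have i2 := hφ.inner_deriv_self (H1.isWeakDeriv U)
  have i3 := hφ.integral_by_parts (H1.isWeakDeriv (gre (vL E))) (H1.isWeakDeriv E)
  have i4 := hφ.integral_by_parts (H1.isWeakDeriv (gre (vL U))) (H1.isWeakDeriv U)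
  have i5 := hφ.integral_by_parts
    (H1.isWeakDeriv (gre ((1 / 2 : ℝ) • mulL (toB U) (vL U)))) (H1.isWeakDeriv E)
  have i6 := hφ.integral_by_parts
    (H1.isWeakDeriv (gre (mulL (toB U) (vL E)))) (H1.isWeakDeriv U)
  have i7 := hφ.integral_by_parts (isWeakDeriv_mul U U) (H1.isWeakDeriv E)
  have i8 : ⟪mulL φ (mulL (toB U) (dL U)), vL E⟫_ℝ = ⟪mulL φ (dL U), mulL (toB U) (vL E)⟫_ℝ := by
    rw [inner_mulL_right, ← mulL_mul, ← mulL_mul, mul_comm]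
  simp only [virialRate, wn, Function.comp_apply, vL_src, dL_src, map_add, map_sub, map_neg,
    map_smul, inner_add_left, inner_add_right, inner_sub_left, inner_sub_right, inner_neg_left,
    inner_neg_right, inner_smul_left, inner_smul_right, conj_trivial] at *
  rw [inner_mulL_comm φ (vL U) (dL U), inner_mulL_comm φ (vL U) (dL (gre (vL U))),
    inner_mulL_comm φ (vL U) (dL (gre (mulL (toB U) (vL E)))),
    inner_mulL_comm φ (dL U) (vL (gre (vL U))),
    inner_mulL_comm φ (dL U) (vL (gre (mulL (toB U) (vL E)))),
    inner_mulL_comm φ (vL E) (dL E), inner_mulL_comm w (dL E) (dL (gre (vL E))),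
    inner_mulL_comm w (dL E) (dL (gre (mulL (toB U) (vL U))))]
  linear_combination (1 + 2 * c) * i1 + (1 + 2 * a) * i2 - (1 + c) * i3 - (1 + a) * i4 - i5 - i6
    + 1 / 2 * i7 - i8

/-- The local energy `∫ w (u² + (∂ₓu)² + η² + (∂ₓη)²)`. -/
def we (w : ℝ →ᵇ ℝ) (U E : H1) : ℝ := wn w (vL U) + wn w (dL U) + wn w (vL E) + wn w (dL E)

theorem we_nonneg {w : ℝ →ᵇ ℝ} (hw : ∀ x, 0 ≤ w x) (U E : H1) : 0 ≤ we w U E := by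
  have := wn_nonneg hw (vL U)
  have := wn_nonneg hw (dL U)
  have := wn_nonneg hw (vL E)
  have := wn_nonneg hw (dL E)
  unfold we; linarith

/-- Both conditions are strict at κ = 0 and affine in κ, so they survive for small κ. -/
theorem exists_sos_constant {β δ₀ s : ℝ} (hs : 0 ≤ s) (h1 : 0 < β + 2 * s) (h2 : s ^ 2 < δ₀) :
    ∃ κ₀ > 0, ∀ κ, 0 ≤ κ → κ ≤ κ₀ → κ ≤ 1 ∧ κ ≤ β + 2 * s * (1 - κ) ∧
      κ ≤ δ₀ - (1 - κ) * s ^ 2 := by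
  refine ⟨min 1 (min ((β + 2 * s) / (1 + 2 * s)) (δ₀ - s ^ 2)), ?_, fun κ h0 h => ?_⟩
  · refine lt_min one_pos (lt_min (by positivity) (by linarith))
  · rw [le_min_iff, le_min_iff, le_div_iff₀ (by linarith)] at h
    exact ⟨h.1, by nlinarith, by nlinarith [mul_nonneg h0 (sq_nonneg s)]⟩

/-- The choice of the multiplier that makes both quadratic forms positive. -/
theorem exists_multiplier {α γ : ℝ} (hα : 0 < α) (hγ : 0 < γ)
    (h : 2 < 8 * α * γ + 3 * (α + γ)) : ∃ m, |m| ≤ 1 ∧ ∃ s r κ : ℝ, 0 ≤ s ∧ 0 ≤ r ∧ 0 < κ ∧ κ ≤ 1 ∧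
      κ ≤ 3 * α - 1 - m + 2 * s * (1 - κ) ∧ κ ≤ α * (1 - m) - (1 - κ) * s ^ 2 ∧
      κ ≤ 3 * γ - 1 + m + 2 * r * (1 - κ) ∧ κ ≤ γ * (1 + m) - (1 - κ) * r ^ 2 := by
  suffices H : ∃ m, |m| ≤ 1 ∧ ∃ s r : ℝ, 0 ≤ s ∧ 0 ≤ r ∧ 0 < 3 * α - 1 - m + 2 * s ∧
      s ^ 2 < α * (1 - m) ∧ 0 < 3 * γ - 1 + m + 2 * r ∧ r ^ 2 < γ * (1 + m) by
    obtain ⟨m, hm, s, r, hs, hr, h1, h2, h3, h4⟩ := H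
    obtain ⟨k, hk, hk'⟩ := exists_sos_constant hs h1 h2
    obtain ⟨l, hl, hl'⟩ := exists_sos_constant hr h3 h4
    obtain ⟨a1, a2, a3⟩ := hk' (min k l) (lt_min hk hl).le (min_le_left _ _)
    obtain ⟨b1, b2, b3⟩ := hl' (min k l) (lt_min hk hl).le (min_le_right _ _)
    exact ⟨m, hm, s, r, min k l, hs, hr, lt_min hk hl, a1, a2, a3, b2, b3⟩
  -- For large α + γ both middle coefficients 3α-1-m and 3γ-1+m can be made positive, and no squares
  -- are needed (s = r = 0).
  rcases lt_or_ge 2 (3 * (α + γ)) with h3 | h3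
  · obtain ⟨m, h1, h2⟩ : ∃ m, max (-1) (1 - 3 * γ) < m ∧ m < min 1 (3 * α - 1) :=
      exists_between (max_lt (lt_min (by norm_num) (by linarith))
        (lt_min (by linarith) (by linarith)))
    rw [max_lt_iff] at h1
    rw [lt_min_iff] at h2
    exact ⟨m, abs_le.2 ⟨h1.1.le, h2.1.le⟩, 0, 0, le_rfl, le_rfl, by linarith,
      by nlinarith [mul_pos hα (sub_pos.2 h2.1)], by linarith,
      by nlinarith [mul_pos hγ (sub_pos.2 h1.1)]⟩
  -- Otherwise m = 3(α-γ)/2 makes both middle coefficients equal to -d. The hypothesis says d < 4αγ,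
  -- and d ≤ 1 gives d² ≤ d < 4αγ, more than enough for the discriminant condition d² < 4α(1-m) =
  -- 4(αd + 3αγ) and its analogue for γ.
  · set d := 1 - 3 * (α + γ) / 2 with hd
    have hd0 : 0 ≤ d := by linarith
    have hd1 : d ≤ 1 := by linarith
    have hp := mul_pos hα hγ
    have key : ∀ A : ℝ, 0 < A → d ^ 2 < 4 * A → ∃ s, 0 ≤ s ∧ 0 < 2 * s - d ∧ s ^ 2 < A := by
      intro A hA hdA
      have : d / 2 < √A := Real.lt_sqrt_of_sq_lt (by nlinarith)
      obtain ⟨s, h1, h2⟩ := exists_between this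
      exact ⟨s, by linarith, by linarith, (Real.lt_sqrt (by linarith)).1 h2⟩
    have e1 : α * (1 - 3 * (α - γ) / 2) = α * d + 3 * (α * γ) := by rw [hd]; ring
    have e2 : γ * (1 + 3 * (α - γ) / 2) = γ * d + 3 * (α * γ) := by rw [hd]; ring
    have q1 := mul_nonneg hα.le hd0
    have q2 := mul_nonneg hγ.le hd0
    obtain ⟨s, s0, s1, s2⟩ := key (α * (1 - 3 * (α - γ) / 2)) (by rw [e1]; linarith)
      (by rw [e1]; nlinarith)
    obtain ⟨r, r0, r1, r2⟩ := key (γ * (1 + 3 * (α - γ) / 2)) (by rw [e2]; linarith)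
      (by rw [e2]; nlinarith)
    refine ⟨3 * (α - γ) / 2, abs_le.2 ⟨by linarith, by linarith⟩, s, r, s0, r0, ?_, s2, ?_, r2⟩
    · rw [hd] at s1; linarith
    · rw [hd] at r1; linarith

theorem isWeakDeriv_sub {f f' g g' : L2} (h : IsWeakDeriv f f') (k : IsWeakDeriv g g') :
    IsWeakDeriv (f - g : L2) (f' - g' : L2) := by
  rw [sub_eq_add_neg, sub_eq_add_neg, ← neg_one_smul ℝ g, ← neg_one_smul ℝ g']
  exact h.add (k.smul (-1))

set_option maxHeartbeats 1000000 in
/-- Coercivity of the virial rate, for slowly varying weights and small solutions. -/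
theorem exists_virialRate_ge (ha : a < 0) (hc : c < 0) (h : 3 * (a + c) + 2 < 8 * a * c) :
    ∃ k κ δ₀ : ℝ, |k| ≤ 1 ∧ 0 < κ ∧ 0 < δ₀ ∧ ∀ (w w' : ℝ →ᵇ ℝ) (δ M : ℝ), IsWeight w w' →
      (∀ x, 0 ≤ w x) → 0 ≤ δ → δ ≤ δ₀ → (∀ x, |w' x| ≤ δ * w x) → 0 < M → M ≤ δ₀ → ∀ U E : H1,
      ‖toB U‖ ≤ M → κ * we w U E ≤ virialRate k a c w w' U E := by
  obtain ⟨m, hm, s, r, κ, hs, hr, hκ, hκ1, h1, h2, h3, h4⟩ :=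
    exists_multiplier (neg_pos.2 ha) (neg_pos.2 hc) (by linarith)
  set C₁ := 2 * -a + |2 * -a * (1 - m) - m * (1 - -a)| + 4 * s with hC₁
  set C₂ := 2 * -c + |2 * -c * (1 - -m) - -m * (1 - -c)| + 4 * r with hC₂
  set C := C₁ + C₂ + 16 + 2 * (|c| + |1 + c|) with hC
  have hC₁0 : 0 ≤ C₁ := by have := abs_nonneg (2 * -a * (1 - m) - m * (1 - -a)); linarith
  have hC₂0 : 0 ≤ C₂ := by have := abs_nonneg (2 * -c * (1 - -m) - -m * (1 - -c)); linarith
  have hC8 : 16 ≤ C := by linarith [abs_nonneg c, abs_nonneg (1 + c)]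
  -- The form estimated by `virial_form_coercive` is twice the quadratic part of the rate, giving
  -- (κ/2)(S₁+S₂). Errors take at most κ/4, and passing from S₁+S₂ to the energy T costs another
  -- factor 2. `C` gathers the error constants.
  refine ⟨m / 2, κ / 8, κ / (8 * C), ?_, by positivity, by positivity, ?_⟩
  · rw [abs_div, abs_two]; linarith
  intro w w' δ M hww hw hδ hδ₀ hw' hM hM₀ U E hU
  have hδC : C * δ ≤ κ / 8 := by
    rw [le_div_iff₀ (by positivity)] at hδ₀; linarith
  have hMC : C * M ≤ κ / 8 := by
    rw [le_div_iff₀ (by positivity)] at hM₀; linarith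
  have hδ1 : δ ≤ 1 := by nlinarith only [hδC, hC8, hδ, hκ1]
  have hM1 : M ≤ 1 := by nlinarith only [hMC, hC8, hM, hκ1]
  -- The derivatives of z = Gu are z, z', z'' = z - u and z''' = z' - uₓ, so that u = z - z'' and uₓ
  -- = z' - z'''.
  have F₁ := virial_form_coercive (neg_pos.2 ha).le hs hκ.le hκ1 h1 h2 hww hw hδ hw'
    (H1.isWeakDeriv (gre (vL U))) (isWeakDeriv_dL_gre (vL U))
    (isWeakDeriv_sub (H1.isWeakDeriv (gre (vL U))) (H1.isWeakDeriv U))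
  have F₂ := virial_form_coercive (m := -m) (neg_pos.2 hc).le hr hκ.le hκ1 (by linarith)
    (by linarith) hww hw hδ hw'
    (H1.isWeakDeriv (gre (vL E))) (isWeakDeriv_dL_gre (vL E))
    (isWeakDeriv_sub (H1.isWeakDeriv (gre (vL E))) (H1.isWeakDeriv E))
  simp only [sub_sub_cancel] at F₁ F₂
  rw [← hC₁] at F₁
  rw [← hC₂] at F₂
  have g₁ := wn_sub_le hw (vL (gre (vL U))) (vL (gre (vL U)) - vL U)
  have g₂ := wn_sub_le hw (dL (gre (vL U))) (dL (gre (vL U)) - dL U)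
  have g₃ := wn_sub_le hw (vL (gre (vL E))) (vL (gre (vL E)) - vL E)
  have g₄ := wn_sub_le hw (dL (gre (vL E))) (dL (gre (vL E)) - dL E)
  simp only [sub_sub_cancel] at g₁ g₂ g₃ g₄
  have x0 := wn_nonneg hw (vL U)
  have x1 := wn_nonneg hw (dL U)
  have e0 := wn_nonneg hw (vL E)
  have e1 := wn_nonneg hw (dL E)
  have z0 := wn_nonneg hw (vL (gre (vL U)))
  have z1 := wn_nonneg hw (dL (gre (vL U)))
  have z2 := wn_nonneg hw (vL (gre (vL U)) - vL U)
  have z3 := wn_nonneg hw (dL (gre (vL U)) - dL U)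
  have y0 := wn_nonneg hw (vL (gre (vL E)))
  have y1 := wn_nonneg hw (dL (gre (vL E)))
  have y2 := wn_nonneg hw (vL (gre (vL E)) - vL E)
  have y3 := wn_nonneg hw (dL (gre (vL E)) - dL E)
  have np := wn_gre_le hww hw hδ1 hw' ((1 / 2 : ℝ) • mulL (toB U) (vL U))
  have nq := wn_gre_le hww hw hδ1 hw' (mulL (toB U) (vL E))
  have nUx := wn_mulL_le hw hU (vL U)
  have nUe := wn_mulL_le hw hU (vL E)
  rw [wn_smul] at np
  have p0 := wn_nonneg hw (vL (gre ((1 / 2 : ℝ) • mulL (toB U) (vL U))))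
  have p1 := wn_nonneg hw (dL (gre ((1 / 2 : ℝ) • mulL (toB U) (vL U))))
  have q0 := wn_nonneg hw (vL (gre (mulL (toB U) (vL E))))
  have q1 := wn_nonneg hw (dL (gre (mulL (toB U) (vL E))))
  have hM2 : M ^ 2 ≤ 1 := by nlinarith only [hM, hM1]
  have np1 : wn w (dL (gre ((1 / 2 : ℝ) • mulL (toB U) (vL U)))) ≤ wn w (vL U) := by
    have hh := mul_le_mul_of_nonneg_right hM2 x0
    linarith only [np, nUx, hh, p0]
  have b1 := abs_inner_le_of_wn_le hw hM (f := vL (gre ((1 / 2 : ℝ) • mulL (toB U) (vL U))))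
    (T := wn w (vL U)) (by linarith only [np, nUx, p1]) (vL E)
  have b2 := abs_inner_le_of_wn_le hw hM (f := dL (gre ((1 / 2 : ℝ) • mulL (toB U) (vL U))))
    (T := wn w (vL U)) (by linarith only [np, nUx, p0]) (dL E)
  have b3 := abs_inner_le_of_wn_le hw hM (f := vL (gre (mulL (toB U) (vL E))))
    (T := 4 * wn w (vL E)) (by linarith only [nq, nUe, q1]) (vL U)
  have b4 := abs_inner_le_of_wn_le hw hM (f := dL (gre (mulL (toB U) (vL E))))
    (T := 4 * wn w (vL E)) (by linarith only [nq, nUe, q0]) (dL U)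
  have b5 := abs_inner_le_of_wn_le hw hM nUx (vL E)
  have b6 := abs_inner_mulL_le_wn hw' (vL E) (dL E)
  have b7 := abs_inner_mulL_le_wn hw' (vL E) (dL (gre (vL E)))
  have b8 := abs_inner_mulL_le_wn hw' (vL E) (dL (gre ((1 / 2 : ℝ) • mulL (toB U) (vL U))))
  rw [we, virialRate]
  set P₀ := vL (gre ((1 / 2 : ℝ) • mulL (toB U) (vL U)))
  set P₁ := dL (gre ((1 / 2 : ℝ) • mulL (toB U) (vL U)))
  set Q₀ := vL (gre (mulL (toB U) (vL E)))
  set Q₁ := dL (gre (mulL (toB U) (vL E)))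
  set X := vL U
  set X' := dL U
  set Y := vL E
  set Y' := dL E
  set S₁ := wn w (vL (gre X)) + wn w (dL (gre X)) + wn w (vL (gre X) - X)
    + wn w (dL (gre X) - X') with hS₁
  set S₂ := wn w (vL (gre Y)) + wn w (dL (gre Y)) + wn w (vL (gre Y) - Y)
    + wn w (dL (gre Y) - Y') with hS₂
  have hT : wn w X + wn w X' + wn w Y + wn w Y' ≤ 2 * (S₁ + S₂) := by
    linarith only [g₁, g₂, g₃, g₄, hS₁, hS₂]
  set T := wn w X + wn w X' + wn w Y + wn w Y' with hTd
  have hT0 : 0 ≤ T := by linarith only [hTd, x0, x1, e0, e1]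
  have S0 : 0 ≤ S₁ + S₂ := by linarith only [hT, hT0]
  have hS1 : 0 ≤ S₁ := by linarith only [hS₁, z0, z1, z2, z3]
  have hS2 : 0 ≤ S₂ := by linarith only [hS₂, y0, y1, y2, y3]
  have hTX : ∀ {A B : ℝ}, A ≤ T → B ≤ 2 * (S₁ + S₂) → A + B ≤ 4 * (S₁ + S₂) := fun h h' => by
    linarith only [h, h', hT]
  have hMT : ∀ {A B : ℝ}, 0 ≤ B → A ≤ B → M / 2 * A ≤ M / 2 * B := fun _ h =>
    mul_le_mul_of_nonneg_left h (by linarith only [hM])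
  have k1 : |⟪mulL w P₀, Y⟫_ℝ| ≤ M / 2 * T := b1.trans (hMT hT0 (by linarith only [hTd, hT0, x0, x1, e0, e1]))
  have k2 : |m / 2 * ⟪mulL w P₁, Y'⟫_ℝ| ≤ M / 2 * T := by
    rw [abs_mul, abs_div, abs_two]
    exact (mul_le_of_le_one_left (abs_nonneg _) (by linarith only [hm])).trans
      (b2.trans (hMT hT0 (by linarith only [hTd, hT0, x0, x1, e0, e1])))
  have k3 : |⟪mulL w Q₀, X⟫_ℝ| ≤ M / 2 * (4 * T) := b3.trans (hMT (by linarith only [hTd, hT0, x0, x1, e0, e1]) (by linarith only [hTd, hT0, x0, x1, e0, e1]))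
  have k4 : |m / 2 * ⟪mulL w Q₁, X'⟫_ℝ| ≤ M / 2 * (4 * T) := by
    rw [abs_mul, abs_div, abs_two]
    exact (mul_le_of_le_one_left (abs_nonneg _) (by linarith only [hm])).trans
      (b4.trans (hMT (by linarith only [hTd, hT0, x0, x1, e0, e1]) (by linarith only [hTd, hT0, x0, x1, e0, e1])))
  have k5 : |⟪mulL w (mulL (toB U) X), Y⟫_ℝ| ≤ M / 2 * T := b5.trans (hMT hT0 (by linarith only [hTd, hT0, x0, x1, e0, e1]))
  have hδT : ∀ {A : ℝ}, A ≤ 4 * (S₁ + S₂) → δ / 2 * A ≤ 2 * (δ * (S₁ + S₂)) := fun h =>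
    (mul_le_mul_of_nonneg_left h (by linarith only [hδ])).trans (le_of_eq (by ring))
  have k6 : |m / 2 * (c * ⟪mulL w' Y, Y'⟫_ℝ)| ≤ |c| * (2 * (δ * (S₁ + S₂))) := by
    rw [abs_mul, abs_div, abs_two, abs_mul]
    exact (mul_le_of_le_one_left (by positivity) (by linarith only [hm])).trans
      (mul_le_mul_of_nonneg_left (b6.trans (hδT (hTX (by linarith only [hTd, x0, x1, e1]) (by linarith only [hT, hTd, x0, x1, e0])))) (abs_nonneg _))
  have k7 : |m / 2 * ((1 + c) * ⟪mulL w' Y, dL (gre Y)⟫_ℝ)| ≤ |1 + c| * (2 * (δ * (S₁ + S₂))) := by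
    rw [abs_mul, abs_div, abs_two, abs_mul]
    exact (mul_le_of_le_one_left (by positivity) (by linarith only [hm])).trans
      (mul_le_mul_of_nonneg_left (b7.trans (hδT (hTX (by linarith only [hTd, x0, x1, e1]) (by linarith only [hS₂, y0, y2, y3, hS1, hS2])))) (abs_nonneg _))
  have k8 : |m / 2 * ⟪mulL w' Y, P₁⟫_ℝ| ≤ 2 * (δ * (S₁ + S₂)) := by
    rw [abs_mul, abs_div, abs_two]
    exact (mul_le_of_le_one_left (abs_nonneg _) (by linarith only [hm])).trans
      (b8.trans (hδT (hTX (by linarith only [hTd, x0, x1, e1]) (by linarith only [hT, hTd, np1, e0, x1, e1]))))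
  have r1 : M * T ≤ 2 * (M * (S₁ + S₂)) := by
    have := mul_le_mul_of_nonneg_left hT hM.le; linarith only [this]
  -- All cubic and slowly-varying-weight errors together, by the smallness of `M` and `δ`.
  have r2 : 16 * (M * (S₁ + S₂)) + (16 + 2 * (|c| + |1 + c|)) * (δ * (S₁ + S₂)) + C₁ * δ * S₁
      + C₂ * δ * S₂ ≤ κ / 4 * (S₁ + S₂) := by
    have t1 := mul_le_mul_of_nonneg_right hMC S0
    have t2 := mul_le_mul_of_nonneg_right hδC S0
    have t3 := mul_le_mul_of_nonneg_right hC8 (mul_nonneg hM.le S0)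
    have t4 := mul_nonneg (mul_nonneg hC₁0 hδ) hS2
    have t5 := mul_nonneg (mul_nonneg hC₂0 hδ) hS1
    have t6 : C * δ * (S₁ + S₂) = (16 + 2 * (|c| + |1 + c|)) * (δ * (S₁ + S₂)) + C₁ * δ * S₁
      + C₂ * δ * S₂ + C₁ * δ * S₂ + C₂ * δ * S₁ := by rw [hC]; ring
    linarith only [t1, t2, t3, t4, t5, t6]
  have r3 := mul_le_mul_of_nonneg_left hT (by positivity : 0 ≤ κ / 8)
  have u1 := (abs_le.1 k1).1
  have u2 := (abs_le.1 k2).1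
  have u3 := (abs_le.1 k3).1
  have u4 := (abs_le.1 k4).2
  have u5 := (abs_le.1 k5).2
  have u6 := (abs_le.1 k6).2
  have u7 := (abs_le.1 k7).1
  have u8 := (abs_le.1 k8).1
  have v1 : 0 ≤ |c| * (δ * (S₁ + S₂)) := by positivity
  have v2 : 0 ≤ |1 + c| * (δ * (S₁ + S₂)) := by positivity
  have v3 : 0 ≤ δ * (S₁ + S₂) := by positivity
  have v4 : 0 ≤ M * (S₁ + S₂) := by positivity
  have v5 : 0 ≤ C₁ * δ * S₁ := by positivity
  have v6 : 0 ≤ C₂ * δ * S₂ := by positivity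
  linarith only [F₁, F₂, r1, r2, r3, u1, u2, u3, u4, u5, u6, u7, u8, v1, v2, v3, v4, v5, v6]

end

/-! ### Hyperbolic weights, dilations and time-dependent scales. -/

section

theorem hasDerivAt_tanh (x : ℝ) : HasDerivAt Real.tanh ((1 / Real.cosh x) ^ 2) x := by
  have h := (Real.hasDerivAt_sinh x).div (Real.hasDerivAt_cosh x) (Real.cosh_pos x).ne'
  have e : Real.tanh = fun x => Real.sinh x / Real.cosh x := funext Real.tanh_eq_sinh_div_cosh
  rw [e]
  refine h.congr_deriv ?_
  rw [div_pow, one_pow]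
  congr 1
  have := Real.cosh_sq x
  nlinarith

theorem hasDerivAt_sech_sq (x : ℝ) : HasDerivAt (fun x => (1 / Real.cosh x) ^ 2)
    (-2 * (1 / Real.cosh x) ^ 2 * Real.tanh x) x := by
  have h := ((Real.hasDerivAt_cosh x).inv (Real.cosh_pos x).ne').pow 2
  have e : (fun x => (1 / Real.cosh x) ^ 2) = (Real.cosh⁻¹) ^ 2 := by
    ext x; simp
  rw [e]
  refine h.congr_deriv ?_
  rw [Real.tanh_eq_sinh_div_cosh]
  have := (Real.cosh_pos x).ne'
  simp only [Pi.inv_apply]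
  norm_num
  field_simp

theorem contDiff_tanh : ContDiff ℝ ∞ Real.tanh := by
  have e : Real.tanh = fun x => Real.sinh x / Real.cosh x := funext Real.tanh_eq_sinh_div_cosh
  rw [e]
  exact Real.contDiff_sinh.div Real.contDiff_cosh fun x => (Real.cosh_pos x).ne'

theorem contDiff_sech_sq : ContDiff ℝ ∞ fun x => (1 / Real.cosh x) ^ 2 :=
  (contDiff_const.div Real.contDiff_cosh fun x => (Real.cosh_pos x).ne').pow 2

theorem abs_tanh_le_one (x : ℝ) : |Real.tanh x| ≤ 1 :=
  abs_le.2 ⟨(Real.neg_one_lt_tanh x).le, (Real.tanh_lt_one x).le⟩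

theorem one_add_sq_le_cosh_sq (x : ℝ) : 1 + x ^ 2 ≤ Real.cosh x ^ 2 := by
  have h := Real.cosh_sq' x
  have h1 : x ^ 2 ≤ Real.sinh x ^ 2 := by
    rw [sq_le_sq]
    rcases le_total 0 x with hx | hx
    · rw [abs_of_nonneg hx, abs_of_nonneg (Real.sinh_nonneg_iff.2 hx)]
      exact Real.self_le_sinh_iff.2 hx
    · rw [abs_of_nonpos hx, abs_of_nonpos (Real.sinh_nonpos_iff.2 hx)]
      exact neg_le_neg (Real.sinh_le_self_iff.2 hx)
  linarith

theorem sech_sq_nonneg (x : ℝ) : 0 ≤ (1 / Real.cosh x) ^ 2 := sq_nonneg _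

theorem sech_sq_le_one (x : ℝ) : (1 / Real.cosh x) ^ 2 ≤ 1 := by
  have := Real.cosh_pos x
  rw [div_pow, one_pow, div_le_one (by positivity)]
  nlinarith [one_add_sq_le_cosh_sq x, sq_nonneg x]

theorem sq_mul_sech_sq_le_one (x : ℝ) : x ^ 2 * (1 / Real.cosh x) ^ 2 ≤ 1 := by
  have := Real.cosh_pos x
  rw [div_pow, one_pow, mul_one_div, div_le_one (by positivity)]
  nlinarith [one_add_sq_le_cosh_sq x]

/-- Young's inequality 2θ|x| ≤ θ² + x² combined with x² sech² x ≤ 1. The free `θ` later balances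
absorption against integrability in time. -/
theorem abs_mul_sech_sq_le (x : ℝ) {θ : ℝ} (hθ : 0 < θ) :
    |x| * (1 / Real.cosh x) ^ 2 ≤ θ * (1 / Real.cosh x) ^ 2 + 1 / θ := by
  have h1 := sq_mul_sech_sq_le_one x
  have h2 := sech_sq_nonneg x
  set S := (1 / Real.cosh x) ^ 2
  rw [← mul_le_mul_iff_right₀ hθ]
  have e : θ * (θ * S + 1 / θ) = θ ^ 2 * S + 1 := by field_simp
  rw [e]
  have h3 := mul_nonneg h2 (sq_nonneg (|x| - θ))
  have h4 := mul_nonneg h2 (sq_nonneg |x|)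
  have h5 : |x| ^ 2 = x ^ 2 := sq_abs x
  have h6 := mul_nonneg h2 (sq_nonneg θ)
  rw [← h5] at h1
  nlinarith

/-- `tanh`. -/
def thB : ℝ →ᵇ ℝ := BoundedContinuousFunction.ofNormedAddCommGroup Real.tanh
  contDiff_tanh.continuous 1 abs_tanh_le_one

/-- `sech²`. -/
def seB : ℝ →ᵇ ℝ := BoundedContinuousFunction.ofNormedAddCommGroup
  (fun x => (1 / Real.cosh x) ^ 2) contDiff_sech_sq.continuous 1 fun x => by
    rw [Real.norm_of_nonneg (sech_sq_nonneg x)]; exact sech_sq_le_one x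

theorem abs_mul_sech_sq_le_two (x : ℝ) : |x| * (1 / Real.cosh x) ^ 2 ≤ 2 := by
  have := abs_mul_sech_sq_le x one_pos
  linarith [sech_sq_le_one x]

/-- `x tanh' x`. -/
def thxB : ℝ →ᵇ ℝ := BoundedContinuousFunction.ofNormedAddCommGroup
  (fun x => x * (1 / Real.cosh x) ^ 2) (continuous_id.mul contDiff_sech_sq.continuous) 2 fun x => by
    rw [norm_mul, Real.norm_of_nonneg (sech_sq_nonneg x)]; exact abs_mul_sech_sq_le_two x

/-- `x (sech²)' x`. -/
def sexB : ℝ →ᵇ ℝ := BoundedContinuousFunction.ofNormedAddCommGroup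
  (fun x => x * (-2 * (1 / Real.cosh x) ^ 2 * Real.tanh x))
  (continuous_id.mul ((continuous_const.mul contDiff_sech_sq.continuous).mul
    contDiff_tanh.continuous)) 4 fun x => by
    rw [Real.norm_eq_abs, abs_mul, abs_mul, abs_mul, abs_neg, abs_two,
      abs_of_nonneg (sech_sq_nonneg x)]
    have h1 := abs_mul_sech_sq_le_two x
    have h2 := abs_tanh_le_one x
    have h3 : 0 ≤ |x| * (1 / Real.cosh x) ^ 2 := mul_nonneg (abs_nonneg _) (sech_sq_nonneg x)
    nlinarith [mul_le_mul h1 h2 (abs_nonneg _) (by norm_num)]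

/-- Dilation `g ↦ g (eˢ ·)`. -/
def dil (s : ℝ) (g : ℝ →ᵇ ℝ) : ℝ →ᵇ ℝ :=
  g.compContinuous ⟨fun x => Real.exp s * x, by fun_prop⟩

theorem dil_apply (s : ℝ) (g : ℝ →ᵇ ℝ) (x : ℝ) : dil s g x = g (Real.exp s * x) := rfl

theorem hasDerivAt_dil_apply {g : ℝ → ℝ} {g' : ℝ → ℝ} (hg : ∀ x, HasDerivAt g (g' x) x) (x s : ℝ) :
    HasDerivAt (fun s => g (Real.exp s * x)) (Real.exp s * x * g' (Real.exp s * x)) s := by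
  have := (hg (Real.exp s * x)).comp s ((Real.hasDerivAt_exp s).mul_const x)
  refine this.congr_deriv (by ring)

theorem continuous_dil {h : ℝ →ᵇ ℝ} {h' : ℝ → ℝ} (hd : ∀ x, HasDerivAt h (h' x) x) {C : ℝ}
    (hC : ∀ x, |x * h' x| ≤ C) : Continuous fun s => dil s h := by
  have hC0 : 0 ≤ C := (abs_nonneg _).trans (hC 0)
  refine LipschitzWith.continuous (K := ⟨C, hC0⟩) (LipschitzWith.of_dist_le_mul fun s r => ?_)
  refine (BoundedContinuousFunction.dist_le (by positivity)).2 fun x => ?_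
  have := Convex.norm_image_sub_le_of_norm_hasDerivWithin_le (s := univ) (x := r) (y := s)
    (fun p _ => (hasDerivAt_dil_apply hd x p).hasDerivWithinAt)
    (fun p _ => hC _) convex_univ (mem_univ _) (mem_univ _)
  exact this

/-- Pointwise the s-derivative of g(eˢx) is h(eˢx) with h(x) = x g'(x). Boundedness of x h'(x) makes
s ↦ `dil s h` Lipschitz in sup norm, so the pointwise primitive is a primitive in the Banach space.
-/
theorem hasDerivAt_dil {g h : ℝ →ᵇ ℝ} {g' h' : ℝ → ℝ} (hg : ∀ x, HasDerivAt g (g' x) x)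
    (hh : ∀ x, h x = x * g' x) (hd : ∀ x, HasDerivAt h (h' x) x) {C : ℝ}
    (hC : ∀ x, |x * h' x| ≤ C) (s : ℝ) : HasDerivAt (fun s => dil s g) (dil s h) s := by
  have hc := continuous_dil hd hC
  have : (fun s => dil s g) = fun s => dil 0 g + ∫ r in (0 : ℝ)..s, dil r h := by
    ext s x
    rw [BoundedContinuousFunction.add_apply]
    have e1 : (∫ r in (0 : ℝ)..s, dil r h) x = ∫ r in (0 : ℝ)..s, dil r h x :=
      ((BoundedContinuousFunction.evalCLM ℝ x).intervalIntegral_comp_comm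
        (hc.intervalIntegrable 0 s)).symm
    have e2 : ∫ r in (0 : ℝ)..s, dil r h x = dil s g x - dil 0 g x := by
      refine intervalIntegral.integral_eq_sub_of_hasDerivAt (f := fun r => dil r g x)
        (fun r _ => ?_) ?_
      · rw [dil_apply, hh]; exact hasDerivAt_dil_apply hg x r
      · exact ((BoundedContinuousFunction.evalCLM ℝ x).continuous.comp hc).intervalIntegrable _ _
    rw [e1, e2]; ring
  rw [this]
  exact (intervalIntegral.integral_hasDerivAt_right (hc.intervalIntegrable _ _)
    hc.stronglyMeasurable.stronglyMeasurableAtFilter hc.continuousAt).const_add _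

theorem hasDerivAt_dil_thB (s : ℝ) : HasDerivAt (fun s => dil s thB) (dil s thxB) s := by
  refine hasDerivAt_dil (g' := fun x => (1 / Real.cosh x) ^ 2)
    (h' := fun x => 1 * (1 / Real.cosh x) ^ 2 + x * (-2 * (1 / Real.cosh x) ^ 2 * Real.tanh x))
    (C := 4) hasDerivAt_tanh (fun x => rfl)
    (fun x => (hasDerivAt_id x).mul (hasDerivAt_sech_sq x)) (fun x => ?_) s
  have h1 := abs_mul_sech_sq_le_two x
  have h2 := abs_tanh_le_one x
  have h3 := sq_mul_sech_sq_le_one x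
  have h4 := sech_sq_nonneg x
  have e : x * (1 * (1 / Real.cosh x) ^ 2 + x * (-2 * (1 / Real.cosh x) ^ 2 * Real.tanh x))
    = x * (1 / Real.cosh x) ^ 2 - 2 * (x ^ 2 * (1 / Real.cosh x) ^ 2) * Real.tanh x := by ring
  rw [e]
  refine (abs_sub _ _).trans ?_
  rw [abs_mul, abs_mul (2 * _), abs_of_nonneg h4,
    abs_of_nonneg (by positivity : 0 ≤ 2 * (x ^ 2 * (1 / Real.cosh x) ^ 2))]
  have := mul_le_mul h3 h2 (abs_nonneg _) zero_le_one
  linarith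

theorem hasDerivAt_dil_seB (s : ℝ) : HasDerivAt (fun s => dil s seB) (dil s sexB) s := by
  refine hasDerivAt_dil (g' := fun x => -2 * (1 / Real.cosh x) ^ 2 * Real.tanh x)
    (h' := fun x => 1 * (-2 * (1 / Real.cosh x) ^ 2 * Real.tanh x)
      + x * (-2 * (-2 * (1 / Real.cosh x) ^ 2 * Real.tanh x) * Real.tanh x
        + -2 * (1 / Real.cosh x) ^ 2 * (1 / Real.cosh x) ^ 2))
    (C := 10) hasDerivAt_sech_sq (fun x => rfl)
    (fun x => (hasDerivAt_id x).mul (((hasDerivAt_sech_sq x).const_mul (-2)).mul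
      (hasDerivAt_tanh x))) (fun x => ?_) s
  have h1 := abs_mul_sech_sq_le_two x
  have h2 := abs_tanh_le_one x
  have h3 := sq_mul_sech_sq_le_one x
  have h4 := sech_sq_nonneg x
  have h5 := sech_sq_le_one x
  have h6 : Real.tanh x ^ 2 ≤ 1 := by rw [← sq_abs]; nlinarith [abs_nonneg (Real.tanh x)]
  set S := (1 / Real.cosh x) ^ 2
  set T := Real.tanh x
  have e : x * (1 * (-2 * S * T) + x * (-2 * (-2 * S * T) * T + -2 * S * S))
    = -2 * (x * S * T) + (4 * (x ^ 2 * S * T ^ 2) - 2 * (x ^ 2 * S * S)) := by ring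
  rw [e]
  have hx2 : 0 ≤ x ^ 2 * S := by positivity
  have k1 : |x * S * T| ≤ 2 := by
    rw [abs_mul, abs_mul, abs_of_nonneg h4]
    have := mul_le_mul h1 h2 (abs_nonneg _) (by norm_num)
    linarith
  have k2 : x ^ 2 * S * T ^ 2 ≤ 1 := by nlinarith [sq_nonneg T]
  have k2' : 0 ≤ x ^ 2 * S * T ^ 2 := by positivity
  have k3 : x ^ 2 * S * S ≤ 1 := by nlinarith
  have k3' : 0 ≤ x ^ 2 * S * S := by positivity
  have k1' := abs_le.1 k1
  exact abs_le.2 ⟨by linarith, by linarith⟩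

theorem norm_dil_le (s : ℝ) (g : ℝ →ᵇ ℝ) : ‖dil s g‖ ≤ ‖g‖ :=
  (BoundedContinuousFunction.norm_le (norm_nonneg _)).2 fun _ => g.norm_coe_le_norm _

theorem norm_thB_le : ‖thB‖ ≤ 1 :=
  BoundedContinuousFunction.norm_ofNormedAddCommGroup_le _ zero_le_one abs_tanh_le_one

theorem norm_seB_le : ‖seB‖ ≤ 1 :=
  BoundedContinuousFunction.norm_ofNormedAddCommGroup_le _ zero_le_one fun x => by
    rw [Real.norm_of_nonneg (sech_sq_nonneg x)]; exact sech_sq_le_one x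

theorem isWeight_dil_thB (s : ℝ) : IsWeight (dil s thB) (Real.exp s • dil s seB) where
  smooth := contDiff_tanh.comp (contDiff_const.mul contDiff_id)
  deriv_eq x := by
    have := (hasDerivAt_tanh (Real.exp s * x)).comp x ((hasDerivAt_id x).const_mul (Real.exp s))
    refine this.congr_deriv ?_
    change _ = Real.exp s * (1 / Real.cosh (Real.exp s * x)) ^ 2
    ring

theorem isWeight_dil_seB (s : ℝ) : IsWeight (Real.exp s • dil s seB)
    ((-2 * Real.exp s ^ 2) • (dil s seB * dil s thB)) where
  smooth := contDiff_const.smul (contDiff_sech_sq.comp (contDiff_const.mul contDiff_id))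
  deriv_eq x := by
    have := ((hasDerivAt_sech_sq (Real.exp s * x)).comp x
      ((hasDerivAt_id x).const_mul (Real.exp s))).const_mul (Real.exp s)
    refine this.congr_deriv ?_
    change _ = (-2 * Real.exp s ^ 2) * ((1 / Real.cosh (Real.exp s * x)) ^ 2 * Real.tanh (Real.exp s * x))
    ring

theorem abs_deriv_weight_le (s x : ℝ) :
    |((-2 * Real.exp s ^ 2) • (dil s seB * dil s thB)) x|
      ≤ 2 * Real.exp s * (Real.exp s • dil s seB) x := by
  change |(-2 * Real.exp s ^ 2) * (dil s seB x * dil s thB x)|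
    ≤ 2 * Real.exp s * (Real.exp s * dil s seB x)
  have h1 : 0 ≤ dil s seB x := sech_sq_nonneg _
  have h2 : |dil s thB x| ≤ 1 := abs_tanh_le_one _
  rw [abs_mul, abs_mul, abs_mul, abs_neg, abs_two, abs_of_nonneg h1,
    abs_of_nonneg (by positivity : (0 : ℝ) ≤ Real.exp s ^ 2)]
  have := mul_le_mul_of_nonneg_left h2 (by positivity : 0 ≤ 2 * Real.exp s ^ 2 * dil s seB x)
  linarith

theorem localEnergy_eq (s : ℝ) (U E : H1) :
    localEnergy (Real.exp s)⁻¹ U E = we (dil s seB) U E := by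
  have hi := integrable_weight (dil s seB)
  have h2 : Integrable fun x => dil s seB x * (vL U x * vL U x) + dil s seB x * (dL U x * dL U x) :=
    (hi _ _).add (hi _ _)
  have h3 : Integrable fun x => dil s seB x * (vL U x * vL U x) + dil s seB x * (dL U x * dL U x)
    + dil s seB x * (vL E x * vL E x) := h2.add (hi _ _)
  rw [we, wn, wn, wn, wn, inner_mulL, inner_mulL, inner_mulL, inner_mulL,
    ← integral_add (hi _ _) (hi _ _), ← integral_add h2 (hi _ _), ← integral_add h3 (hi _ _)]
  refine integral_congr_ae (Eventually.of_forall fun x => ?_)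
  have e : dil s seB x = (1 / Real.cosh (x / (Real.exp s)⁻¹)) ^ 2 := by
    rw [dil_apply, div_inv_eq_mul, mul_comm]; rfl
  simp only [e]
  change _ * (vL U x ^ 2 + dL U x ^ 2 + vL E x ^ 2 + dL E x ^ 2) = _
  ring

/-- The virial functional as a linear form in the weights. -/
def virialL (k : ℝ) (U E : H1) : (ℝ →ᵇ ℝ) × (ℝ →ᵇ ℝ) →L[ℝ] ℝ :=
  ((innerSL ℝ (vL E)).comp (mulL.flip (vL U)) + (innerSL ℝ (dL E)).comp (mulL.flip (dL U))).comp
      (ContinuousLinearMap.fst ℝ _ _)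
    + (k • (innerSL ℝ (dL U)).comp (mulL.flip (vL E))).comp (ContinuousLinearMap.snd ℝ _ _)

theorem virialL_apply (k : ℝ) (U E : H1) (φ w : ℝ →ᵇ ℝ) :
    virialL k U E (φ, w) = virial k φ w U E := by
  change ⟪vL E, mulL φ (vL U)⟫_ℝ + ⟪dL E, mulL φ (dL U)⟫_ℝ + k * ⟪dL U, mulL w (vL E)⟫_ℝ = _
  rw [virial, real_inner_comm, real_inner_comm (dL E), real_inner_comm (dL U)]

theorem continuous_virialL (k : ℝ) {u η : ℝ → H1} (hu : Continuous u) (hη : Continuous η) :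
    Continuous fun t => virialL k (u t) (η t) := by
  unfold virialL
  have h1 : Continuous fun t => vL (u t) := by fun_prop
  have h2 : Continuous fun t => dL (u t) := by fun_prop
  have h3 : Continuous fun t => vL (η t) := by fun_prop
  have h4 : Continuous fun t => dL (η t) := by fun_prop
  have c1 := fun (f g : ℝ → L2) (hf : Continuous f) (hg : Continuous g) =>
    ((innerSL ℝ).continuous.comp hf).clm_comp ((mulL.flip).continuous.comp hg)
  exact (((c1 _ _ h3 h1).add (c1 _ _ h4 h2)).clm_comp continuous_const).add
    (((c1 _ _ h2 h3).const_smul k).clm_comp continuous_const)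

/-- Product rule when `V` is only norm-continuous but differentiable on the frozen vector `Φ t`. It
combines the fixed-weight virial identity with the motion of the weights. -/
theorem hasDerivAt_clm_apply_of_weak {X : Type*} [NormedAddCommGroup X] [NormedSpace ℝ X]
    {V : ℝ → X →L[ℝ] ℝ} {Φ : ℝ → X} {Φ' : X} {D t : ℝ} (hV : ContinuousAt V t)
    (hΦ : HasDerivAt Φ Φ' t) (hD : HasDerivAt (fun r => V r (Φ t)) D t) :
    HasDerivAt (fun r => V r (Φ r)) (V t Φ' + D) t := by
  rw [hasDerivAt_iff_tendsto_slope] at *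
  have h1 : Tendsto (fun r => V r (slope Φ t r) + slope (fun r => V r (Φ t)) t r) (𝓝[≠] t)
      (𝓝 (V t Φ' + D)) :=
    (((ContinuousLinearMap.id ℝ (X →L[ℝ] ℝ)).continuous₂.tendsto (V t, Φ')).comp
      ((hV.tendsto.mono_left nhdsWithin_le_nhds).prodMk_nhds hΦ)).add hD
  refine h1.congr fun r => ?_
  simp only [slope_def_module, map_smul, map_sub]
  rw [← smul_add]
  congr 1
  abel

variable {a c : ℝ} {u η : ℝ → H1}

/-- Virial identity with a scale depending on time. -/
theorem IsGlobalSolution.hasDerivAt_virial_dil (h : IsGlobalSolution a c u η) (k : ℝ) {s : ℝ → ℝ}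
    {s' t : ℝ} (hs : HasDerivAt s s' t) :
    HasDerivAt (fun t => virial k (dil (s t) thB) (Real.exp (s t) • dil (s t) seB) (u t) (η t))
      (s' * virial k (dil (s t) thxB) (Real.exp (s t) • (dil (s t) seB + dil (s t) sexB))
          (u t) (η t)
        + virialRate k a c (Real.exp (s t) • dil (s t) seB)
          ((-2 * Real.exp (s t) ^ 2) • (dil (s t) seB * dil (s t) thB)) (u t) (η t)) t := by
  have h1 := (continuous_virialL k h.continuous_u h.continuous_eta).continuousAt (x := t)
  have d1 : HasDerivAt (fun t => dil (s t) thB) (s' • dil (s t) thxB) t :=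
    (hasDerivAt_dil_thB (s t)).scomp t hs
  have d2 : HasDerivAt (fun t => dil (s t) seB) (s' • dil (s t) sexB) t :=
    (hasDerivAt_dil_seB (s t)).scomp t hs
  have d3 := hs.exp.smul d2
  have h2 := hasDerivAt_clm_apply_of_weak h1 (d1.prodMk d3) (D := virialRate k a c
    (Real.exp (s t) • dil (s t) seB)
    ((-2 * Real.exp (s t) ^ 2) • (dil (s t) seB * dil (s t) thB)) (u t) (η t)) (by
      have := h.hasDerivAt_virial k (isWeight_dil_thB (s t)) (isWeight_dil_seB (s t)) t
      refine this.congr_of_eventuallyEq (Eventually.of_forall fun r => ?_)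
      exact virialL_apply _ _ _ _ _)
  have e1 : ((s' • dil (s t) thxB,
      Real.exp (s t) • s' • dil (s t) sexB + (Real.exp (s t) * s') • dil (s t) seB)
        : (ℝ →ᵇ ℝ) × (ℝ →ᵇ ℝ))
      = s' • (dil (s t) thxB, Real.exp (s t) • (dil (s t) seB + dil (s t) sexB)) := by
    rw [Prod.smul_mk]
    congr 1
    module
  rw [e1, map_smul, virialL_apply, smul_eq_mul] at h2
  refine h2.congr_of_eventuallyEq (Eventually.of_forall fun r => ?_)
  exact (virialL_apply _ _ _ _ _).symm

end

/-! ### From differential inequalities to integrability and sequences of times. -/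

/-- A nonnegative function dominated by the derivative of a bounded function is integrable. -/
theorem integrable_of_le_deriv {g K K' : ℝ → ℝ} {T B : ℝ} (hg0 : ∀ t, T ≤ t → 0 ≤ g t)
    (hg : ContinuousOn g (Ici T)) (hK : ∀ t, T ≤ t → HasDerivAt K (K' t) t)
    (hgK : ∀ t, T ≤ t → g t ≤ K' t) (hB : ∀ t, T ≤ t → |K t| ≤ B) :
    IntegrableOn g (Ioi T) ∧ ∫ t in Ioi T, g t ≤ 2 * B := by
  have hci : ∀ r, IntegrableOn g (Icc T r) := fun r =>
    (hg.mono Icc_subset_Ici_self).integrableOn_Icc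
  have hle : ∀ r, T ≤ r → ∫ t in T..r, g t ≤ 2 * B := by
    intro r hr
    have h1 := intervalIntegral.integral_le_sub_of_hasDeriv_right_of_le hr
      (fun t ht => (hK t ht.1).continuousAt.continuousWithinAt)
      (fun t ht => (hK t ht.1.le).hasDerivWithinAt) (hci r) (fun t ht => hgK t ht.1.le)
    have h2 := (abs_le.1 (hB r hr)).2
    have h3 := (abs_le.1 (hB T le_rfl)).1
    linarith
  have hint : IntegrableOn g (Ioi T) := by
    refine integrableOn_Ioi_of_intervalIntegral_norm_bounded (l := atTop) (b := fun r : ℝ => r)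
      (2 * B) T (fun r => (hci r).mono_set Ioc_subset_Icc_self) tendsto_id ?_
    filter_upwards [eventually_ge_atTop T] with r hr
    refine le_trans (le_of_eq ?_) (hle r hr)
    refine intervalIntegral.integral_congr fun t ht => ?_
    rw [uIcc_of_le hr] at ht
    exact Real.norm_of_nonneg (hg0 t ht.1)
  refine ⟨hint, ?_⟩
  refine le_of_tendsto (intervalIntegral_tendsto_integral_Ioi T hint tendsto_id) ?_
  filter_upwards [eventually_ge_atTop T] with r hr using hle r hr

/-- For the growing scale, the inequality is only available once the scale is large; a crude bound
covers the initial interval. -/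
theorem integrable_of_le_deriv_of_le {g K K' : ℝ → ℝ} {T₁ T B A : ℝ} (hT : T₁ ≤ T)
    (hg0 : ∀ t, T₁ ≤ t → 0 ≤ g t) (hg : ContinuousOn g (Ici T₁))
    (hA : ∀ t, T₁ ≤ t → t ≤ T → g t ≤ A) (hK : ∀ t, T ≤ t → HasDerivAt K (K' t) t)
    (hgK : ∀ t, T ≤ t → g t ≤ K' t) (hB : ∀ t, T ≤ t → |K t| ≤ B) :
    IntegrableOn g (Ioi T₁) ∧ ∫ t in Ioi T₁, g t ≤ A * (T - T₁) + 2 * B := by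
  obtain ⟨h1, h2⟩ := integrable_of_le_deriv (fun t ht => hg0 t (hT.trans ht))
    (hg.mono (Ici_subset_Ici.2 hT)) hK hgK hB
  have hc : IntegrableOn g (Ioc T₁ T) :=
    (hg.mono Icc_subset_Ici_self).integrableOn_Icc.mono_set Ioc_subset_Icc_self
  have hu : Ioc T₁ T ∪ Ioi T = Ioi T₁ := Ioc_union_Ioi_eq_Ioi hT
  refine ⟨hu ▸ hc.union h1, ?_⟩
  rw [← hu, setIntegral_union (Ioc_disjoint_Ioi le_rfl) measurableSet_Ioi hc h1]
  refine add_le_add ?_ h2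
  have : ∫ t in Ioc T₁ T, g t ≤ ∫ _ in Ioc T₁ T, A :=
    setIntegral_mono_on hc (by simp) measurableSet_Ioc fun t ht => hA t ht.1.le ht.2
  refine this.trans (le_of_eq ?_)
  rw [setIntegral_const, smul_eq_mul, measureReal_def, Real.volume_Ioc,
    ENNReal.toReal_ofReal (by linarith), mul_comm]

/-- A nonnegative function whose integral against a non-integrable density of order at least `1/t`
converges tends to zero along a sequence of times. -/
theorem exists_seq_tendsto_zero {f g : ℝ → ℝ} {T k : ℝ} (hk : 0 < k) (hT : 0 < T)
    (hf : ∀ t, T ≤ t → 0 ≤ f t) (hfg : ∀ t, T ≤ t → k * t⁻¹ * f t ≤ g t)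
    (hg : IntegrableOn g (Ioi T)) :
    ∃ τ : ℕ → ℝ, StrictMono τ ∧ (∀ n, T ≤ τ n) ∧ Tendsto τ atTop atTop ∧
      Tendsto (fun n => f (τ n)) atTop (𝓝 0) := by
  have key : ∀ R δ : ℝ, 0 < δ → ∃ t, R ≤ t ∧ T ≤ t ∧ f t < δ := by
    intro R δ hδ
    by_contra! hcon
    -- If f ≥ δ on a half-line, then g ≥ kδ/t there, contradicting the non-integrability of 1/t.
    refine not_integrableOn_Ioi_inv (a := max R T) ?_
    have hg' : IntegrableOn (fun t => (k * δ)⁻¹ * g t) (Ioi (max R T)) :=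
      (hg.mono_set (Ioi_subset_Ioi (le_max_right _ _))).const_mul _
    refine hg'.mono' (measurable_inv.aestronglyMeasurable) ?_
    refine (ae_restrict_iff' measurableSet_Ioi).2 (Eventually.of_forall fun t ht => ?_)
    have ht' := max_lt_iff.1 (mem_Ioi.1 ht)
    have t0 : 0 < t := hT.trans ht'.2
    rw [Real.norm_of_nonneg (inv_nonneg.2 t0.le), le_inv_mul_iff₀ (by positivity)]
    refine le_trans ?_ (hfg t ht'.2.le)
    have := mul_le_mul_of_nonneg_left (hcon t ht'.1.le ht'.2.le)
      (by positivity : 0 ≤ k * t⁻¹)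
    linarith
  choose F hF1 hF2 hF3 using fun (R : ℝ) (n : ℕ) => key R (1 / ((n : ℝ) + 1)) (by positivity)
  let τ : ℕ → ℝ := fun n => Nat.rec (F 0 0) (fun m r => F (r + 1) (m + 1)) n
  have hs : ∀ n, τ (n + 1) = F (τ n + 1) (n + 1) := fun n => rfl
  have hstep : ∀ n, τ n + 1 ≤ τ (n + 1) := fun n => by rw [hs]; exact hF1 _ _
  have hlt : ∀ n, f (τ n) < 1 / ((n : ℝ) + 1) := by
    intro n
    cases n with
    | zero => exact_mod_cast hF3 0 0
    | succ n => rw [hs]; exact hF3 _ _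
  have hge : ∀ n, T ≤ τ n := by
    intro n
    cases n with
    | zero => exact hF2 0 0
    | succ n => rw [hs]; exact hF2 _ _
  have hn : ∀ n : ℕ, (n : ℝ) ≤ τ n := by
    intro n
    induction n with
    | zero => exact_mod_cast hT.le.trans (hge 0)
    | succ n ih => push_cast; linarith [hstep n]
  refine ⟨τ, strictMono_nat_of_lt_succ fun n => by linarith [hstep n], hge,
    tendsto_atTop_mono hn tendsto_natCast_atTop_atTop, ?_⟩
  exact squeeze_zero (fun n => hf _ (hge n)) (fun n => (hlt n).le)
    tendsto_one_div_add_atTop_nhds_zero_nat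

/-! ### Size of the local energy and of the virial functional. -/

theorem seB_dil_nonneg (s x : ℝ) : 0 ≤ dil s seB x := sech_sq_nonneg _

theorem wn_le_norm_sq {w : ℝ →ᵇ ℝ} (hw : ‖w‖ ≤ 1) (f : L2) : wn w f ≤ ‖f‖ ^ 2 := by
  refine (le_abs_self _).trans ((abs_inner_mulL_le w f f).trans ?_)
  rw [← sq]
  exact mul_le_of_le_one_left (sq_nonneg _) hw

theorem pairNorm_sq (U E : H1) :
    pairNorm U E ^ 2 = ‖vL U‖ ^ 2 + ‖dL U‖ ^ 2 + (‖vL E‖ ^ 2 + ‖dL E‖ ^ 2) := by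
  rw [← H1.norm_sq, ← H1.norm_sq]
  exact Real.sq_sqrt (by positivity)

theorem we_le (s : ℝ) (U E : H1) : we (dil s seB) U E ≤ pairNorm U E ^ 2 := by
  have h : ‖dil s seB‖ ≤ 1 := (norm_dil_le _ _).trans norm_seB_le
  rw [pairNorm_sq, we]
  linarith [wn_le_norm_sq h (vL U), wn_le_norm_sq h (dL U), wn_le_norm_sq h (vL E),
    wn_le_norm_sq h (dL E)]

theorem wn_const_smul (r : ℝ) (w : ℝ →ᵇ ℝ) (f : L2) : wn (r • w) f = r * wn w f := by
  simp only [wn, map_smul, _root_.smul_apply, inner_smul_left, conj_trivial]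

theorem we_smul (r : ℝ) (w : ℝ →ᵇ ℝ) (U E : H1) : we (r • w) U E = r * we w U E := by
  simp only [we, wn_const_smul]; ring

theorem abs_virial_le {k : ℝ} (hk : |k| ≤ 1) {φ w : ℝ →ᵇ ℝ} (hφ : ‖φ‖ ≤ 1) (hw : ‖w‖ ≤ 1)
    (U E : H1) : |virial k φ w U E| ≤ pairNorm U E ^ 2 := by
  have h1 := abs_inner_mulL_le φ (vL U) (vL E)
  have h2 := abs_inner_mulL_le φ (dL U) (dL E)
  have h3 := abs_inner_mulL_le w (vL E) (dL U)
  have n1 := norm_nonneg (vL U)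
  have n2 := norm_nonneg (dL U)
  have n3 := norm_nonneg (vL E)
  have n4 := norm_nonneg (dL E)
  have h1' := h1.trans (mul_le_of_le_one_left (by positivity) hφ)
  have h2' := h2.trans (mul_le_of_le_one_left (by positivity) hφ)
  have h3' := h3.trans (mul_le_of_le_one_left (by positivity) hw)
  have h4 : |k * ⟪mulL w (vL E), dL U⟫_ℝ| ≤ ‖vL E‖ * ‖dL U‖ := by
    rw [abs_mul]
    exact (mul_le_of_le_one_left (abs_nonneg _) hk).trans h3'
  rw [pairNorm_sq, virial]
  refine (abs_add_le _ _).trans ((add_le_add ((abs_add_le _ _).trans (add_le_add h1' h2'))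
    h4).trans ?_)
  nlinarith [sq_nonneg (‖vL U‖ - ‖vL E‖), sq_nonneg (‖dL U‖ - ‖dL E‖), sq_nonneg (‖vL E‖ - ‖dL U‖),
    sq_nonneg (‖vL U‖ - ‖vL E‖ + ‖dL U‖), sq_nonneg (‖vL U‖ - ‖vL E‖ + ‖dL U‖ - ‖dL E‖)]

/-! ### Moving weights and the growing scale. -/

section

theorem wn_add_const (A B : ℝ) (w : ℝ →ᵇ ℝ) (f : L2) :
    wn (A • w + BoundedContinuousFunction.const ℝ B) f = A * wn w f + B * ‖f‖ ^ 2 := by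
  have h : mulL (BoundedContinuousFunction.const ℝ B) f = B • f := by
    apply Lp.ext
    filter_upwards [coeFn_mulL (BoundedContinuousFunction.const ℝ B) f, Lp.coeFn_smul B f]
      with x h1 h2
    rw [h1, h2]; rfl
  rw [wn, map_add, _root_.add_apply, inner_add_left, h, inner_smul_left,
    real_inner_self_eq_norm_sq, ← wn_const_smul]
  rfl

/-- The constant part of the majorant is paid by the global norm, which the energy controls; only
the `w` part is local. -/
theorem abs_inner_mulL_le_of_le {v w : ℝ →ᵇ ℝ} {A B : ℝ} (h : ∀ x, |v x| ≤ A * w x + B)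
    (f g : L2) : |⟪mulL v f, g⟫_ℝ|
      ≤ 1 / 2 * (A * (wn w f + wn w g) + B * (‖f‖ ^ 2 + ‖g‖ ^ 2)) := by
  have := abs_inner_mulL_le_wn (v := v) (w := A • w + BoundedContinuousFunction.const ℝ B) (δ := 1)
    (fun x => by rw [one_mul]; exact h x) f g
  rw [wn_add_const, wn_add_const] at this
  linarith

/-- The contribution of the motion of the weights is of lower order. -/
theorem abs_virial_moving_le {k s θ : ℝ} (hk : |k| ≤ 1) (hs : Real.exp s ≤ 1) (hθ : 0 < θ)
    (U E : H1) :
    |virial k (dil s thxB) (Real.exp s • (dil s seB + dil s sexB)) U E|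
      ≤ (3 * θ + Real.exp s) / 2 * we (dil s seB) U E + 3 / (2 * θ) * pairNorm U E ^ 2 := by
  have hv : ∀ x, |dil s thxB x| ≤ θ * dil s seB x + 1 / θ := fun x => by
    change |Real.exp s * x * (1 / Real.cosh (Real.exp s * x)) ^ 2| ≤ _
    rw [abs_mul _ ((1 / Real.cosh (Real.exp s * x)) ^ 2), abs_of_nonneg (sech_sq_nonneg _)]
    exact abs_mul_sech_sq_le _ hθ
  have hv' : ∀ x, |(dil s seB + dil s sexB) x| ≤ (1 + 2 * θ) * dil s seB x + 2 * (1 / θ) :=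
    fun x => by
    have h0 := seB_dil_nonneg s x
    have h1 : |dil s sexB x| ≤ 2 * |dil s thxB x| := by
      change |Real.exp s * x * (-2 * (1 / Real.cosh (Real.exp s * x)) ^ 2
        * Real.tanh (Real.exp s * x))| ≤ 2 * |Real.exp s * x * _|
      have e : Real.exp s * x * (-2 * (1 / Real.cosh (Real.exp s * x)) ^ 2
        * Real.tanh (Real.exp s * x)) = -2 * (Real.exp s * x
          * (1 / Real.cosh (Real.exp s * x)) ^ 2) * Real.tanh (Real.exp s * x) := by ring
      rw [e, abs_mul, abs_mul (-2), abs_neg, abs_two]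
      exact mul_le_of_le_one_right (by positivity) (abs_tanh_le_one _)
    rw [BoundedContinuousFunction.add_apply]
    refine (abs_add_le _ _).trans ?_
    rw [abs_of_nonneg h0]
    linarith [hv x]
  have b1 := abs_inner_mulL_le_of_le hv (vL U) (vL E)
  have b2 := abs_inner_mulL_le_of_le hv (dL U) (dL E)
  have b3 := abs_inner_mulL_le_of_le hv' (vL E) (dL U)
  have x0 := wn_nonneg (seB_dil_nonneg s) (vL U)
  have x1 := wn_nonneg (seB_dil_nonneg s) (dL U)
  have e0 := wn_nonneg (seB_dil_nonneg s) (vL E)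
  have e1 := wn_nonneg (seB_dil_nonneg s) (dL E)
  have hp := Real.exp_pos s
  have hθ' : 0 < 1 / θ := by positivity
  have b4 : |k * ⟪mulL (Real.exp s • (dil s seB + dil s sexB)) (vL E), dL U⟫_ℝ|
      ≤ 1 / 2 * ((Real.exp s + 2 * θ) * we (dil s seB) U E + 2 * (1 / θ) * pairNorm U E ^ 2) := by
    rw [map_smul, _root_.smul_apply, inner_smul_left, conj_trivial, abs_mul, abs_mul,
      abs_of_pos hp]
    have hT : wn (dil s seB) (vL E) + wn (dil s seB) (dL U) ≤ we (dil s seB) U E := by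
      rw [we]; linarith
    have hN : ‖vL E‖ ^ 2 + ‖dL U‖ ^ 2 ≤ pairNorm U E ^ 2 := by
      rw [pairNorm_sq]; nlinarith [sq_nonneg ‖vL U‖, sq_nonneg ‖dL E‖]
    have hT0 : 0 ≤ we (dil s seB) U E := we_nonneg (seB_dil_nonneg s) U E
    refine (mul_le_of_le_one_left (by positivity) hk).trans ?_
    refine (mul_le_mul_of_nonneg_left b3 hp.le).trans ?_
    have t1 := mul_le_mul_of_nonneg_left hT (by positivity : 0 ≤ 1 + 2 * θ)
    have t2 := mul_le_mul_of_nonneg_left hN (by positivity : 0 ≤ 2 * (1 / θ))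
    have t3 := mul_le_mul_of_nonneg_left (add_le_add t1 t2) hp.le
    have t4 := mul_le_mul_of_nonneg_right hs (by positivity : 0 ≤ 2 * θ * we (dil s seB) U E)
    have t5 := mul_le_mul_of_nonneg_right hs
      (by positivity : 0 ≤ 2 * (1 / θ) * pairNorm U E ^ 2)
    linarith
  have e : 3 / (2 * θ) = 3 / 2 * (1 / θ) := by field_simp
  rw [virial, e]
  refine (abs_add_le _ _).trans ((add_le_add ((abs_add_le _ _).trans (add_le_add b1 b2))
    b4).trans ?_)
  rw [we, pairNorm_sq]
  linarith

/-- The logarithm of the inverse of the growing scale. -/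
def logScale (C₀ t : ℝ) : ℝ := 2 * Real.log (Real.log t) - Real.log C₀ - Real.log t

theorem exp_logScale {C₀ t : ℝ} (hC : 0 < C₀) (ht : 1 < t) :
    Real.exp (logScale C₀ t) = Real.log t ^ 2 / (C₀ * t) := by
  have hl := Real.log_pos ht
  have e : (2 : ℝ) * Real.log (Real.log t) = Real.log (Real.log t ^ 2) := by
    rw [Real.log_pow]; norm_num
  rw [logScale, e, Real.exp_sub, Real.exp_sub, Real.exp_log (by positivity), Real.exp_log hC,
    Real.exp_log (by linarith), div_div]

theorem growingScale_eq {C₀ t : ℝ} (hC : 0 < C₀) (ht : 1 < t) :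
    growingScale C₀ t = (Real.exp (logScale C₀ t))⁻¹ := by
  rw [exp_logScale hC ht, inv_div, growingScale]

theorem hasDerivAt_logScale (C₀ : ℝ) {t : ℝ} (ht : 1 < t) :
    HasDerivAt (logScale C₀) (2 * (t⁻¹ / Real.log t) - t⁻¹) t := by
  have h1 := Real.hasDerivAt_log (x := t) (by linarith)
  exact (((h1.log (Real.log_pos ht).ne').const_mul 2).sub_const _).sub h1

theorem abs_deriv_logScale_le {t : ℝ} (ht : Real.exp 1 ≤ t) :
    |2 * (t⁻¹ / Real.log t) - t⁻¹| ≤ t⁻¹ := by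
  have h0 : 0 < t := (Real.exp_pos 1).trans_le ht
  have h1 : 1 ≤ Real.log t := (Real.le_log_iff_exp_le h0).2 ht
  have h2 : t⁻¹ / Real.log t ≤ t⁻¹ := div_le_self (by positivity) h1
  have h3 : 0 ≤ t⁻¹ / Real.log t := by positivity
  exact abs_le.2 ⟨by linarith, by linarith⟩

theorem tendsto_exp_logScale {C₀ : ℝ} (hC : 0 < C₀) :
    Tendsto (fun t => Real.exp (logScale C₀ t)) atTop (𝓝 0) := by
  have h := (Real.isLittleO_pow_log_id_atTop (n := 2)).tendsto_div_nhds_zero.mul_const C₀⁻¹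
  rw [zero_mul] at h
  refine h.congr' ?_
  filter_upwards [eventually_gt_atTop 1] with t ht
  rw [exp_logScale hC ht, id, ← div_eq_mul_inv, div_div, mul_comm t]

theorem continuous_we {X : Type*} [TopologicalSpace X] {w : X → ℝ →ᵇ ℝ} {u η : X → H1} {S : Set X}
    (hw : ContinuousOn w S) (hu : Continuous u) (hη : Continuous η) :
    ContinuousOn (fun t => we (w t) (u t) (η t)) S := by
  have c1 : ∀ f : X → L2, Continuous f → ContinuousOn (fun t => wn (w t) (f t)) S := fun f hf =>
    ContinuousOn.inner (𝕜 := ℝ)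
      ((mulL.continuous.comp_continuousOn hw).clm_apply hf.continuousOn) hf.continuousOn
  exact (((c1 _ (vL.continuous.comp hu)).add (c1 _ (dL.continuous.comp hu))).add
    (c1 _ (vL.continuous.comp hη))).add (c1 _ (dL.continuous.comp hη))

theorem norm_weight_le {s : ℝ} (hs : Real.exp s ≤ 1) : ‖Real.exp s • dil s seB‖ ≤ 1 := by
  rw [norm_smul, Real.norm_of_nonneg (Real.exp_pos s).le]
  exact mul_le_one₀ hs (norm_nonneg _) ((norm_dil_le _ _).trans norm_seB_le)

variable {a c : ℝ} {u η : ℝ → H1}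

/-- Integrated decay at a fixed scale. -/
theorem IsGlobalSolution.integral_localEnergy_le (h : IsGlobalSolution a c u η) {k κ s N : ℝ}
    (hk : |k| ≤ 1) (hκ : 0 < κ) (hs : Real.exp s ≤ 1) (hN : ∀ t, pairNorm (u t) (η t) ≤ N)
    (hrate : ∀ t, κ * (Real.exp s * we (dil s seB) (u t) (η t)) ≤ virialRate k a c
      (Real.exp s • dil s seB) ((-2 * Real.exp s ^ 2) • (dil s seB * dil s thB)) (u t) (η t)) :
    IntegrableOn (fun t => we (dil s seB) (u t) (η t)) (Ioi 2) ∧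
      ∫ t in Ioi (2 : ℝ), we (dil s seB) (u t) (η t) ≤ 2 / κ * (Real.exp s)⁻¹ * N ^ 2 := by
  have hp := Real.exp_pos s
  have hE : Continuous fun t => we (dil s seB) (u t) (η t) := by
    rw [← continuousOn_univ]
    exact continuous_we continuousOn_const h.continuous_u h.continuous_eta
  have hE0 : ∀ t, 0 ≤ we (dil s seB) (u t) (η t) := fun t => we_nonneg (seB_dil_nonneg s) _ _
  obtain ⟨h1, h2⟩ := integrable_of_le_deriv (T := 2) (B := N ^ 2)
    (g := fun t => κ * (Real.exp s * we (dil s seB) (u t) (η t)))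
    (fun t _ => mul_nonneg hκ.le (mul_nonneg hp.le (hE0 t)))
    (continuous_const.mul (continuous_const.mul hE)).continuousOn
    (fun t _ => h.hasDerivAt_virial k (isWeight_dil_thB s) (isWeight_dil_seB s) t)
    (fun t _ => hrate t)
    (fun t _ => (abs_virial_le hk ((norm_dil_le _ _).trans norm_thB_le) (norm_weight_le hs) _ _).trans
      (pow_le_pow_left₀ (Real.sqrt_nonneg _) (hN t) 2))
  have e : ∀ t, we (dil s seB) (u t) (η t)
      = (κ * Real.exp s)⁻¹ * (κ * (Real.exp s * we (dil s seB) (u t) (η t))) := fun t => by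
    field_simp
  constructor
  · rw [funext e]
    exact h1.const_mul _
  · rw [integral_congr_ae (Eventually.of_forall e), integral_const_mul]
    refine (mul_le_mul_of_nonneg_left h2 (by positivity)).trans (le_of_eq ?_)
    field_simp

/-- Integrated decay at the growing scale. -/
theorem exists_growing_bound {C₀ k κ δ₀ : ℝ} (hC : 0 < C₀) (hk : |k| ≤ 1) (hκ : 0 < κ)
    (hδ : 0 < δ₀) : ∃ C > 0, ∀ (a c N : ℝ) (u η : ℝ → H1), IsGlobalSolution a c u η →
      (∀ t, pairNorm (u t) (η t) ≤ N) →
      (∀ s, Real.exp s ≤ δ₀ → ∀ t, κ * (Real.exp s * we (dil s seB) (u t) (η t)) ≤ virialRate k a c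
        (Real.exp s • dil s seB) ((-2 * Real.exp s ^ 2) • (dil s seB * dil s thB)) (u t) (η t)) →
      IntegrableOn (fun t => Real.exp (logScale C₀ t)
          * we (dil (logScale C₀ t) seB) (u t) (η t)) (Ioi 2) ∧
        ∫ t in Ioi (2 : ℝ), Real.exp (logScale C₀ t)
          * we (dil (logScale C₀ t) seB) (u t) (η t) ≤ C * N ^ 2 := by
  have hcs : ContinuousOn (logScale C₀) (Ici 2) := fun t ht =>
    (hasDerivAt_logScale C₀ (by have := mem_Ici.1 ht; linarith)).continuousAt.continuousWithinAt
  -- Past `T` the scale is large enough for coercivity, T ≥ 3 > e gives log t ≥ 1, and T ≥ 2/κ makes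
  -- 1/t ≤ κ/2.
  obtain ⟨T, hT⟩ := eventually_atTop.1 (((tendsto_exp_logScale hC).eventually_le_const
    (lt_min one_pos hδ)).and (eventually_ge_atTop (max 3 (2 / κ))))
  have hT3 : 3 ≤ T := (le_max_left _ _).trans (hT T le_rfl).2
  obtain ⟨P, hP⟩ := (isCompact_Icc (a := (2 : ℝ)) (b := T)).exists_bound_of_continuousOn
    ((Real.continuous_exp.comp_continuousOn hcs).mono Icc_subset_Ici_self)
  have hP0 : 0 ≤ P := (norm_nonneg _).trans (hP 2 ⟨le_rfl, by linarith⟩)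
  refine ⟨P * (T - 2) + 4 / κ * (1 + 9 * C₀ / κ), ?_, fun a c N u η h hN hrate => ?_⟩
  · have : 0 ≤ P * (T - 2) := mul_nonneg hP0 (by linarith)
    positivity
  set s := logScale C₀ with hs
  set E : ℝ → ℝ := fun t => we (dil (s t) seB) (u t) (η t) with hEd
  have hE0 : ∀ t, 0 ≤ E t := fun t => we_nonneg (seB_dil_nonneg _) _ _
  have hdil : Continuous fun r => dil r seB := continuous_iff_continuousAt.2 fun r =>
    (hasDerivAt_dil_seB r).continuousAt
  have hEc : ContinuousOn E (Ici 2) :=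
    continuous_we (hdil.comp_continuousOn hcs) h.continuous_u h.continuous_eta
  have hN0 : 0 ≤ N := (Real.sqrt_nonneg _).trans (hN 0)
  have hn2 : ∀ t, pairNorm (u t) (η t) ^ 2 ≤ N ^ 2 := fun t =>
    pow_le_pow_left₀ (Real.sqrt_nonneg _) (hN t) 2
  set G := 9 * C₀ / κ * N ^ 2 with hG
  have hG0 : 0 ≤ G := by positivity
  have hgc : ContinuousOn (fun t => κ / 2 * (Real.exp (s t) * E t)) (Ici 2) :=
    continuousOn_const.mul ((Real.continuous_exp.comp_continuousOn hcs).mul hEc)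
  -- The virial functional is corrected by -G/log t, whose derivative G/(t log² t) compensates the
  -- part of the moving-weight error that cannot be absorbed.
  have hmain := integrable_of_le_deriv_of_le (T₁ := 2) (T := T)
    (A := κ / 2 * (P * N ^ 2)) (B := N ^ 2 + G)
    (g := fun t => κ / 2 * (Real.exp (s t) * E t))
    (K := fun t => virial k (dil (s t) thB) (Real.exp (s t) • dil (s t) seB) (u t) (η t)
      - G * (Real.log t)⁻¹)
    (K' := fun t => (2 * (t⁻¹ / Real.log t) - t⁻¹) * virial k (dil (s t) thxB)
        (Real.exp (s t) • (dil (s t) seB + dil (s t) sexB)) (u t) (η t)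
      + virialRate k a c (Real.exp (s t) • dil (s t) seB)
          ((-2 * Real.exp (s t) ^ 2) • (dil (s t) seB * dil (s t) thB)) (u t) (η t)
      - G * (-t⁻¹ / Real.log t ^ 2))
    (by linarith)
    (fun t _ => mul_nonneg (by positivity) (mul_nonneg (Real.exp_pos _).le (hE0 t))) hgc
    (fun t h2 hTt => ?_) (fun t ht => ?_) (fun t ht => ?_) (fun t ht => ?_)
  · obtain ⟨h1, h2⟩ := hmain
    have e : ∀ t, Real.exp (s t) * E t = 2 / κ * (κ / 2 * (Real.exp (s t) * E t)) := fun t => by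
      field_simp
    constructor
    · change IntegrableOn (fun t => Real.exp (s t) * E t) _
      rw [show (fun t => Real.exp (s t) * E t)
        = fun t => 2 / κ * (κ / 2 * (Real.exp (s t) * E t)) from funext e]
      exact h1.const_mul _
    · change ∫ t in Ioi 2, Real.exp (s t) * E t ≤ _
      rw [integral_congr_ae (Eventually.of_forall e), integral_const_mul]
      refine (mul_le_mul_of_nonneg_left h2 (by positivity)).trans (le_of_eq ?_)
      rw [hG]
      field_simp
      ring
  · have p1 := (le_abs_self _).trans (hP t ⟨h2, hTt⟩)
    have p2 : E t ≤ N ^ 2 := (we_le _ _ _).trans (hn2 t)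
    exact mul_le_mul_of_nonneg_left (mul_le_mul p1 p2 (hE0 t) hP0) (by positivity)
  · have ht1 : 1 < t := by linarith
    have hl := Real.log_pos ht1
    exact (h.hasDerivAt_virial_dil k (hasDerivAt_logScale C₀ ht1)).sub
      (((Real.hasDerivAt_log (by linarith)).inv hl.ne').const_mul G)
  · obtain ⟨q1, q2⟩ := hT t ht
    have ht1 : 1 < t := by linarith
    have ht0 : 0 < t := by linarith
    have hl := Real.log_pos ht1
    have hexp : Real.exp 1 ≤ t := by
      have := Real.exp_one_lt_d9; linarith
    have hr := hrate (s t) (q1.trans (min_le_right _ _)) t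
    have hμ1 : Real.exp (s t) ≤ 1 := q1.trans (min_le_left _ _)
    -- With this `θ` the error 3θ/(2t) equals κ/4 times eˢ, hence absorbable, while the remainder
    -- 3N²/(2θt) = 9N²/(κt²eˢ) equals 9C₀N²/(κ t log² t), which fixes `G`.
    have hθ : 0 < κ / 6 * (t * Real.exp (s t)) := by positivity
    have hm := abs_virial_moving_le (U := u t) (E := η t) hk hμ1 hθ
    have hd := abs_deriv_logScale_le hexp
    set V := virial k (dil (s t) thxB) (Real.exp (s t) • (dil (s t) seB + dil (s t) sexB))
      (u t) (η t)
    have m1 := (abs_le.1 ((abs_mul _ V).le.trans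
      (mul_le_mul hd hm (abs_nonneg _) (by positivity)))).1
    have q3 : 2 / κ ≤ t := (le_max_right _ _).trans q2
    have q4 : t⁻¹ ≤ κ / 2 := by
      rw [inv_le_comm₀ ht0 (by positivity), inv_div]; exact q3
    have hE := hE0 t
    have hμ := Real.exp_pos (s t)
    have m2 : t⁻¹ * ((3 * (κ / 6 * (t * Real.exp (s t))) + Real.exp (s t)) / 2 * E t)
        ≤ κ / 2 * (Real.exp (s t) * E t) := by
      have e1 : t⁻¹ * ((3 * (κ / 6 * (t * Real.exp (s t))) + Real.exp (s t)) / 2 * E t)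
        = κ / 4 * (Real.exp (s t) * E t) + t⁻¹ * (1 / 2 * (Real.exp (s t) * E t)) := by
        field_simp; ring
      rw [e1]
      have := mul_le_mul_of_nonneg_right q4
        (by positivity : 0 ≤ 1 / 2 * (Real.exp (s t) * E t))
      linarith
    have m3 : t⁻¹ * (3 / (2 * (κ / 6 * (t * Real.exp (s t)))) * pairNorm (u t) (η t) ^ 2)
        ≤ G * (t⁻¹ / Real.log t ^ 2) := by
      have e1 : t⁻¹ * (3 / (2 * (κ / 6 * (t * Real.exp (s t)))) * pairNorm (u t) (η t) ^ 2)
        = 9 * C₀ / κ * pairNorm (u t) (η t) ^ 2 * (t⁻¹ / Real.log t ^ 2) := by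
        rw [hs, exp_logScale hC ht1]
        field_simp
        ring
      rw [e1, hG]
      refine mul_le_mul_of_nonneg_right (mul_le_mul_of_nonneg_left (hn2 t) (by positivity))
        (by positivity)
    have e5 : G * (-t⁻¹ / Real.log t ^ 2) = -(G * (t⁻¹ / Real.log t ^ 2)) := by ring
    rw [e5]
    change κ * (Real.exp (s t) * E t) ≤ _ at hr
    change -(t⁻¹ * (_ * E t + _)) ≤ _ at m1
    rw [mul_add] at m1
    linarith
  · obtain ⟨q1, q2⟩ := hT t ht
    have hexp : Real.exp 1 ≤ t := by
      have := Real.exp_one_lt_d9; linarith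
    have h1 : 1 ≤ Real.log t := (Real.le_log_iff_exp_le (by linarith)).2 hexp
    have h2 : (Real.log t)⁻¹ ≤ 1 := inv_le_one_of_one_le₀ h1
    have hv := abs_virial_le hk ((norm_dil_le (s t) _).trans norm_thB_le)
      (norm_weight_le (q1.trans (min_le_left _ _))) (u t) (η t)
    refine (abs_sub _ _).trans (add_le_add (hv.trans (hn2 t)) ?_)
    rw [abs_mul, abs_of_nonneg hG0, abs_of_nonneg (by positivity)]
    exact mul_le_of_le_one_right hG0 h2

end

theorem norm_toB_le_pairNorm (U E : H1) : ‖toB U‖ ≤ pairNorm U E :=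
  (norm_toB_le U).trans (Real.le_sqrt_of_sq_le (by nlinarith [sq_nonneg ‖E‖]))

end ABCDBoussinesq

end

/-! ### Conclusion at both scales. -/

open ABCDBoussinesq

theorem proposition5p1 (a b c : ℝ) (habc : ABCDBoussinesq.DispersionLike a b c) :
    ∃ ε₀ : ℝ, 0 < ε₀ ∧
      -- fixed large scale
      (∃ ℓ₀ : ℝ, 0 < ℓ₀ ∧ ∃ C : ℝ, 0 < C ∧ ∀ ℓ : ℝ, ℓ₀ ≤ ℓ → ∀ ε : ℝ, 0 < ε → ε ≤ ε₀ →
        ∀ u η : ℝ → ABCDBoussinesq.H1, ABCDBoussinesq.IsGlobalSolution a c u η →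
          ABCDBoussinesq.pairNorm (u 0) (η 0) < ε →
          (IntegrableOn (fun t => ABCDBoussinesq.localEnergy ℓ (u t) (η t)) (Ioi 2) ∧
            ∫ t in Ioi (2 : ℝ), ABCDBoussinesq.localEnergy ℓ (u t) (η t) ≤ C * ℓ * ε ^ 2) ∧
          ∃ τ : ℕ → ℝ, StrictMono τ ∧ (∀ n, 2 ≤ τ n) ∧ Tendsto τ atTop atTop ∧
            Tendsto (fun n => ABCDBoussinesq.localEnergy ℓ (u (τ n)) (η (τ n))) atTop (𝓝 0)) ∧
      -- time-dependent scale
      (∀ C₀ : ℝ, 0 < C₀ → ∃ C : ℝ, 0 < C ∧ ∀ ε : ℝ, 0 < ε → ε ≤ ε₀ →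
        ∀ u η : ℝ → ABCDBoussinesq.H1, ABCDBoussinesq.IsGlobalSolution a c u η →
          ABCDBoussinesq.pairNorm (u 0) (η 0) < ε →
          (IntegrableOn (fun t => 1 / ABCDBoussinesq.growingScale C₀ t *
              ABCDBoussinesq.localEnergy (ABCDBoussinesq.growingScale C₀ t) (u t) (η t))
              (Ioi 2) ∧
            ∫ t in Ioi (2 : ℝ), 1 / ABCDBoussinesq.growingScale C₀ t *
              ABCDBoussinesq.localEnergy (ABCDBoussinesq.growingScale C₀ t) (u t) (η t)
              ≤ C * ε ^ 2) ∧
          ∃ τ : ℕ → ℝ, StrictMono τ ∧ (∀ n, 2 ≤ τ n) ∧ Tendsto τ atTop atTop ∧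
            Tendsto (fun n => ABCDBoussinesq.localEnergy
              (ABCDBoussinesq.growingScale C₀ (τ n)) (u (τ n)) (η (τ n))) atTop (𝓝 0)) := by
  obtain ⟨k, κ, δ₀, hk, hκ, hδ₀, H⟩ := exists_virialRate_ge habc.a_neg habc.c_neg habc.dispersion
  obtain ⟨ε₁, hε₁, A, hA, HA⟩ := exists_uniform_bound habc.a_neg habc.c_neg
  have hA0 : 0 < A := by linarith
  have hrate : ∀ ε, 0 < ε → ε ≤ min ε₁ (δ₀ / A) → ∀ u η : ℝ → H1,
      (∀ t, pairNorm (u t) (η t) ≤ A * ε) → ∀ s, Real.exp s ≤ δ₀ / 2 → ∀ t,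
      κ * (Real.exp s * we (dil s seB) (u t) (η t)) ≤ virialRate k a c
        (Real.exp s • dil s seB) ((-2 * Real.exp s ^ 2) • (dil s seB * dil s thB))
        (u t) (η t) := fun ε hε hεε u η hN s hs t => by
    have hp := Real.exp_pos s
    rw [← we_smul]
    refine H _ _ (2 * Real.exp s) (A * ε) (isWeight_dil_seB s)
      (fun x => mul_nonneg hp.le (seB_dil_nonneg s x)) (by positivity) (by linarith)
      (abs_deriv_weight_le s) (by positivity) ?_ _ _ ((norm_toB_le_pairNorm _ _).trans (hN t))
    have := (le_div_iff₀ hA0).1 (hεε.trans (min_le_right _ _))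
    linarith
  -- ε ≤ δ₀/A bounds ‖u‖_∞ by Aε ≤ δ₀; ℓ ≥ 2/δ₀ makes the relative variation 2/ℓ of the weight at
  -- most δ₀, and ℓ ≥ 1 keeps the weight φ' bounded by 1.
  refine ⟨min ε₁ (δ₀ / A), lt_min hε₁ (by positivity),
    ⟨max 1 (2 / δ₀), by positivity, 2 / κ * A ^ 2, by positivity,
      fun ℓ hℓ ε hε hεε u η h h0 => ?_⟩, fun C₀ hC₀ => ?_⟩
  · have hN := HA ε hε (hεε.trans (min_le_left _ _)) u η h h0
    have hℓ1 : 1 ≤ ℓ := (le_max_left _ _).trans hℓ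
    have hℓ0 : 0 < ℓ := by linarith
    have hexp : Real.exp (-Real.log ℓ) = ℓ⁻¹ := by rw [Real.exp_neg, Real.exp_log hℓ0]
    have hexp' : (Real.exp (-Real.log ℓ))⁻¹ = ℓ := by rw [hexp, inv_inv]
    have hle : ∀ U E, localEnergy ℓ U E = we (dil (-Real.log ℓ) seB) U E := fun U E => by
      rw [← localEnergy_eq, hexp']
    have hs1 : Real.exp (-Real.log ℓ) ≤ 1 := hexp ▸ inv_le_one_of_one_le₀ hℓ1
    have hs2 : Real.exp (-Real.log ℓ) ≤ δ₀ / 2 := by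
      rw [hexp, inv_le_comm₀ hℓ0 (by positivity), inv_div]
      exact (le_max_right _ _).trans hℓ
    obtain ⟨h1, h2⟩ := h.integral_localEnergy_le hk hκ hs1 hN (hrate ε hε hεε u η hN _ hs2)
    simp only [hle]
    refine ⟨⟨h1, h2.trans (le_of_eq ?_)⟩, exists_seq_tendsto_zero one_pos two_pos
      (fun t _ => we_nonneg (seB_dil_nonneg _) _ _) (fun t ht => ?_) h1⟩
    · rw [hexp']; ring
    · rw [one_mul]
      exact mul_le_of_le_one_left (we_nonneg (seB_dil_nonneg _) _ _)
        (inv_le_one_of_one_le₀ (by linarith))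
  · obtain ⟨C, hC, HC⟩ := exists_growing_bound hC₀ hk hκ (half_pos hδ₀)
    refine ⟨C * A ^ 2, by positivity, fun ε hε hεε u η h h0 => ?_⟩
    have hN := HA ε hε (hεε.trans (min_le_left _ _)) u η h h0
    obtain ⟨h1, h2⟩ := HC a c (A * ε) u η h hN (hrate ε hε hεε u η hN)
    have hle : ∀ t, 2 ≤ t → localEnergy (growingScale C₀ t) (u t) (η t)
        = we (dil (logScale C₀ t) seB) (u t) (η t) := fun t ht => by
      rw [growingScale_eq hC₀ (by linarith), localEnergy_eq]
    have heq : EqOn (fun t => Real.exp (logScale C₀ t)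
          * we (dil (logScale C₀ t) seB) (u t) (η t))
        (fun t => 1 / growingScale C₀ t * localEnergy (growingScale C₀ t) (u t) (η t))
        (Ioi 2) := fun t ht => by
      have ht2 : 2 < t := ht
      change _ = 1 / growingScale C₀ t * localEnergy (growingScale C₀ t) (u t) (η t)
      rw [hle t ht2.le, growingScale_eq hC₀ (by linarith), one_div, inv_inv]
    -- The density 1/λ(t) = log² t/(C₀t) is at least (log² 2/C₀)/t for t ≥ 2.
    refine ⟨⟨h1.congr_fun heq measurableSet_Ioi, ?_⟩, exists_seq_tendsto_zero
      (f := fun t => localEnergy (growingScale C₀ t) (u t) (η t))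
      (k := Real.log 2 ^ 2 / C₀) (by have := Real.log_pos one_lt_two; positivity) two_pos
      (fun t ht => ?_) (fun t ht => ?_) h1⟩
    · rw [← setIntegral_congr_fun measurableSet_Ioi heq]
      exact h2.trans (le_of_eq (by ring))
    · rw [hle t ht]
      exact we_nonneg (seB_dil_nonneg _) _ _
    · rw [hle t ht]
      refine mul_le_mul_of_nonneg_right ?_ (we_nonneg (seB_dil_nonneg _) _ _)
      rw [exp_logScale hC₀ (by linarith), ← div_eq_mul_inv, div_div]
      have hl := Real.log_pos one_lt_two
      have := Real.log_le_log two_pos ht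
      gcongr
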